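/- **Setting.** For every security parameter $k$ let a group description be drawn from a distribution $\mathsf{gen}(k)$: a cyclic group $G=\langle g\rangle$ of prime order $q$, whose elements are represented injectively by bit strings; the representations and the public group description have length polynomial in $k$ (for example, quadratic residues modulo a prime $p=2q+1$). Let $n(k)$ be the number of servers and $t(k)$ the threshold, with $1\le t(k)\le n(k)$, $n(k)$ polynomially bounded, and $n,t$ computable in time polynomial in $k$. Algorithms are uniform probabilistic algorithms with a step count, which may use uniform sampling below a given number, the group operation, and the conversion between elements and representations; an interactive algorithm is polynomial time if its total number of steps is bounded by a polynomial in $k$ for all random choices and all well-formed answers it may get (a possible ciphertext with $n$ possible decryption shares; the empty answer is also allowed in challenge steps). **DDH assumption.** For uniform $\alpha,\beta,\gamma\in\mathbb Z_q$, no polynomial time algorithm, given $k$ and the group, distinguishes $(g^\alpha,g^\beta,g^{\alpha\beta})$ from $(g^\alpha,g^\beta,g^{\gamma})$ with non-negligible advantage. **Modified threshold ElGamal.** Key generation picks uniform $a_0,\dots,a_{t-1}\in\mathbb Z_q$ and uniform $x_1,\dots,x_n\in\mathbb Z_q$; with $f(x)=\sum_{j<t}a_jx^j$, the secret key is $\alpha=f(0)$,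 the public key is $(q,g,h=g^\alpha)$ and the group description, the points $x_1,\dots,x_n$ are public, and the share of server $i$ is $\alpha_i=f(x_i)$. Encryption of $m\in G$ is $(g^r,mh^r)$ for uniform $r\in\mathbb Z_q$. The partial decryption of $(a,b)$ with share $s$ is $a^{s}$, without validity proof. Combination interpolates in the exponent over all sets of $t$ different points. **Oracles.** After key generation, let - $S(m)$ return an encryption $c$ of $m$ and all $n$ correct partial decryptions of $c$; - $I(m,i_1,\dots,i_{t-1})$, for $t-1$ different indices in $\{1,\dots,n\}$, return an encryption $c$ of $m$ and $n$ partial decryptions of $c$, where the one of server $i$ is made with $\alpha_i$ if $i\in\{i_1,\dots,i_{t-1}\}$ and with a fresh uniform $r_i\in\mathbb Z_q$ otherwise; - $F(m)$ return an encryption $c$ of $m$ and $n$ partial decryptions of $c$, all made with fresh uniform $r_i\in\mathbb Z_q$. **Game 1.** A bit $b$ is chosen uniformly. The adversary gets $k,n,t$, the public key and $x_1,\dots,x_n$, and calls $S$ on messages of its choice as many times as it wishes. It chooses $m_0,m_1\in G$. Then, as many times as it wishes, it chooses $t-1$ different indices and gets $I(m_b,i_1,\dots,i_{t-1})$ (a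 malformed index list gets an empty answer). Finally it may call $S$ again as many times as it wishes, and outputs a guess of $b$. All choices may be adaptive. **Game 2.** The same, except that the adversary chooses a single message $m\in G$, and each challenge answer is $I(m,i_1,\dots,i_{t-1})$ if $b=0$ and $F(m)$ if $b=1$. **Theorem.** Under the DDH assumption for $\mathsf{gen}$, the modified threshold ElGamal scheme is equivocable: for every polynomial time adversary in Game 1, and for every polynomial time adversary in Game 2, the advantage $\left|\Pr[\text{the guess equals } b]-\tfrac12\right|$ is negligible in $k$. -/

import Mathlib

noncomputable section

/-! ### Groups of prime order -/

/-- A concretely represented cyclic group `G = ⟨g⟩` of prime order `q`: every element is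
represented by a natural number (a bit string) through the injection `enc`, and `desc` is the
public description of the group (for instance the modulus `p` for the quadratic residues
modulo `p = 2 q + 1`). -/
structure GroupInst where
  G : Type
  [grp : CommGroup G]
  q : ℕ
  [prime : Fact q.Prime]
  card_eq : Nat.card G = q
  g : G
  g_gen : ∀ x : G, x ∈ Subgroup.zpowers g
  enc : G → ℕ
  enc_injective : Function.Injective enc
  desc : ℕ

attribute [instance] GroupInst.grp GroupInst.prime

open Classical in
/-- The group element represented by a number (the neutral element if there is none). -/
def GroupInst.dec (P : GroupInst) (x : ℕ) : P.G :=
  if h : ∃ a : P.G, P.enc a = x then h.choose else 1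

/-- In a group family (for security parameter `k` the group is drawn from `gen k`), the group
description and the representations of group elements have length polynomial in `k`. -/
def PolySize (gen : ℕ → PMF GroupInst) : Prop :=
  ∃ T : Polynomial ℕ, ∀ k, ∀ P ∈ (gen k).support,
    Nat.size P.desc ≤ T.eval k ∧ ∀ x : P.G, Nat.size (P.enc x) ≤ T.eval k

/-! ### Probabilistic oracle programs with a step count

A typed language of loop programs over natural numbers, group elements, pairs and lists, with
logarithmic cost: an arithmetic or group instruction costs one plus the bit lengths of its
operands, structural instructions cost one step, and every pass through a loop costs
at least one step. Since all running times below are bounded by a polynomial, bounded loops are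
as good as unbounded ones. For groups whose operations and membership test are polynomial time on
representations (as for quadratic residues modulo a prime), having the group operations as
instructions changes running times only by a polynomial. -/

/-- Data types of the language. -/
inductive Ty : Type
  | unit : Ty
  | nat : Ty
  | grp : Ty
  | prod : Ty → Ty → Ty
  | list : Ty → Ty

/-- The values of a data type, over a given group. -/
@[reducible] def Ty.val (P : GroupInst) : Ty → Type
  | .unit => Unit
  | .nat => ℕ
  | .grp => P.G
  | .prod a b => Ty.val P a × Ty.val P b
  | .list a => List (Ty.val P a)

/-- Arithmetic instructions (`sub` is truncated, `x / 0 = 0`, `x % 0 = x`). -/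
inductive Arith : Type
  | add | sub | mul | div | mod

def Arith.eval : Arith → ℕ → ℕ → ℕ
  | .add, x, y => x + y
  | .sub, x, y => x - y
  | .mul, x, y => x * y
  | .div, x, y => x / y
  | .mod, x, y => x % y

/-- `Prog Q R a b`: programs with input of type `a`, output of type `b`, and an oracle that
takes queries of type `Q` and gives answers of type `R`. -/
inductive Prog (Q R : Ty) : Ty → Ty → Type
  | id {a : Ty} : Prog Q R a a
  | comp {a b c : Ty} : Prog Q R a b → Prog Q R b c → Prog Q R a c
  | unit {a : Ty} : Prog Q R a .unit
  | pair {a b c : Ty} : Prog Q R a b → Prog Q R a c → Prog Q R a (.prod b c)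
  | fst {a b : Ty} : Prog Q R (.prod a b) a
  | snd {a b : Ty} : Prog Q R (.prod a b) b
  /-- a numerical constant -/
  | lit {a : Ty} : ℕ → Prog Q R a .nat
  | arith : Arith → Prog Q R (.prod .nat .nat) .nat
  /-- runs the first program if the number is nonzero, the second one if it is zero -/
  | ite {a b : Ty} : Prog Q R a b → Prog Q R a b → Prog Q R (.prod .nat a) b
  | nil {a b : Ty} : Prog Q R a (.list b)
  | cons {b : Ty} : Prog Q R (.prod b (.list b)) (.list b)
  /-- case distinction on a list: empty, or head and tail -/
  | lcase {a b c : Ty} : Prog Q R a c → Prog Q R (.prod (.prod b (.list b)) a) c →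
      Prog Q R (.prod (.list b) a) c
  /-- on input `(n, x)`, applies the program `n` times to `x` -/
  | loop {a : Ty} : Prog Q R a a → Prog Q R (.prod .nat a) a
  | gone {a : Ty} : Prog Q R a .grp
  | gmul : Prog Q R (.prod .grp .grp) .grp
  /-- the representation of a group element -/
  | enc : Prog Q R .grp .nat
  /-- the group element with a given representation -/
  | dec : Prog Q R .nat .grp
  /-- on input `n`, a fresh uniformly random element of `{0, …, n - 1}` -/
  | rand : Prog Q R .nat .nat
  /-- an oracle call -/
  | call : Prog Q R Q R

/-- The uniform distribution on `{0, …, n - 1}` (the point mass at `0` if `n = 0`). -/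
def uniformBelow : ℕ → PMF ℕ
  | 0 => PMF.pure 0
  | n + 1 => (PMF.uniformOfFintype (Fin (n + 1))).map Fin.val

/-- `n`-fold iteration of a randomized map with costs. -/
def iterateCost {α : Type} (f : α → PMF (α × ℕ)) : ℕ → α → PMF (α × ℕ)
  | 0, x => PMF.pure (x, 1)
  | n + 1, x => (f x).bind fun y => (iterateCost f n y.1).map fun z => (z.1, y.2 + z.2 + 1)

/-- Joint distribution of the output and of the number of steps of a program that is run with
oracle `O`. All random choices and all oracle calls are independent given their arguments. -/
def Prog.run {Q R : Ty} (P : GroupInst) (O : Q.val P → PMF (R.val P)) :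
    {a b : Ty} → Prog Q R a b → a.val P → PMF (b.val P × ℕ)
  | _, _, .id, x => PMF.pure (x, 1)
  | _, _, .comp f g, x =>
      (Prog.run P O f x).bind fun y => (Prog.run P O g y.1).map fun z => (z.1, y.2 + z.2 + 1)
  | _, _, .unit, _ => PMF.pure ((), 1)
  | _, _, .pair f g, x =>
      (Prog.run P O f x).bind fun y =>
        (Prog.run P O g x).map fun z => ((y.1, z.1), y.2 + z.2 + 1)
  | _, _, .fst, x => PMF.pure (x.1, 1)
  | _, _, .snd, x => PMF.pure (x.2, 1)
  | _, _, .lit n, _ => PMF.pure (n, 1 + Nat.size n)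
  | _, _, .arith op, x => PMF.pure (op.eval x.1 x.2, 1 + Nat.size x.1 + Nat.size x.2)
  | _, _, .ite f g, x =>
      (match x.1 with
        | 0 => Prog.run P O g x.2
        | _ + 1 => Prog.run P O f x.2).map (Prod.map (fun y => y) Nat.succ)
  | _, _, .nil, _ => PMF.pure ([], 1)
  | _, _, .cons, x => PMF.pure (x.1 :: x.2, 1)
  | _, _, .lcase f g, x =>
      (match x.1 with
        | [] => Prog.run P O f x.2
        | y :: ys => Prog.run P O g ((y, ys), x.2)).map (Prod.map (fun y => y) Nat.succ)
  | _, _, .loop f, x => iterateCost (Prog.run P O f) x.1 x.2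
  | _, _, .gone, _ => PMF.pure ((1 : P.G), 1)
  | _, _, .gmul, x =>
      PMF.pure ((x.1 * x.2 : P.G), 1 + Nat.size (P.enc x.1) + Nat.size (P.enc x.2))
  | _, _, .enc, x => PMF.pure (P.enc x, 1 + Nat.size (P.enc x))
  | _, _, .dec, x => PMF.pure (P.dec x, 1 + Nat.size x)
  | _, _, .rand, x => (uniformBelow x).map fun y => (y, 1 + Nat.size x)
  | _, _, .call, x => (O x).map fun y => (y, 1)

/-- Programs without oracle: the oracle takes and gives no information. -/
abbrev PlainProg (a b : Ty) : Type := Prog .unit .unit a b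

def PlainProg.run (P : GroupInst) {a b : Ty} (p : PlainProg a b) (x : a.val P) :
    PMF (b.val P × ℕ) :=
  Prog.run (Q := .unit) (R := .unit) P (fun _ => PMF.pure ()) p x

/-- A function `ℕ → ℕ` whose value at `k` can be computed in time polynomial in `k`. -/
def PolyTimeComputable (f : ℕ → ℕ) : Prop :=
  ∃ (p : PlainProg .nat .nat) (T : Polynomial ℕ), ∀ (k : ℕ) (P : GroupInst),
    ∀ o ∈ (p.run P k).support, o.1 = f k ∧ o.2 ≤ T.eval k

/-- Negligible functions: those that vanish faster than every inverse polynomial. -/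
def Negligible (f : ℕ → ℝ) : Prop :=
  Asymptotics.SuperpolynomialDecay Filter.atTop (fun k : ℕ => (k : ℝ)) f

/-! ### The Decision Diffie–Hellman assumption -/

/-- Input of a DDH distinguisher: `(k, (desc, q, g), (g^α, g^β, g^γ))`. -/
abbrev ddhTy : Ty :=
  .prod .nat (.prod (.prod .nat (.prod .nat .grp)) (.prod .grp (.prod .grp .grp)))

def ddhInput (P : GroupInst) (k : ℕ) (x y z : P.G) : ddhTy.val P :=
  (k, (P.desc, P.q, P.g), (x, y, z))

/-- `g ^ a` for an exponent `a` modulo `q`. -/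
def GroupInst.gpow (P : GroupInst) (a : ZMod P.q) : P.G := P.g ^ a.val

/-- Output of a distinguisher on a random Diffie–Hellman triple (`real = true`), or on a
triple whose third component is an independent uniform element of the group. -/
def ddhExp (gen : ℕ → PMF GroupInst) (D : PlainProg ddhTy .nat) (k : ℕ) (real : Bool) :
    PMF ℕ :=
  (gen k).bind fun P =>
    (PMF.uniformOfFintype (ZMod P.q)).bind fun α =>
    (PMF.uniformOfFintype (ZMod P.q)).bind fun β =>
    (PMF.uniformOfFintype (ZMod P.q)).bind fun γ =>
      (D.run P (ddhInput P k (P.gpow α) (P.gpow β)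
        (P.gpow (if real then α * β else γ)))).map fun o => o.1

def ddhAdvantage (gen : ℕ → PMF GroupInst) (D : PlainProg ddhTy .nat) (k : ℕ) : ℝ :=
  |(ddhExp gen D k true 1).toReal - (ddhExp gen D k false 1).toReal|

/-- The DDH assumption for the group family `gen`: no polynomial time algorithm distinguishes
`(g^α, g^β, g^(αβ))` from `(g^α, g^β, g^γ)` with non-negligible advantage. -/
def DDH (gen : ℕ → PMF GroupInst) : Prop :=
  ∀ D : PlainProg ddhTy .nat,
    (∃ T : Polynomial ℕ, ∀ k, ∀ P ∈ (gen k).support, ∀ x y z : P.G,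
      ∀ o ∈ (D.run P (ddhInput P k x y z)).support, o.2 ≤ T.eval k) →
    Negligible (ddhAdvantage gen D)

/-! ### Threshold encryption without validity proofs -/

/-- A threshold encryption scheme without verification keys and validity proofs. `PK`, `M`, `C`
and `D` are the data types of public keys, plaintexts, ciphertexts and decryption shares, and
`SK P` is the set of private key shares. Key generation consists of drawing the group
(`setup`, from the security parameter) and drawing the keys (`KG`, from the number `n` of
servers and the threshold `t`). Oracle queries number the servers from `1` to `n`; here they are
indexed by `Fin n`. The combining algorithm tries all sets of `t` shares; its value is the set of
decryptions that these yield. -/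
structure TEScheme where
  PK : Ty
  M : Ty
  C : Ty
  D : Ty
  SK : GroupInst → Type
  [skFintype : ∀ P, Fintype (SK P)]
  [skNonempty : ∀ P, Nonempty (SK P)]
  setup : ℕ → PMF GroupInst
  KG : (P : GroupInst) → (n t : ℕ) → PMF (PK.val P × (Fin n → SK P))
  Enc : (P : GroupInst) → PK.val P → M.val P → PMF (C.val P)
  SD : (P : GroupInst) → {n : ℕ} → PK.val P → Fin n → SK P → C.val P → D.val P
  CM : (P : GroupInst) → (n t : ℕ) → PK.val P → C.val P → (Fin n → D.val P) → Set (M.val P)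

attribute [instance] TEScheme.skFintype TEScheme.skNonempty

namespace TEScheme

/-- Data type of an answer of the key owner: a ciphertext and a list of decryption shares. -/
abbrev Ans (E : TEScheme) : Ty := .prod E.C (.list E.D)

/-- The procedure `S(m)`: an encryption of `m` and all correct decryption shares. -/
def oracleS (E : TEScheme) (P : GroupInst) {n : ℕ} (pk : E.PK.val P) (sk : Fin n → E.SK P)
    (m : E.M.val P) : PMF (E.Ans.val P) :=
  (E.Enc P pk m).map fun c => (c, List.ofFn fun i => E.SD P pk i (sk i) c)

/-- The procedure `I(m, i₁, …, i_{t-1})`: an encryption of `m`, the correct decryption shares of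
the listed servers, and for all other servers shares that are made with fresh random keys. -/
def oracleI (E : TEScheme) (P : GroupInst) {n : ℕ} (pk : E.PK.val P) (sk : Fin n → E.SK P)
    (m : E.M.val P) (L : List ℕ) : PMF (E.Ans.val P) :=
  (E.Enc P pk m).bind fun c =>
    (PMF.uniformOfFintype (Fin n → E.SK P)).map fun r =>
      (c, List.ofFn fun i : Fin n =>
        E.SD P pk i (if (i : ℕ) + 1 ∈ L then sk i else r i) c)

/-- The procedure `F(m)`: an encryption of `m`, and shares all made with fresh random keys. -/
def oracleF (E : TEScheme) (P : GroupInst) (n : ℕ) (pk : E.PK.val P)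
    (m : E.M.val P) : PMF (E.Ans.val P) :=
  (E.Enc P pk m).bind fun c =>
    (PMF.uniformOfFintype (Fin n → E.SK P)).map fun r =>
      (c, List.ofFn fun i : Fin n => E.SD P pk i (r i) c)

/-- `L` lists `t - 1` different elements of `{1, …, n}`. -/
def ValidIndices (n t : ℕ) (L : List ℕ) : Prop :=
  L.length = t - 1 ∧ L.Nodup ∧ ∀ i ∈ L, 1 ≤ i ∧ i ≤ n

open Classical in
/-- The challenge oracle: a query must consist of `t - 1` different indices (any other query is
answered by the empty list); it is then answered by one sample of `f` (in a one-element list). -/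
def challenge (E : TEScheme) (P : GroupInst) (n t : ℕ) (f : List ℕ → PMF (E.Ans.val P))
    (L : List ℕ) : PMF (List (E.Ans.val P)) :=
  if ValidIndices n t L then (f L).map fun a => [a] else PMF.pure []

/-- Input of a combiner: `((k, n, t), pk)`. -/
abbrev inputTy (E : TEScheme) : Ty := .prod (.prod .nat (.prod .nat .nat)) E.PK

/-- A malicious combiner in a game with challenge data of type `X`. In its first phase it gets
its input and may call `S`; it ends the phase with a state and the challenge data. In the second
phase it may call the challenge oracle. In the third phase it may call `S` again, and it outputs
its guess (`0` stands for `false`, every other number for `true`). -/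
structure Combiner (E : TEScheme) (X : Ty) where
  σ : Ty
  τ : Ty
  phase1 : Prog E.M E.Ans E.inputTy (.prod σ X)
  phase2 : Prog (.list .nat) (.list E.Ans) σ τ
  phase3 : Prog E.M E.Ans τ .nat

/-- The guess and the total number of steps of a combiner, run with given oracles. -/
def Combiner.run {E : TEScheme} {X : Ty} (A : E.Combiner X) (P : GroupInst)
    (O₁ : E.M.val P → PMF (E.Ans.val P))
    (O₂ : X.val P → List ℕ → PMF (List (E.Ans.val P)))
    (O₃ : E.M.val P → PMF (E.Ans.val P)) (x : E.inputTy.val P) : PMF (Bool × ℕ) :=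
  (Prog.run (Q := E.M) (R := E.Ans) P O₁ A.phase1 x).bind fun y =>
    (Prog.run (Q := .list .nat) (R := .list E.Ans) P (O₂ y.1.2) A.phase2 y.1.1).bind fun z =>
      (Prog.run (Q := E.M) (R := E.Ans) P O₃ A.phase3 z.1).map fun o =>
        (o.1 != 0, y.2 + z.2 + o.2)

/-- Well-formed answers: a possible ciphertext together with `n` possible decryption shares. -/
def WellFormed (E : TEScheme) (P : GroupInst) (n t : ℕ) (a : E.Ans.val P) : Prop :=
  (∃ K ∈ (E.KG P n t).support, ∃ m, a.1 ∈ (E.Enc P K.1 m).support) ∧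
  a.2.length = n ∧
  ∀ d ∈ a.2, ∃ K ∈ (E.KG P n t).support, ∃ m, ∃ c ∈ (E.Enc P K.1 m).support,
    ∃ (i : Fin n) (s : E.SK P), d = E.SD P K.1 i s c

/-- A combiner is polynomial time if its total number of steps is at most a polynomial in the
security parameter, whatever its random choices and whatever well-formed answers it gets. -/
def Combiner.PolyTime {E : TEScheme} {X : Ty} (A : E.Combiner X) (n t : ℕ → ℕ) : Prop :=
  ∃ T : Polynomial ℕ, ∀ k, ∀ P ∈ (E.setup k).support,
    ∀ K ∈ (E.KG P (n k) (t k)).support,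
    ∀ (O₁ : E.M.val P → PMF (E.Ans.val P))
      (O₂ : X.val P → List ℕ → PMF (List (E.Ans.val P)))
      (O₃ : E.M.val P → PMF (E.Ans.val P)),
    (∀ m, ∀ a ∈ (O₁ m).support, E.WellFormed P (n k) (t k) a) →
    (∀ x L, ∀ l ∈ (O₂ x L).support, l.length ≤ 1 ∧ ∀ a ∈ l, E.WellFormed P (n k) (t k) a) →
    (∀ m, ∀ a ∈ (O₃ m).support, E.WellFormed P (n k) (t k) a) →
    ∀ o ∈ (A.run P O₁ O₂ O₃ ((k, n k, t k), K.1)).support, o.2 ≤ T.eval k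

/-- A game between the key owner and a combiner: the owner generates the keys and a uniform
bit `b`; the challenge data `x` of the combiner and the bit determine the challenge oracle.
The outcome tells whether the guess is correct. -/
def game (E : TEScheme) {X : Ty} (A : E.Combiner X) (k n t : ℕ)
    (chal : (P : GroupInst) → E.PK.val P → (Fin n → E.SK P) → Bool → X.val P →
      List ℕ → PMF (E.Ans.val P)) : PMF Bool :=
  (E.setup k).bind fun P =>
    (E.KG P n t).bind fun K =>
      (PMF.uniformOfFintype Bool).bind fun b =>
        (A.run P (E.oracleS P K.1 K.2)
          (fun x => E.challenge P n t (chal P K.1 K.2 b x))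
          (E.oracleS P K.1 K.2) ((k, n, t), K.1)).map fun o => o.1 == b

/-- First game: the combiner chooses `(m₀, m₁)`, and each challenge is `I(m_b, i₁, …)`. -/
def game1 (E : TEScheme) (A : E.Combiner (.prod E.M E.M)) (k n t : ℕ) : PMF Bool :=
  E.game A k n t fun P pk sk b x L => E.oracleI P pk sk (if b then x.2 else x.1) L

/-- Second game: the combiner chooses `m`, and each challenge is `I(m, i₁, …)` if `b = 0` and
`F(m)` if `b = 1`. -/
def game2 (E : TEScheme) (A : E.Combiner E.M) (k n t : ℕ) : PMF Bool :=
  E.game A k n t fun P pk sk b m L =>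
    if b then E.oracleF P n pk m else E.oracleI P pk sk m L

/-- Equivocable security, for `n k` servers and threshold `t k` at security parameter `k`. -/
def Equivocable (E : TEScheme) (n t : ℕ → ℕ) : Prop :=
  (∀ A : E.Combiner (.prod E.M E.M), A.PolyTime n t →
    Negligible fun k => |(E.game1 A k (n k) (t k) true).toReal - 1 / 2|) ∧
  (∀ A : E.Combiner E.M, A.PolyTime n t →
    Negligible fun k => |(E.game2 A k (n k) (t k) true).toReal - 1 / 2|)

end TEScheme

/-! ### The modified threshold ElGamal scheme -/

namespace ElGamal

/-- Public keys: `(desc, q, g, h, (x₁, …, x_n))`. -/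
abbrev pkTy : Ty := .prod .nat (.prod .nat (.prod .grp (.prod .grp (.list .nat))))

/-- The sharing polynomial `f(x) = ∑ a_j x^j` of degree less than `t`. -/
def share {q t : ℕ} (a : Fin t → ZMod q) (x : ZMod q) : ZMod q :=
  ∑ j : Fin t, a j * x ^ (j : ℕ)

/-- Key generation: uniform coefficients `a₀, …, a_{t-1}` and uniform public points
`x₁, …, x_n`; the secret key is `α = f(0)`, `h = g^α`, and the shares are `α_i = f(x_i)`. -/
def KG (P : GroupInst) (n t : ℕ) : PMF (pkTy.val P × (Fin n → ZMod P.q)) :=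
  (PMF.uniformOfFintype (Fin t → ZMod P.q)).bind fun a =>
    (PMF.uniformOfFintype (Fin n → ZMod P.q)).map fun x =>
      ((P.desc, P.q, P.g, P.gpow (share a 0), List.ofFn fun i => (x i).val),
        fun i => share a (x i))

/-- Encryption: `(g^r, m h^r)` for uniform `r`. -/
def Enc (P : GroupInst) (pk : pkTy.val P) (m : P.G) : PMF (P.G × P.G) :=
  (PMF.uniformOfFintype (ZMod P.q)).map fun r =>
    (pk.2.2.1 ^ r.val, m * pk.2.2.2.1 ^ r.val)

/-- Partial decryption: `(g^r)^(α_i)`. -/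
def SD (P : GroupInst) (s : ZMod P.q) (c : P.G × P.G) : P.G := c.1 ^ s.val

/-- The Lagrange coefficient of the point `x i` at `0`, for the points `x j`, `j ∈ T`. -/
def lagrangeCoeff {q n : ℕ} [Fact q.Prime] (x : Fin n → ZMod q) (T : Finset (Fin n))
    (i : Fin n) : ZMod q :=
  ∏ j ∈ T.erase i, (0 - x j) / (x i - x j)

/-- Combination: interpolation in the exponent, for all sets of `t` different points. -/
def CM (P : GroupInst) (n t : ℕ) (pk : pkTy.val P) (c : P.G × P.G) (d : Fin n → P.G) :
    Set P.G :=
  let x : Fin n → ZMod P.q := fun i => ((pk.2.2.2.2.getD i 0 : ℕ) : ZMod P.q)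
  {m | ∃ T : Finset (Fin n), T.card = t ∧ Set.InjOn x T ∧
    m = c.2 / ∏ i ∈ T, d i ^ (lagrangeCoeff x T i).val}

end ElGamal

/-- The modified threshold ElGamal scheme over the group family `gen`. -/
def elGamal (gen : ℕ → PMF GroupInst) : TEScheme where
  PK := ElGamal.pkTy
  M := .grp
  C := .prod .grp .grp
  D := .grp
  SK := fun P => ZMod P.q
  setup := gen
  KG := ElGamal.KG
  Enc := ElGamal.Enc
  SD := fun P _ _ _ s c => ElGamal.SD P s c
  CM := ElGamal.CM

end

/-! An answer of the key owner with encryption randomness r depends on the sharing coefficients a_0,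
…, a_{t-1} only through g^r and the elements g^{z_j} with z_j = r a_j. Evaluation of polynomials is
linear, so the ciphertext is (g^r, m g^{z(0)}) and the correct share of server i is g^{z(x_i)}. The
proof replaces the vector z, in all challenge answers, by a fresh uniform vector, one coordinate at
a time.

The step for coordinate i is a reduction to DDH. Given (X, Y, Z) = (g^α, g^β, g^γ), put a_i = α and
draw all other coefficients. For each challenge draw fresh s, s' and use g^r = Y^s g^{s'} and
g^{z_i} = Z^s X^{s'}. If γ = αβ, then r is uniform and z_i = r a_i (`simSampler_mul`). If γ ≠ αβ,
then (r, z_i) is uniform (`simSampler_update`), so a single instance serves any number of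
challenges. For j ≠ i the coefficient a_j is known, hence g^{r a_j} can be formed; for j < i it is
masked by fresh noise. Answers of S need only the elements g^{a_j}, because there r is chosen in the
open. Drawing i at random makes the t hybrid steps telescope (`ex_ddhGame_mul`, `ex_ddhGame_le`,
`abs_game_sub_le`).

After t steps z is a uniform polynomial of degree less than t. Its values at 0 and at t-1 further
points are independent and uniform if the points are different and nonzero. The first value hides m,
and the others make the correct shares look like the random ones (`answerOf_unif`). The challenges
no longer depend on the bit, so a guess succeeds with probability 1/2 (`game_le`). Both games are
instances of one notion of `Attack`.

The exceptional events are γ = αβ, a challenge with r = 0, and points that coincide or vanish. Their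
probabilities are polynomial multiples of 1/q. The mean of 1/q is itself negligible under DDH: the
product αβ vanishes about twice as often as a uniform γ, which a test of the third component detects
(`meanInv_le`).

The remaining work shows that the reduction is a polynomial time program. `Prog.sim` substitutes a
program for an oracle with controlled overhead, and `Tame` is a sublanguage in which polynomial
running time is automatic. -/

noncomputable section

open scoped ENNReal

/-! ### Expectations and uniform distributions -/

namespace PMF

universe u v w
variable {α : Type u} {β : Type v} {γ : Type w}

/-- Expectation of a function with values in `[0, ∞]`. -/
def ex (p : PMF α) (f : α → ℝ≥0∞) : ℝ≥0∞ := ∑' a, p a * f a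

theorem ex_pure (a : α) (f : α → ℝ≥0∞) : (PMF.pure a).ex f = f a := by
  classical
  unfold ex
  rw [tsum_eq_single a]
  · simp
  · intro b hb
    simp [PMF.pure_apply, hb]

theorem ex_bind (p : PMF α) (g : α → PMF β) (f : β → ℝ≥0∞) :
    (p.bind g).ex f = p.ex fun a => (g a).ex f := by
  unfold ex
  simp only [PMF.bind_apply, ← ENNReal.tsum_mul_right, ← ENNReal.tsum_mul_left]
  rw [ENNReal.tsum_comm]
  simp only [mul_assoc]

theorem ex_map (p : PMF α) (g : α → β) (f : β → ℝ≥0∞) :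
    (p.map g).ex f = p.ex fun a => f (g a) := by
  unfold PMF.map
  rw [ex_bind]
  simp [ex_pure]

theorem ex_mono_of_support (p : PMF α) {f g : α → ℝ≥0∞} (h : ∀ a ∈ p.support, f a ≤ g a) :
    p.ex f ≤ p.ex g := by
  refine ENNReal.tsum_le_tsum fun a => ?_
  by_cases ha : p a = 0
  · simp [ha]
  · exact mul_le_mul_right (h a ((p.mem_support_iff a).2 ha)) _

theorem ex_mono (p : PMF α) {f g : α → ℝ≥0∞} (h : ∀ a, f a ≤ g a) : p.ex f ≤ p.ex g :=
  p.ex_mono_of_support fun a _ => h a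

theorem ex_congr_of_support (p : PMF α) {f g : α → ℝ≥0∞} (h : ∀ a ∈ p.support, f a = g a) :
    p.ex f = p.ex g :=
  le_antisymm (p.ex_mono_of_support fun a ha => (h a ha).le)
    (p.ex_mono_of_support fun a ha => (h a ha).ge)

theorem ex_add (p : PMF α) (f g : α → ℝ≥0∞) : (p.ex fun a => f a + g a) = p.ex f + p.ex g := by
  unfold ex
  simp only [mul_add]
  exact ENNReal.tsum_add

theorem ex_const_mul (p : PMF α) (c : ℝ≥0∞) (f : α → ℝ≥0∞) :
    (p.ex fun a => c * f a) = c * p.ex f := by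
  unfold ex
  rw [← ENNReal.tsum_mul_left]
  congr 1
  ext a
  ring

theorem ex_const (p : PMF α) (c : ℝ≥0∞) : (p.ex fun _ => c) = c := by
  unfold ex
  rw [ENNReal.tsum_mul_right, PMF.tsum_coe, one_mul]

theorem ex_finset_sum {ι : Type*} (p : PMF α) (s : Finset ι) (f : ι → α → ℝ≥0∞) :
    (p.ex fun x => ∑ i ∈ s, f i x) = ∑ i ∈ s, p.ex (f i) := by
  classical
  induction s using Finset.induction_on with
  | empty => simp [ex_const]
  | insert i s hi ih => simp only [Finset.sum_insert hi, ex_add, ih]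

theorem ex_le_of_le (p : PMF α) {f : α → ℝ≥0∞} {c : ℝ≥0∞} (h : ∀ a ∈ p.support, f a ≤ c) :
    p.ex f ≤ c :=
  (p.ex_mono_of_support h).trans_eq (p.ex_const c)

/-- Tonelli: independent draws may be made in any order. -/
theorem ex_comm (p : PMF α) (q : PMF β) (f : α → β → ℝ≥0∞) :
    (p.ex fun a => q.ex fun b => f a b) = q.ex fun b => p.ex fun a => f a b := by
  unfold ex
  simp only [← ENNReal.tsum_mul_left]
  rw [ENNReal.tsum_comm]
  congr 1; ext b; congr 1; ext a
  ring

theorem apply_eq_ex [DecidableEq α] (p : PMF α) (a : α) : p a = p.ex fun x => if x = a then 1 else 0 := by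
  unfold ex
  rw [tsum_eq_single a]
  · simp
  · intro b hb
    simp [hb]

/-- Indicators of points are test functions. This reduces equalities of distributions to
expectations, where independent draws commute freely. -/
theorem ext_of_ex {p q : PMF α} (h : ∀ f, p.ex f = q.ex f) : p = q := by
  classical
  ext a
  rw [apply_eq_ex, apply_eq_ex, h]

theorem bind_congr_of_support (p : PMF α) {f g : α → PMF β} (h : ∀ a ∈ p.support, f a = g a) :
    p.bind f = p.bind g := by
  refine ext_of_ex fun F => ?_
  rw [ex_bind, ex_bind]
  exact p.ex_congr_of_support fun a ha => by rw [h a ha]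

/-- Uniform distribution, with a short name. -/
abbrev unif (α : Type u) [Fintype α] [Nonempty α] : PMF α := PMF.uniformOfFintype α

theorem ex_unif (α : Type u) [Fintype α] [Nonempty α] (f : α → ℝ≥0∞) :
    (unif α).ex f = (Fintype.card α : ℝ≥0∞)⁻¹ * ∑ a, f a := by
  unfold ex
  rw [tsum_fintype, Finset.mul_sum]
  simp

/-- A surjective additive homomorphism of finite groups preserves uniform distributions. -/
theorem unif_map_of_surjective {A B : Type*} [AddGroup A] [AddGroup B] [Fintype A] [Fintype B]
    (φ : A →+ B) (hφ : Function.Surjective φ) : (unif A).map φ = unif B := by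
  classical
  -- All fibres are cosets of the kernel and so have the same size.
  have hfib : ∀ y : B, (Finset.univ.filter fun g => φ g = y).card =
      (Finset.univ.filter fun g => φ g = 0).card := fun y =>
    AddMonoidHom.card_fiber_eq_of_mem_range φ (hφ y) (hφ 0)
  have hcard : Fintype.card A = Fintype.card B * (Finset.univ.filter fun g => φ g = 0).card := by
    rw [← Finset.card_univ, Finset.card_eq_sum_card_fiberwise (f := φ) (t := Finset.univ)
      (fun _ _ => Finset.mem_coe.2 (Finset.mem_univ _))]
    simp [hfib]
  ext y
  rw [PMF.map_apply, tsum_fintype]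
  simp only [PMF.uniformOfFintype_apply]
  rw [← Finset.sum_filter, Finset.sum_const]
  have h1 : (Finset.univ.filter fun a => y = φ a) = Finset.univ.filter fun a => φ a = y := by
    ext a; simp [eq_comm]
  rw [h1, hfib, nsmul_eq_mul, hcard]
  have h0 : (Finset.univ.filter fun g => φ g = 0).card ≠ 0 :=
    Finset.card_ne_zero.2 ⟨0, by simp⟩
  push_cast
  rw [ENNReal.mul_inv (by simp) (by simp), mul_comm, mul_assoc,
    ENNReal.inv_mul_cancel (by exact_mod_cast h0) (by simp), mul_one]

theorem unif_map_equiv {A B : Type*} [Fintype A] [Nonempty A] [Fintype B] [Nonempty B]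
    (e : A ≃ B) : (unif A).map e = unif B := by
  refine ext_of_ex fun f => ?_
  rw [ex_map, ex_unif, ex_unif, Fintype.card_congr e, e.sum_comp]

theorem unif_prod (A B : Type*) [Fintype A] [Nonempty A] [Fintype B] [Nonempty B] :
    unif (A × B) = (unif A).bind fun a => (unif B).map fun b => (a, b) := by
  refine ext_of_ex fun f => ?_
  rw [ex_bind]
  simp only [ex_map, ex_unif, Fintype.card_prod, Fintype.sum_prod_type, ← Finset.mul_sum]
  push_cast
  rw [ENNReal.mul_inv (by simp) (by simp)]
  ring

/-- A map that agrees with a surjective additive homomorphism preserves uniform distributions. -/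
theorem unif_map_eq_unif {A B : Type*} [AddGroup A] [AddGroup B] [Fintype A] [Fintype B]
    (F : A → B) (hadd : ∀ a b, F (a + b) = F a + F b) (hF : Function.Surjective F) :
    (unif A).map F = unif B :=
  unif_map_of_surjective (AddMonoidHom.mk' F hadd) hF

/-! ### Randomized iteration over lists -/

/-- `n`-fold iteration of a randomized map. -/
def iterP (f : α → PMF α) : ℕ → α → PMF α
  | 0, x => PMF.pure x
  | n + 1, x => (f x).bind (iterP f n)

theorem iterP_pure (F : α → α) (f : α → PMF α) (h : ∀ x, f x = PMF.pure (F x)) (n : ℕ) (x : α) :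
    iterP f n x = PMF.pure (F^[n] x) := by
  induction n generalizing x with
  | zero => rfl
  | succ n ih => rw [iterP, h, PMF.pure_bind, ih, Function.iterate_succ_apply]

/-- Randomized left fold. -/
def foldP (f : β → α → PMF β) : List α → β → PMF β
  | [], s => PMF.pure s
  | y :: l, s => (f s y).bind (foldP f l)

theorem foldP_pure (F : β → α → β) (f : β → α → PMF β) (h : ∀ s x, f s x = PMF.pure (F s x))
    (l : List α) (s : β) : foldP f l s = PMF.pure (l.foldl F s) := by
  induction l generalizing s with
  | nil => rfl
  | cons y l ih => rw [foldP, h, PMF.pure_bind, ih, List.foldl_cons]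

/-- Randomized map over a list. -/
def mapP (f : α → PMF β) : List α → PMF (List β)
  | [] => PMF.pure []
  | y :: l => (f y).bind fun z => (mapP f l).bind fun zs => PMF.pure (z :: zs)

theorem length_of_mem_support_mapP {f : α → PMF β} {l : List α} {r : List β}
    (h : r ∈ (mapP f l).support) : r.length = l.length := by
  induction l generalizing r with
  | nil => simp_all [mapP]
  | cons y l ih =>
    simp only [mapP, PMF.mem_support_bind_iff, PMF.mem_support_pure_iff] at h
    obtain ⟨z, -, zs, hzs, rfl⟩ := h
    simp [ih hzs]

theorem mapP_pure (F : α → β) (f : α → PMF β) (h : ∀ x, f x = PMF.pure (F x)) (l : List α) :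
    mapP f l = PMF.pure (l.map F) := by
  induction l with
  | nil => rfl
  | cons y l ih => simp [mapP, h, ih]

/-- The accumulator grows at its front, hence the reversal. -/
theorem foldP_cons (f : α → PMF β) (l : List α) (s : List β) :
    foldP (fun s y => (f y).bind fun z => PMF.pure (z :: s)) l s =
      (mapP f l).bind fun r => PMF.pure (r.reverse ++ s) := by
  induction l generalizing s with
  | nil => simp [foldP, mapP]
  | cons y l ih => simp [foldP, mapP, ih]

theorem unif_fin_succ (F : Type*) [Fintype F] [Nonempty F] (n : ℕ) :
    unif (Fin (n + 1) → F) =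
      (unif F).bind fun a => (unif (Fin n → F)).map fun f => Fin.cons a f := by
  rw [← unif_map_equiv (Fin.consEquiv fun _ : Fin (n + 1) => F), unif_prod, PMF.map_bind]
  simp only [PMF.map_comp]
  rfl

/-- Sampling independently along a list. -/
theorem mapP_ofFn {F : Type*} [Fintype F] [Nonempty F] {n : ℕ} (v : Fin n → α)
    (f : α → PMF β) (h : Fin n → F → β) (hf : ∀ i, f (v i) = (unif F).map (h i)) :
    mapP f (List.ofFn v) = (unif (Fin n → F)).map fun r => List.ofFn fun i => h i (r i) := by
  induction n with
  | zero =>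
    simp only [List.ofFn_zero, mapP]
    exact (PMF.map_const _ _).symm
  | succ n ih =>
    rw [List.ofFn_succ, mapP, hf, ih _ _ fun i => hf i.succ, unif_fin_succ, PMF.map_bind,
      PMF.bind_map]
    congr 1
    ext1 a
    simp only [PMF.map_comp, Function.comp_apply, PMF.bind_map]
    rw [PMF.map]
    congr 1
    ext1 r
    simp [List.ofFn_succ]

end PMF

/-! ### Sampling below a number -/

theorem uniformBelow_eq_map_val (q : ℕ) [NeZero q] :
    uniformBelow q = (PMF.unif (ZMod q)).map ZMod.val := by
  cases q with
  | zero => exact absurd rfl (NeZero.ne 0)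
  | succ n =>
    unfold uniformBelow
    congr 1

/-- The inequality is not strict because sampling below 0 yields 0. -/
theorem mem_support_uniformBelow {n x : ℕ} (h : x ∈ (uniformBelow n).support) : x ≤ n := by
  cases n with
  | zero => simp_all [uniformBelow]
  | succ n =>
    unfold uniformBelow at h
    rw [PMF.mem_support_map_iff] at h
    obtain ⟨a, -, rfl⟩ := h
    exact a.2.le

end

noncomputable section

open scoped ENNReal

/-! ### Outputs and running times of programs -/

namespace Prog

open PMF

variable {Q R Q' R' e : Ty} (P : GroupInst)

/-- Output distribution of a program. -/
def out (O : Q.val P → PMF (R.val P)) {a b : Ty} (p : Prog Q R a b) (x : a.val P) :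
    PMF (b.val P) :=
  (p.run P O x).map Prod.fst

variable (O : Q.val P → PMF (R.val P)) {a b c : Ty}

theorem out_id (x : a.val P) : out P O (.id) x = PMF.pure x := by
  simp [out, Prog.run, PMF.pure_map]

theorem out_comp (f : Prog Q R a b) (g : Prog Q R b c) (x : a.val P) :
    out P O (.comp f g) x = (out P O f x).bind (out P O g) := by
  simp only [out, Prog.run, PMF.map_bind, PMF.map_comp, PMF.bind_map]
  rfl

theorem out_unit (x : a.val P) : out P O (.unit) x = PMF.pure () := by
  simp [out, Prog.run, PMF.pure_map]

theorem out_pair (f : Prog Q R a b) (g : Prog Q R a c) (x : a.val P) :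
    out P O (.pair f g) x =
      (out P O f x).bind fun y => (out P O g x).bind fun z => PMF.pure (y, z) := by
  simp only [out, Prog.run, PMF.map_bind, PMF.map_comp, PMF.bind_map]
  rfl

theorem out_fst (x : (Ty.prod a b).val P) : out P O (.fst) x = PMF.pure x.1 := by
  simp [out, Prog.run, PMF.pure_map]

theorem out_snd (x : (Ty.prod a b).val P) : out P O (.snd) x = PMF.pure x.2 := by
  simp [out, Prog.run, PMF.pure_map]

theorem out_lit (n : ℕ) (x : a.val P) : out P O (.lit n) x = PMF.pure n := by
  simp [out, Prog.run, PMF.pure_map]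

theorem out_arith (op : Arith) (x : (Ty.prod .nat .nat).val P) :
    out P O (.arith op) x = PMF.pure (op.eval x.1 x.2) := by
  simp [out, Prog.run, PMF.pure_map]

theorem out_ite (f g : Prog Q R a b) (x : (Ty.prod .nat a).val P) :
    out P O (.ite f g) x = if x.1 = 0 then out P O g x.2 else out P O f x.2 := by
  obtain ⟨n, x⟩ := x
  cases n <;> simp only [out, Prog.run, PMF.map_comp] <;> rfl

theorem out_nil (x : a.val P) : out P O (.nil (b := b)) x = PMF.pure [] := by
  simp [out, Prog.run, PMF.pure_map]

theorem out_cons (x : (Ty.prod b (.list b)).val P) :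
    out P O (.cons) x = PMF.pure (x.1 :: x.2) := by
  simp [out, Prog.run, PMF.pure_map]

theorem out_lcase_nil (f : Prog Q R a c) (g : Prog Q R (.prod (.prod b (.list b)) a) c)
    (x : a.val P) : out P O (.lcase f g) (([], x) : (Ty.prod (.list b) a).val P) =
      out P O f x := by
  simp only [out, Prog.run, PMF.map_comp]; rfl

theorem out_lcase_cons (f : Prog Q R a c) (g : Prog Q R (.prod (.prod b (.list b)) a) c)
    (y : b.val P) (l : List (b.val P)) (x : a.val P) :
    out P O (.lcase f g) ((y :: l, x) : (Ty.prod (.list b) a).val P) =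
      out P O g ((y, l), x) := by
  simp only [out, Prog.run, PMF.map_comp]; rfl

theorem out_loop (f : Prog Q R a a) (x : (Ty.prod .nat a).val P) :
    out P O (.loop f) x = iterP (out P O f) x.1 x.2 := by
  obtain ⟨n, x⟩ := x
  simp only [out, Prog.run]
  induction n generalizing x with
  | zero => simp [iterateCost, iterP, PMF.pure_map]
  | succ n ih =>
    rw [iterateCost, iterP, out, PMF.map_bind, PMF.bind_map]
    congr 1
    funext y
    rw [PMF.map_comp]
    exact ih y.1

theorem out_gone (x : a.val P) : out P O (.gone) x = PMF.pure (1 : P.G) := by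
  simp [out, Prog.run, PMF.pure_map]

theorem out_gmul (x : (Ty.prod .grp .grp).val P) :
    out P O (.gmul) x = PMF.pure (x.1 * x.2 : P.G) := by
  simp [out, Prog.run, PMF.pure_map]

theorem out_enc (x : P.G) : out P O (.enc) x = PMF.pure (P.enc x) := by
  simp [out, Prog.run, PMF.pure_map]

theorem out_dec (x : ℕ) : out P O (.dec) x = PMF.pure (P.dec x) := by
  simp [out, Prog.run, PMF.pure_map]

theorem out_rand (x : ℕ) : out P O (.rand) x = uniformBelow x := by
  simp only [out, Prog.run, PMF.map_comp]
  exact PMF.map_id _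

theorem out_call (x : Q.val P) : out P O (.call) x = O x := by
  simp only [out, Prog.run, PMF.map_comp]
  exact PMF.map_id _

/-- `p.Steps P O x y c`: on input `x`, the program may output `y` after `c` steps. -/
def Steps (O : Q.val P → PMF (R.val P)) (p : Prog Q R a b) (x : a.val P) (y : b.val P) (c : ℕ) :
    Prop :=
  (y, c) ∈ (p.run P O x).support

variable {P O}

theorem mem_support_out_iff {p : Prog Q R a b} {x : a.val P} {y : b.val P} :
    y ∈ (p.out P O x).support ↔ ∃ c, p.Steps P O x y c := by
  simp only [out, PMF.mem_support_map_iff, Prod.exists, Steps]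
  aesop

theorem steps_comp_iff {f : Prog Q R a b} {g : Prog Q R b c} {x : a.val P} {z : c.val P}
    {s : ℕ} : Steps P O (.comp f g) x z s ↔
      ∃ y s₁ s₂, Steps P O f x y s₁ ∧ Steps P O g y z s₂ ∧ s = s₁ + s₂ + 1 := by
  simp only [Steps, Prog.run, PMF.mem_support_bind_iff, PMF.mem_support_map_iff, Prod.exists,
    Prod.mk.injEq]
  grind

theorem steps_pair_iff {f : Prog Q R a b} {g : Prog Q R a c} {x : a.val P}
    {z : (Ty.prod b c).val P} {s : ℕ} : Steps P O (.pair f g) x z s ↔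
      ∃ s₁ s₂, Steps P O f x z.1 s₁ ∧ Steps P O g x z.2 s₂ ∧ s = s₁ + s₂ + 1 := by
  obtain ⟨z₁, z₂⟩ := z
  simp only [Steps, Prog.run, PMF.mem_support_bind_iff, PMF.mem_support_map_iff, Prod.exists,
    Prod.mk.injEq]
  grind

theorem steps_id_iff {x y : a.val P} {s : ℕ} :
    Steps P O (.id) x y s ↔ y = x ∧ s = 1 := by
  simp [Steps, Prog.run]

theorem steps_unit_iff {x : a.val P} {y : Unit} {s : ℕ} :
    Steps P O (.unit) x y s ↔ s = 1 := by
  simp [Steps, Prog.run]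

theorem steps_fst_iff {x : (Ty.prod a b).val P} {y : a.val P} {s : ℕ} :
    Steps P O (.fst) x y s ↔ y = x.1 ∧ s = 1 := by
  simp [Steps, Prog.run]

theorem steps_snd_iff {x : (Ty.prod a b).val P} {y : b.val P} {s : ℕ} :
    Steps P O (.snd) x y s ↔ y = x.2 ∧ s = 1 := by
  simp [Steps, Prog.run]

theorem steps_lit_iff {n : ℕ} {x : a.val P} {y : ℕ} {s : ℕ} :
    Steps P O (.lit n) x y s ↔ y = n ∧ s = 1 + Nat.size n := by
  simp [Steps, Prog.run]

theorem steps_arith_iff {op : Arith} {x : (Ty.prod .nat .nat).val P} {y : ℕ} {s : ℕ} :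
    Steps P O (.arith op) x y s ↔
      y = op.eval x.1 x.2 ∧ s = 1 + Nat.size x.1 + Nat.size x.2 := by
  simp [Steps, Prog.run]

theorem steps_ite_iff {f g : Prog Q R a b} {x : (Ty.prod .nat a).val P} {y : b.val P} {s : ℕ} :
    Steps P O (.ite f g) x y s ↔
      ∃ s₁, (if x.1 = 0 then Steps P O g x.2 y s₁ else Steps P O f x.2 y s₁) ∧ s = s₁ + 1 := by
  obtain ⟨n, x⟩ := x
  cases n <;> simp [Steps, Prog.run] <;> grind

theorem steps_nil_iff {x : a.val P} {y : List (b.val P)} {s : ℕ} :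
    Steps P O (.nil (b := b)) x y s ↔ y = [] ∧ s = 1 := by
  simp [Steps, Prog.run]

theorem steps_cons_iff {x : (Ty.prod b (.list b)).val P} {y : List (b.val P)} {s : ℕ} :
    Steps P O (.cons) x y s ↔ y = x.1 :: x.2 ∧ s = 1 := by
  simp [Steps, Prog.run]

theorem steps_lcase_nil_iff {f : Prog Q R a c} {g : Prog Q R (.prod (.prod b (.list b)) a) c}
    {x : a.val P} {y : c.val P} {s : ℕ} :
    Steps P O (.lcase f g) (([], x) : (Ty.prod (.list b) a).val P) y s ↔
      ∃ s₁, Steps P O f x y s₁ ∧ s = s₁ + 1 := by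
  simp [Steps, Prog.run]; grind

theorem steps_lcase_cons_iff {f : Prog Q R a c} {g : Prog Q R (.prod (.prod b (.list b)) a) c}
    {z : b.val P} {l : List (b.val P)} {x : a.val P} {y : c.val P} {s : ℕ} :
    Steps P O (.lcase f g) ((z :: l, x) : (Ty.prod (.list b) a).val P) y s ↔
      ∃ s₁, Steps P O g ((z, l), x) y s₁ ∧ s = s₁ + 1 := by
  simp [Steps, Prog.run]; grind

theorem steps_loop_zero_iff {f : Prog Q R a a} {x y : a.val P} {s : ℕ} :
    Steps P O (.loop f) ((0, x) : (Ty.prod .nat a).val P) y s ↔ y = x ∧ s = 1 := by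
  simp [Steps, Prog.run, iterateCost]

theorem steps_loop_succ_iff {f : Prog Q R a a} {n : ℕ} {x z : a.val P} {s : ℕ} :
    Steps P O (.loop f) ((n + 1, x) : (Ty.prod .nat a).val P) z s ↔
      ∃ y s₁ s₂, Steps P O f x y s₁ ∧
        Steps P O (.loop f) ((n, y) : (Ty.prod .nat a).val P) z s₂ ∧ s = s₁ + s₂ + 1 := by
  simp only [Steps, Prog.run, iterateCost, PMF.mem_support_bind_iff, PMF.mem_support_map_iff,
    Prod.exists, Prod.mk.injEq]
  grind

theorem steps_gone_iff {x : a.val P} {y : P.G} {s : ℕ} :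
    Steps P O (.gone) x y s ↔ y = 1 ∧ s = 1 := by
  simp [Steps, Prog.run]

theorem steps_gmul_iff {x : (Ty.prod .grp .grp).val P} {y : P.G} {s : ℕ} :
    Steps P O (.gmul) x y s ↔
      y = x.1 * x.2 ∧ s = 1 + Nat.size (P.enc x.1) + Nat.size (P.enc x.2) := by
  simp [Steps, Prog.run]

theorem steps_enc_iff {x : P.G} {y : ℕ} {s : ℕ} :
    Steps P O (.enc) x y s ↔ y = P.enc x ∧ s = 1 + Nat.size (P.enc x) := by
  simp [Steps, Prog.run]

theorem steps_dec_iff {x : ℕ} {y : P.G} {s : ℕ} :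
    Steps P O (.dec) x y s ↔ y = P.dec x ∧ s = 1 + Nat.size x := by
  simp [Steps, Prog.run]

theorem steps_rand_iff {x : ℕ} {y : ℕ} {s : ℕ} :
    Steps P O (.rand) x y s ↔ y ∈ (uniformBelow x).support ∧ s = 1 + Nat.size x := by
  simp only [Steps, Prog.run, PMF.mem_support_map_iff, Prod.mk.injEq]
  grind

theorem steps_call_iff {x : Q.val P} {y : R.val P} {s : ℕ} :
    Steps P O (.call) x y s ↔ y ∈ (O x).support ∧ s = 1 := by
  simp only [Steps, Prog.run, PMF.mem_support_map_iff, Prod.mk.injEq]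
  grind

/-! ### Replacing an oracle by a program -/

/-- Exchanges the first two components of a triple. -/
def swap {Q R e b a : Ty} : Prog Q R (.prod e (.prod b a)) (.prod b (.prod e a)) :=
  .pair (.comp .snd .fst) (.pair .fst (.comp .snd .snd))

theorem out_swap (x : (Ty.prod e (.prod b a)).val P) :
    out P O swap x = PMF.pure (x.2.1, x.1, x.2.2) := by
  simp [swap, out_pair, out_comp, out_fst, out_snd]

theorem steps_swap_iff {x : (Ty.prod e (.prod b a)).val P}
    {y : (Ty.prod b (.prod e a)).val P} {s : ℕ} :
    Steps P O swap x y s ↔ y = (x.2.1, x.1, x.2.2) ∧ s = 9 := by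
  obtain ⟨y₁, y₂, y₃⟩ := y
  simp only [swap, steps_pair_iff, steps_comp_iff, steps_fst_iff, steps_snd_iff, Prod.mk.injEq]
  constructor
  · rintro ⟨s₁, s₂, ⟨y, t₁, t₂, ⟨rfl, rfl⟩, ⟨rfl, rfl⟩, rfl⟩, ⟨u₁, u₂, ⟨rfl, rfl⟩,
      ⟨y', t₃, t₄, ⟨rfl, rfl⟩, ⟨rfl, rfl⟩, rfl⟩, rfl⟩, rfl⟩
    simp
  · rintro ⟨⟨rfl, rfl, rfl⟩, rfl⟩
    exact ⟨3, 5, ⟨_, 1, 1, ⟨rfl, rfl⟩, ⟨rfl, rfl⟩, rfl⟩, ⟨1, 3, ⟨rfl, rfl⟩,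
      ⟨_, 1, 1, ⟨rfl, rfl⟩, ⟨rfl, rfl⟩, rfl⟩, rfl⟩, rfl⟩

/-- Runs `p` and answers its oracle calls with the program `o`, which also gets a parameter of
type `e`. -/
def sim (o : Prog Q' R' (.prod e Q) R) : {a b : Ty} → Prog Q R a b → Prog Q' R' (.prod e a) b
  | _, _, .id => .snd
  | _, _, .comp f g => .comp (.pair .fst (sim o f)) (sim o g)
  | _, _, .unit => .unit
  | _, _, .pair f g => .pair (sim o f) (sim o g)
  | _, _, .fst => .comp .snd .fst
  | _, _, .snd => .comp .snd .snd
  | _, _, .lit n => .lit n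
  | _, _, .arith op => .comp .snd (.arith op)
  | _, _, .ite f g => .comp swap (.ite (sim o f) (sim o g))
  | _, _, .nil => .nil
  | _, _, .cons => .comp .snd .cons
  | _, _, .lcase f g => .comp swap (.lcase (sim o f) (.comp swap (sim o g)))
  | _, _, .loop f => .comp swap (.comp (.loop (.pair .fst (sim o f))) .snd)
  | _, _, .gone => .gone
  | _, _, .gmul => .comp .snd .gmul
  | _, _, .enc => .comp .snd .enc
  | _, _, .dec => .comp .snd .dec
  | _, _, .rand => .comp .snd .rand
  | _, _, .call => o

/-- An oracle is a memoryless kernel: the answer to a query is independent of everything else given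
the query. A fresh run of `o` at each call therefore has the same effect as the oracle given by its
output distribution. -/
theorem out_sim (O' : Q'.val P → PMF (R'.val P)) (o : Prog Q' R' (.prod e Q) R)
    (p : Prog Q R a b) (ε : e.val P) (x : a.val P) :
    out P O' (sim o p) (ε, x) = out P (fun y => out P O' o (ε, y)) p x := by
  induction p with
  | id => simp only [sim, out_id, out_snd]
  | comp f g hf hg =>
    simp only [sim, out_comp, out_pair, out_fst, hf, PMF.pure_bind, PMF.bind_bind, hg]
  | unit => simp only [sim, out_unit]
  | pair f g hf hg => simp only [sim, out_pair, hf, hg]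
  | fst => simp only [sim, out_comp, out_fst, out_snd, PMF.pure_bind]
  | snd => simp only [sim, out_comp, out_snd, PMF.pure_bind]
  | lit n => simp only [sim, out_lit]
  | arith op => simp only [sim, out_comp, out_snd, out_arith, PMF.pure_bind]
  | ite f g hf hg => simp only [sim, out_comp, out_swap, out_ite, PMF.pure_bind, hf, hg]
  | nil => simp only [sim, out_nil]
  | cons => simp only [sim, out_comp, out_snd, out_cons, PMF.pure_bind]
  | lcase f g hf hg =>
    obtain ⟨l, x⟩ := x
    rw [sim, out_comp, out_swap, PMF.pure_bind]
    cases l with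
    | nil => exact (out_lcase_nil ..).trans ((hf x).trans (out_lcase_nil ..).symm)
    | cons y l =>
      refine (out_lcase_cons ..).trans (Eq.trans ?_ (out_lcase_cons ..).symm)
      rw [out_comp, out_swap, PMF.pure_bind]
      exact hg _
  | loop f hf =>
    obtain ⟨n, x⟩ := x
    simp only [sim, out_comp, out_swap, out_loop, PMF.pure_bind]
    induction n generalizing x with
    | zero => simp [iterP, out_snd]
    | succ n ih =>
      simp only [iterP, out_pair, out_fst, hf, PMF.pure_bind, PMF.bind_bind]
      congr 1
      ext1 y
      exact ih y
  | gone => simp only [sim, out_gone]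
  | gmul => simp only [sim, out_comp, out_snd, out_gmul, PMF.pure_bind]
  | enc => simp only [sim, out_comp, out_snd, out_enc, PMF.pure_bind]
  | dec => simp only [sim, out_comp, out_snd, out_dec, PMF.pure_bind]
  | rand => simp only [sim, out_comp, out_snd, out_rand, PMF.pure_bind]
  | call => simp only [sim, out_call]

end Prog

/-! ### Bit lengths and the running time of a simulation -/

/-- All numbers in a value have at most `M` bits. -/
def Ty.Bits (P : GroupInst) (M : ℕ) : (a : Ty) → a.val P → Prop
  | .unit, _ => True
  | .nat, n => Nat.size n ≤ M
  | .grp, _ => True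
  | .prod a b, x => Ty.Bits P M a x.1 ∧ Ty.Bits P M b x.2
  | .list a, l => ∀ y ∈ l, Ty.Bits P M a y

theorem Nat.size_mul_le (x y : ℕ) : Nat.size (x * y) ≤ Nat.size x + Nat.size y := by
  rw [Nat.size_le, pow_add]
  exact Nat.mul_lt_mul'' (Nat.lt_size_self x) (Nat.lt_size_self y)

theorem Nat.size_add_le (x y : ℕ) : Nat.size (x + y) ≤ Nat.size x + Nat.size y + 1 := by
  rw [Nat.size_le, pow_succ, pow_add]
  have h1 := Nat.lt_size_self x
  have h2 := Nat.lt_size_self y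
  have h3 : 2 ^ x.size ≤ 2 ^ x.size * 2 ^ y.size := Nat.le_mul_of_pos_right _ (by positivity)
  have h4 : 2 ^ y.size ≤ 2 ^ x.size * 2 ^ y.size := Nat.le_mul_of_pos_left _ (by positivity)
  omega

/-- The right-hand side is exactly the cost of the instruction, so a run of at most M steps never
computes a number of more than M bits arithmetically. -/
theorem Arith.size_eval_le (op : Arith) (x y : ℕ) :
    Nat.size (op.eval x y) ≤ 1 + Nat.size x + Nat.size y := by
  have h : ∀ z, z ≤ x → Nat.size z ≤ 1 + Nat.size x + Nat.size y := fun z hz =>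
    (Nat.size_le_size hz).trans (by omega)
  cases op with
  | add => exact (Nat.size_add_le x y).trans (by omega)
  | sub => exact h _ (Nat.sub_le x y)
  | mul => exact (Nat.size_mul_le x y).trans (by omega)
  | div => exact h _ (Nat.div_le_self x y)
  | mod => exact h _ (Nat.mod_le x y)

namespace Prog

variable {Q R Q' R' e : Ty} {P : GroupInst} {a b : Ty}

/-- The running time of a program with simulated oracle is at most a constant multiple of the
running time with oracle, if the simulation takes constant time on queries of bounded size. -/
theorem sim_steps {O' : Q'.val P → PMF (R'.val P)} {o : Prog Q' R' (.prod e Q) R} {ε : e.val P}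
    {M K : ℕ} (hK : 30 ≤ K)
    (ho : ∀ y, Ty.Bits P M Q y → ∀ r c, Steps P O' o (ε, y) r c → c ≤ K ∧ Ty.Bits P M R r)
    {p : Prog Q R a b} {x : a.val P} {y : b.val P} {s' : ℕ}
    (h : Steps P O' (sim o p) (ε, x) y s') :
    ∃ s, Steps P (fun y => out P O' o (ε, y)) p x y s ∧
      (s ≤ M → Ty.Bits P M a x → s' ≤ K * s ∧ Ty.Bits P M b y) := by
  induction p generalizing s' with
  | id =>
    rw [sim, steps_snd_iff] at h
    obtain ⟨rfl, rfl⟩ := h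
    exact ⟨1, steps_id_iff.2 ⟨rfl, rfl⟩, fun _ hx => ⟨by omega, hx⟩⟩
  | comp f g hf hg =>
    simp only [sim, steps_comp_iff, steps_pair_iff, steps_fst_iff] at h
    obtain ⟨⟨_, z⟩, s₁, s₂, ⟨t₁, t₂, ⟨rfl, rfl⟩, hz, rfl⟩, hy, rfl⟩ := h
    obtain ⟨c₁, h₁, k₁⟩ := hf hz
    obtain ⟨c₂, h₂, k₂⟩ := hg hy
    refine ⟨_, steps_comp_iff.2 ⟨z, c₁, c₂, h₁, h₂, rfl⟩, fun hM hx => ?_⟩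
    obtain ⟨l₁, b₁⟩ := k₁ (by omega) hx
    obtain ⟨l₂, b₂⟩ := k₂ (by omega) b₁
    exact ⟨by nlinarith, b₂⟩
  | unit =>
    rw [sim, steps_unit_iff] at h
    exact ⟨1, steps_unit_iff.2 rfl, fun _ _ => ⟨by omega, trivial⟩⟩
  | pair f g hf hg =>
    simp only [sim, steps_pair_iff] at h
    obtain ⟨t₁, t₂, h₁, h₂, rfl⟩ := h
    obtain ⟨c₁, h₁, k₁⟩ := hf h₁
    obtain ⟨c₂, h₂, k₂⟩ := hg h₂
    refine ⟨_, steps_pair_iff.2 ⟨c₁, c₂, h₁, h₂, rfl⟩, fun hM hx => ?_⟩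
    obtain ⟨l₁, b₁⟩ := k₁ (by omega) hx
    obtain ⟨l₂, b₂⟩ := k₂ (by omega) hx
    exact ⟨by nlinarith, b₁, b₂⟩
  | fst =>
    simp only [sim, steps_comp_iff, steps_fst_iff, steps_snd_iff] at h
    obtain ⟨_, _, _, ⟨rfl, rfl⟩, ⟨rfl, rfl⟩, rfl⟩ := h
    exact ⟨1, steps_fst_iff.2 ⟨rfl, rfl⟩, fun _ hx => ⟨by omega, hx.1⟩⟩
  | snd =>
    simp only [sim, steps_comp_iff, steps_snd_iff] at h
    obtain ⟨_, _, _, ⟨rfl, rfl⟩, ⟨rfl, rfl⟩, rfl⟩ := h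
    exact ⟨1, steps_snd_iff.2 ⟨rfl, rfl⟩, fun _ hx => ⟨by omega, hx.2⟩⟩
  | lit n =>
    rw [sim, steps_lit_iff] at h
    obtain ⟨rfl, rfl⟩ := h
    exact ⟨_, steps_lit_iff.2 ⟨rfl, rfl⟩, fun hM _ => ⟨by nlinarith,
      show Nat.size _ ≤ M by omega⟩⟩
  | arith op =>
    simp only [sim, steps_comp_iff, steps_snd_iff, steps_arith_iff] at h
    obtain ⟨_, _, _, ⟨rfl, rfl⟩, ⟨rfl, rfl⟩, rfl⟩ := h
    exact ⟨_, steps_arith_iff.2 ⟨rfl, rfl⟩, fun hM hx => ⟨by nlinarith,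
      (op.size_eval_le _ _).trans hM⟩⟩
  | ite f g hf hg =>
    simp only [sim, steps_comp_iff, steps_swap_iff, steps_ite_iff] at h
    obtain ⟨_, _, _, ⟨rfl, rfl⟩, ⟨t, h, rfl⟩, rfl⟩ := h
    simp only at h
    split_ifs at h with h0
    · obtain ⟨c, h, k⟩ := hg h
      refine ⟨_, steps_ite_iff.2 ⟨c, by rwa [if_pos h0], rfl⟩, fun hM hx => ?_⟩
      obtain ⟨l, b⟩ := k (by omega) hx.2
      exact ⟨by nlinarith, b⟩
    · obtain ⟨c, h, k⟩ := hf h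
      refine ⟨_, steps_ite_iff.2 ⟨c, by rwa [if_neg h0], rfl⟩, fun hM hx => ?_⟩
      obtain ⟨l, b⟩ := k (by omega) hx.2
      exact ⟨by nlinarith, b⟩
  | nil =>
    rw [sim, steps_nil_iff] at h
    obtain ⟨rfl, rfl⟩ := h
    exact ⟨1, steps_nil_iff.2 ⟨rfl, rfl⟩, fun _ _ => ⟨by omega, fun _ h => by simp at h⟩⟩
  | cons =>
    simp only [sim, steps_comp_iff, steps_cons_iff, steps_snd_iff] at h
    obtain ⟨_, _, _, ⟨rfl, rfl⟩, ⟨rfl, rfl⟩, rfl⟩ := h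
    refine ⟨1, steps_cons_iff.2 ⟨rfl, rfl⟩, fun _ hx => ⟨by omega, fun z hz => ?_⟩⟩
    rcases List.mem_cons.1 hz with rfl | hz
    exacts [hx.1, hx.2 z hz]
  | lcase f g hf hg =>
    obtain ⟨l, x⟩ := x
    cases l with
    | nil =>
      simp only [sim, steps_comp_iff, steps_swap_iff] at h
      obtain ⟨_, _, _, ⟨rfl, rfl⟩, h, rfl⟩ := h
      obtain ⟨t, h₁, rfl⟩ := steps_lcase_nil_iff.1 h
      obtain ⟨c, h₂, k⟩ := hf h₁
      refine ⟨_, steps_lcase_nil_iff.2 ⟨c, h₂, rfl⟩, fun hM hx => ?_⟩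
      obtain ⟨l, b⟩ := k (by omega) hx.2
      exact ⟨by nlinarith, b⟩
    | cons z l =>
      simp only [sim, steps_comp_iff, steps_swap_iff] at h
      obtain ⟨_, _, _, ⟨rfl, rfl⟩, h, rfl⟩ := h
      obtain ⟨t, h₁, rfl⟩ := steps_lcase_cons_iff.1 h
      simp only [steps_comp_iff, steps_swap_iff] at h₁
      obtain ⟨_, _, _, ⟨rfl, rfl⟩, h₁, rfl⟩ := h₁
      obtain ⟨c, h₂, k⟩ := hg h₁
      refine ⟨_, steps_lcase_cons_iff.2 ⟨c, h₂, rfl⟩, fun hM hx => ?_⟩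
      obtain ⟨l, b⟩ := k (by omega)
        ⟨⟨hx.1 _ List.mem_cons_self, fun w hw => hx.1 w (List.mem_cons_of_mem _ hw)⟩, hx.2⟩
      exact ⟨by nlinarith, b⟩
  | loop f hf =>
    obtain ⟨n, x⟩ := x
    simp only [sim, steps_comp_iff, steps_swap_iff, steps_snd_iff] at h
    obtain ⟨_, _, _, ⟨rfl, rfl⟩, ⟨⟨ε', y'⟩, s₁, _, h, ⟨rfl, rfl⟩, rfl⟩, rfl⟩ := h
    -- The summand 15 covers the fixed cost of entering and leaving the simulated loop. It is paid
    -- once, out of the step that the original loop spends on termination, so it must be carried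
    -- through the induction on the number of passes.
    suffices ∃ s, Steps P (fun y => out P O' o (ε, y)) (.loop f)
        ((n, x) : (Ty.prod .nat _).val P) y s ∧ (s ≤ M → Ty.Bits P M _ x →
          s₁ + 15 ≤ K * s ∧ Ty.Bits P M _ y) by
      obtain ⟨s, h, k⟩ := this
      exact ⟨s, h, fun hM hx => ⟨by have := (k hM hx.2).1; omega, (k hM hx.2).2⟩⟩
    clear * - h hf hK
    induction n generalizing x s₁ with
    | zero =>
      obtain ⟨h₁, rfl⟩ := steps_loop_zero_iff.1 h
      obtain ⟨rfl, rfl⟩ := Prod.mk.inj h₁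
      exact ⟨1, steps_loop_zero_iff.2 ⟨rfl, rfl⟩, fun _ hx => ⟨by omega, hx⟩⟩
    | succ n ih =>
      obtain ⟨⟨_, z⟩, t₁, t₂, h₁, h₂, rfl⟩ := steps_loop_succ_iff.1 h
      simp only [steps_pair_iff, steps_fst_iff] at h₁
      obtain ⟨_, u, ⟨rfl, rfl⟩, h₁, rfl⟩ := h₁
      obtain ⟨c₁, h₁, k₁⟩ := hf h₁
      obtain ⟨c₂, h₂, k₂⟩ := ih z t₂ h₂
      refine ⟨_, steps_loop_succ_iff.2 ⟨z, c₁, c₂, h₁, h₂, rfl⟩, fun hM hx => ?_⟩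
      obtain ⟨l₁, b₁⟩ := k₁ (by omega) hx
      obtain ⟨l₂, b₂⟩ := k₂ (by omega) b₁
      exact ⟨by nlinarith, b₂⟩
  | gone =>
    rw [sim, steps_gone_iff] at h
    obtain ⟨rfl, rfl⟩ := h
    exact ⟨1, steps_gone_iff.2 ⟨rfl, rfl⟩, fun _ _ => ⟨by omega, trivial⟩⟩
  | gmul =>
    simp only [sim, steps_comp_iff, steps_snd_iff, steps_gmul_iff] at h
    obtain ⟨_, _, _, ⟨rfl, rfl⟩, ⟨rfl, rfl⟩, rfl⟩ := h
    exact ⟨_, steps_gmul_iff.2 ⟨rfl, rfl⟩, fun hM hx => ⟨by nlinarith, trivial⟩⟩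
  | enc =>
    simp only [sim, steps_comp_iff, steps_snd_iff, steps_enc_iff] at h
    obtain ⟨_, _, _, ⟨rfl, rfl⟩, ⟨rfl, rfl⟩, rfl⟩ := h
    exact ⟨_, steps_enc_iff.2 ⟨rfl, rfl⟩, fun hM hx => ⟨by nlinarith,
      show Nat.size _ ≤ M by omega⟩⟩
  | dec =>
    simp only [sim, steps_comp_iff, steps_snd_iff, steps_dec_iff] at h
    obtain ⟨_, _, _, ⟨rfl, rfl⟩, ⟨rfl, rfl⟩, rfl⟩ := h
    exact ⟨_, steps_dec_iff.2 ⟨rfl, rfl⟩, fun hM hx => ⟨by nlinarith, trivial⟩⟩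
  | rand =>
    simp only [sim, steps_comp_iff, steps_snd_iff, steps_rand_iff] at h
    obtain ⟨_, _, _, ⟨rfl, rfl⟩, ⟨hy, rfl⟩, rfl⟩ := h
    exact ⟨_, steps_rand_iff.2 ⟨hy, rfl⟩, fun hM hx => ⟨by nlinarith,
      (Nat.size_le_size (mem_support_uniformBelow hy)).trans hx⟩⟩
  | call =>
    rw [sim] at h
    refine ⟨1, steps_call_iff.2 ⟨mem_support_out_iff.2 ⟨_, h⟩, rfl⟩, fun _ hx => ?_⟩
    have := ho _ hx _ _ h
    exact ⟨by omega, this.2⟩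

end Prog
end

noncomputable section

open scoped ENNReal

/-! ### Programs that run in polynomial time by construction

The programs below refer to a number `N`: the only loop repeats its body `N` times, and the only
arithmetic instructions do not increase numbers. -/

inductive Tame : Ty → Ty → Type
  | id {a : Ty} : Tame a a
  | comp {a b c : Ty} : Tame a b → Tame b c → Tame a c
  | pair {a b c : Ty} : Tame a b → Tame a c → Tame a (.prod b c)
  | fst {a b : Ty} : Tame (.prod a b) a
  | snd {a b : Ty} : Tame (.prod a b) b
  | lit {a : Ty} (n : ℕ) (hn : n ≤ 2 := by decide) : Tame a .nat
  | sub : Tame (.prod .nat .nat) .nat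
  | div : Tame (.prod .nat .nat) .nat
  | mod : Tame (.prod .nat .nat) .nat
  | ite {a b : Ty} : Tame a b → Tame a b → Tame (.prod .nat a) b
  | nil {a b : Ty} : Tame a (.list b)
  | cons {b : Ty} : Tame (.prod b (.list b)) (.list b)
  | lcase {a b c : Ty} : Tame a c → Tame (.prod (.prod b (.list b)) a) c →
      Tame (.prod (.list b) a) c
  /-- applies a program `N` times -/
  | rep {a : Ty} : Tame a a → Tame a a
  | gone {a : Ty} : Tame a .grp
  | gmul : Tame (.prod .grp .grp) .grp
  | rand : Tame .nat .nat

namespace Tame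

open PMF

/-- Output distribution. -/
def eval (P : GroupInst) (N : ℕ) : {a b : Ty} → Tame a b → a.val P → PMF (b.val P)
  | _, _, .id, x => PMF.pure x
  | _, _, .comp f g, x => (eval P N f x).bind (eval P N g)
  | _, _, .pair f g, x => (eval P N f x).bind fun y => (eval P N g x).bind fun z =>
      PMF.pure (y, z)
  | _, _, .fst, x => PMF.pure x.1
  | _, _, .snd, x => PMF.pure x.2
  | _, _, .lit n _, _ => PMF.pure n
  | _, _, .sub, x => PMF.pure (x.1 - x.2 : ℕ)
  | _, _, .div, x => PMF.pure (x.1 / x.2 : ℕ)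
  | _, _, .mod, x => PMF.pure (x.1 % x.2 : ℕ)
  | _, _, .ite f g, x => if x.1 = 0 then eval P N g x.2 else eval P N f x.2
  | _, _, .nil, _ => PMF.pure []
  | _, _, .cons, x => PMF.pure (x.1 :: x.2)
  | _, _, .lcase f g, x =>
      match x.1 with
      | [] => eval P N f x.2
      | y :: ys => eval P N g ((y, ys), x.2)
  | _, _, .rep f, x => iterP (eval P N f) N x
  | _, _, .gone, _ => PMF.pure (1 : P.G)
  | _, _, .gmul, x => PMF.pure (x.1 * x.2 : P.G)
  | _, _, .rand, x => uniformBelow x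

/-- Translation to programs with an oracle that returns `N`. -/
def toProg : {a b : Ty} → Tame a b → Prog .unit .nat a b
  | _, _, .id => .id
  | _, _, .comp f g => .comp f.toProg g.toProg
  | _, _, .pair f g => .pair f.toProg g.toProg
  | _, _, .fst => .fst
  | _, _, .snd => .snd
  | _, _, .lit n _ => .lit n
  | _, _, .sub => .arith .sub
  | _, _, .div => .arith .div
  | _, _, .mod => .arith .mod
  | _, _, .ite f g => .ite f.toProg g.toProg
  | _, _, .nil => .nil
  | _, _, .cons => .cons
  | _, _, .lcase f g => .lcase f.toProg g.toProg
  | _, _, .rep f => .comp (.pair (.comp .unit .call) .id) (.loop f.toProg)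
  | _, _, .gone => .gone
  | _, _, .gmul => .gmul
  | _, _, .rand => .rand

theorem out_toProg (P : GroupInst) (N : ℕ) {a b : Ty} (p : Tame a b) (x : a.val P) :
    p.toProg.out P (Q := .unit) (R := .nat) (fun _ => PMF.pure N) x = p.eval P N x := by
  induction p with
  | id => exact Prog.out_id ..
  | comp f g hf hg =>
    rw [toProg, Prog.out_comp, eval, hf]
    congr 1
    funext y
    exact hg y
  | pair f g hf hg => rw [toProg, Prog.out_pair, eval, hf, hg]
  | fst => exact Prog.out_fst ..
  | snd => exact Prog.out_snd ..
  | lit n hn => exact Prog.out_lit ..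
  | sub => exact Prog.out_arith ..
  | div => exact Prog.out_arith ..
  | mod => exact Prog.out_arith ..
  | ite f g hf hg => rw [toProg, Prog.out_ite, eval, hf, hg]
  | nil => exact Prog.out_nil ..
  | cons => exact Prog.out_cons ..
  | lcase f g hf hg =>
    obtain ⟨l, x⟩ := x
    cases l with
    | nil => exact (Prog.out_lcase_nil ..).trans (hf x)
    | cons y l => exact (Prog.out_lcase_cons ..).trans (hg _)
  | rep f hf =>
    rw [toProg, Prog.out_comp, Prog.out_pair, Prog.out_comp, Prog.out_unit, PMF.pure_bind,
      Prog.out_call, Prog.out_id, PMF.pure_bind, PMF.pure_bind, PMF.pure_bind, Prog.out_loop,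
      eval]
    congr 1
    funext y
    exact hf y
  | gone => exact Prog.out_gone ..
  | gmul => exact Prog.out_gmul ..
  | rand => exact Prog.out_rand ..

/-- The group elements have representations of at most `M` bits. -/
def _root_.GroupInst.EncLe (P : GroupInst) (M : ℕ) : Prop := ∀ x : P.G, Nat.size (P.enc x) ≤ M

/-- No instruction produces a number longer than its operands, up to constants of two bits and the
loop bound N, so M bits suffice throughout. The only loop makes N ≤ M passes, which multiplies a
running time polynomial in M by at most M. Output sizes are part of the induction because they bound
the cost of what follows. -/
theorem steps_toProg {a b : Ty} (p : Tame a b) : ∃ T : Polynomial ℕ, ∀ (P : GroupInst) (N M : ℕ),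
    N ≤ M → 2 ≤ M → P.EncLe M → ∀ x y s, Ty.Bits P M a x →
      Prog.Steps P (Q := .unit) (R := .nat) (fun _ => PMF.pure N) p.toProg x y s →
        s ≤ T.eval M ∧ Ty.Bits P M b y := by
  have hle : ∀ {M x z : ℕ}, Nat.size x ≤ M → z ≤ x → Nat.size z ≤ M := fun h1 h2 =>
    (Nat.size_le_size h2).trans h1
  induction p with
  | id =>
    refine ⟨1, fun P N M _ _ _ x y s hx h => ?_⟩
    obtain ⟨rfl, rfl⟩ := Prog.steps_id_iff.1 h
    simpa using hx
  | comp f g hf hg =>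
    obtain ⟨Tf, hf⟩ := hf
    obtain ⟨Tg, hg⟩ := hg
    refine ⟨Tf + Tg + 1, fun P N M hN hM hE x z s hx h => ?_⟩
    obtain ⟨y, s₁, s₂, h₁, h₂, rfl⟩ := Prog.steps_comp_iff.1 h
    obtain ⟨l₁, b₁⟩ := hf P N M hN hM hE _ _ _ hx h₁
    obtain ⟨l₂, b₂⟩ := hg P N M hN hM hE _ _ _ b₁ h₂
    refine ⟨?_, b₂⟩
    simp only [Polynomial.eval_add, Polynomial.eval_one]
    omega
  | pair f g hf hg =>
    obtain ⟨Tf, hf⟩ := hf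
    obtain ⟨Tg, hg⟩ := hg
    refine ⟨Tf + Tg + 1, fun P N M hN hM hE x z s hx h => ?_⟩
    obtain ⟨s₁, s₂, h₁, h₂, rfl⟩ := Prog.steps_pair_iff.1 h
    obtain ⟨l₁, b₁⟩ := hf P N M hN hM hE _ _ _ hx h₁
    obtain ⟨l₂, b₂⟩ := hg P N M hN hM hE _ _ _ hx h₂
    refine ⟨?_, b₁, b₂⟩
    simp only [Polynomial.eval_add, Polynomial.eval_one]
    omega
  | fst =>
    refine ⟨1, fun P N M _ _ _ x y s hx h => ?_⟩
    obtain ⟨rfl, rfl⟩ := Prog.steps_fst_iff.1 h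
    simpa using hx.1
  | snd =>
    refine ⟨1, fun P N M _ _ _ x y s hx h => ?_⟩
    obtain ⟨rfl, rfl⟩ := Prog.steps_snd_iff.1 h
    simpa using hx.2
  | lit n hn =>
    refine ⟨3, fun P N M _ hM _ x y s hx h => ?_⟩
    obtain ⟨h₁, rfl⟩ := Prog.steps_lit_iff.1 h
    rw [h₁]
    have h2 : Nat.size n ≤ 2 := Nat.size_le.2 (by omega)
    refine ⟨?_, h2.trans hM⟩
    simp only [Polynomial.eval_ofNat]
    omega
  | sub =>
    refine ⟨2 * Polynomial.X + 1, fun P N M _ hM _ x y s hx h => ?_⟩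
    obtain ⟨rfl, rfl⟩ := Prog.steps_arith_iff.1 h
    have h1 : Nat.size x.1 ≤ M := hx.1
    have h2 : Nat.size x.2 ≤ M := hx.2
    refine ⟨?_, hle h1 (Nat.sub_le _ _)⟩
    simp
    omega
  | div =>
    refine ⟨2 * Polynomial.X + 1, fun P N M _ hM _ x y s hx h => ?_⟩
    obtain ⟨rfl, rfl⟩ := Prog.steps_arith_iff.1 h
    have h1 : Nat.size x.1 ≤ M := hx.1
    have h2 : Nat.size x.2 ≤ M := hx.2
    refine ⟨?_, hle h1 (Nat.div_le_self _ _)⟩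
    simp
    omega
  | mod =>
    refine ⟨2 * Polynomial.X + 1, fun P N M _ hM _ x y s hx h => ?_⟩
    obtain ⟨rfl, rfl⟩ := Prog.steps_arith_iff.1 h
    have h1 : Nat.size x.1 ≤ M := hx.1
    have h2 : Nat.size x.2 ≤ M := hx.2
    refine ⟨?_, hle h1 (Nat.mod_le _ _)⟩
    simp
    omega
  | ite f g hf hg =>
    obtain ⟨Tf, hf⟩ := hf
    obtain ⟨Tg, hg⟩ := hg
    refine ⟨Tf + Tg + 1, fun P N M hN hM hE x z s hx h => ?_⟩
    obtain ⟨s, h₁, rfl⟩ := Prog.steps_ite_iff.1 h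
    simp only [Polynomial.eval_add, Polynomial.eval_one]
    split_ifs at h₁
    · obtain ⟨l, b⟩ := hg P N M hN hM hE _ _ _ hx.2 h₁
      exact ⟨by omega, b⟩
    · obtain ⟨l, b⟩ := hf P N M hN hM hE _ _ _ hx.2 h₁
      exact ⟨by omega, b⟩
  | nil =>
    refine ⟨1, fun P N M _ _ _ x y s hx h => ?_⟩
    obtain ⟨rfl, rfl⟩ := Prog.steps_nil_iff.1 h
    exact ⟨by simp, fun _ h => by simp at h⟩
  | cons =>
    refine ⟨1, fun P N M _ _ _ x y s hx h => ?_⟩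
    obtain ⟨rfl, rfl⟩ := Prog.steps_cons_iff.1 h
    refine ⟨by simp, fun z hz => ?_⟩
    rcases List.mem_cons.1 hz with rfl | hz
    exacts [hx.1, hx.2 z hz]
  | lcase f g hf hg =>
    obtain ⟨Tf, hf⟩ := hf
    obtain ⟨Tg, hg⟩ := hg
    refine ⟨Tf + Tg + 1, fun P N M hN hM hE x z s hx h => ?_⟩
    obtain ⟨l, x⟩ := x
    simp only [Polynomial.eval_add, Polynomial.eval_one]
    cases l with
    | nil =>
      obtain ⟨s, h₁, rfl⟩ := Prog.steps_lcase_nil_iff.1 h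
      obtain ⟨l, b⟩ := hf P N M hN hM hE _ _ _ hx.2 h₁
      exact ⟨by omega, b⟩
    | cons w l =>
      obtain ⟨s, h₁, rfl⟩ := Prog.steps_lcase_cons_iff.1 h
      obtain ⟨l, b⟩ := hg P N M hN hM hE _ _ _
        ⟨⟨hx.1 _ List.mem_cons_self, fun w hw => hx.1 w (List.mem_cons_of_mem _ hw)⟩, hx.2⟩ h₁
      exact ⟨by omega, b⟩
  | rep f hf =>
    obtain ⟨Tf, hf⟩ := hf
    refine ⟨Polynomial.X * (Tf + 1) + 7, fun P N M hN hM hE x z s hx h => ?_⟩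
    simp only [toProg, Prog.steps_comp_iff, Prog.steps_pair_iff, Prog.steps_id_iff,
      Prog.steps_call_iff, Prog.steps_unit_iff, PMF.mem_support_pure_iff] at h
    obtain ⟨⟨m, w⟩, _, s₂, ⟨_, _, ⟨_, _, _, rfl, ⟨rfl, rfl⟩, rfl⟩, ⟨rfl, rfl⟩, rfl⟩, h, rfl⟩ := h
    suffices s₂ ≤ m * (Tf.eval M + 1) + 1 ∧ Ty.Bits P M _ z by
      refine ⟨?_, this.2⟩
      have := Nat.mul_le_mul_right (Tf.eval M + 1) hN
      dsimp only at this
      simp only [Polynomial.eval_add, Polynomial.eval_one, Polynomial.eval_mul,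
        Polynomial.eval_X, Polynomial.eval_ofNat]
      omega
    have hf := hf P m M hN hM hE
    generalize (fun _ : Unit => PMF.pure m) = O at h hf
    clear hN
    change Ty.Bits P M _ w at hx
    induction m generalizing w s₂ with
    | zero =>
      obtain ⟨rfl, rfl⟩ := Prog.steps_loop_zero_iff.1 h
      exact ⟨by omega, hx⟩
    | succ m ih =>
      obtain ⟨y, s₁, s₂, h₁, h₂, rfl⟩ := Prog.steps_loop_succ_iff.1 h
      obtain ⟨l₁, b₁⟩ := hf _ _ _ hx h₁
      obtain ⟨l₂, b₂⟩ := ih _ _ h₂ b₁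
      exact ⟨by rw [Nat.succ_mul]; omega, b₂⟩
  | gone =>
    refine ⟨1, fun P N M _ _ _ x y s hx h => ?_⟩
    obtain ⟨rfl, rfl⟩ := Prog.steps_gone_iff.1 h
    exact ⟨by simp, trivial⟩
  | gmul =>
    refine ⟨2 * Polynomial.X + 1, fun P N M _ hM hE x y s hx h => ?_⟩
    obtain ⟨rfl, rfl⟩ := Prog.steps_gmul_iff.1 h
    have h1 := hE x.1
    have h2 := hE x.2
    refine ⟨?_, trivial⟩
    simp
    omega
  | rand =>
    refine ⟨Polynomial.X + 1, fun P N M _ hM hE x y s hx h => ?_⟩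
    obtain ⟨hy, rfl⟩ := Prog.steps_rand_iff.1 h
    have h1 : Nat.size x ≤ M := hx
    refine ⟨?_, hle h1 (mem_support_uniformBelow hy)⟩
    simp
    omega

/-- Translation to programs that get `N` as an additional input. -/
def compile {a b : Ty} (p : Tame a b) : PlainProg (.prod .nat a) b :=
  Prog.sim .fst p.toProg

theorem out_compile (P : GroupInst) (N : ℕ) {a b : Ty} (p : Tame a b) (x : a.val P) :
    p.compile.out P (Q := .unit) (R := .unit) (fun _ => PMF.pure ()) (N, x) = p.eval P N x := by
  rw [compile, Prog.out_sim, ← out_toProg]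
  simp only [Prog.out_fst]

theorem steps_compile {a b : Ty} (p : Tame a b) : ∃ T : Polynomial ℕ, ∀ (P : GroupInst)
    (N M : ℕ), N ≤ M → 2 ≤ M → P.EncLe M → ∀ x y s, Ty.Bits P M a x →
      Prog.Steps P (Q := .unit) (R := .unit) (fun _ => PMF.pure ()) p.compile (N, x) y s →
        s ≤ T.eval M ∧ Ty.Bits P M b y := by
  obtain ⟨T, hT⟩ := p.steps_toProg
  refine ⟨30 * T, fun P N M hN hM hE x y s hx h => ?_⟩
  have hmono : ∀ {M M' : ℕ}, M ≤ M' → ∀ {a : Ty} {x : a.val P}, Ty.Bits P M a x →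
      Ty.Bits P M' a x := by
    intro M M' h a
    induction a with
    | unit => exact fun h => h
    | nat => exact fun h' => le_trans h' h
    | grp => exact fun h => h
    | prod a b ha hb => exact fun h' => ⟨ha h'.1, hb h'.2⟩
    | list a ha => exact fun h' y hy => ha (h' y hy)
  have hNs : Nat.size N ≤ M := (Nat.size_le.2 Nat.lt_two_pow_self).trans hN
  -- `sim_steps` requires the number of simulated steps to be below its size bound; enlarging M to M
  -- + T(M) ensures this. The constant 30 is the least factor that it admits.
  have ho : ∀ y : Unit, Ty.Bits P (M + T.eval M) .unit y → ∀ (r c : ℕ),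
      Prog.Steps P (Q := .unit) (R := .unit) (fun _ => PMF.pure ())
        (.fst : PlainProg (.prod .nat .unit) .nat) (N, y) r c →
      c ≤ 30 ∧ Ty.Bits P (M + T.eval M) .nat r := by
    intro y _ r c hr
    obtain ⟨h₁, rfl⟩ := Prog.steps_fst_iff.1 hr
    rw [h₁]
    exact ⟨by omega, hNs.trans (Nat.le_add_right _ _)⟩
  obtain ⟨c, hc, hk⟩ := Prog.sim_steps le_rfl ho h
  simp only [Prog.out_fst] at hc
  obtain ⟨h1, h2⟩ := hT P N M hN hM hE x y c hx hc
  have := (hk (by omega) (hmono (by omega) hx)).1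
  refine ⟨?_, h2⟩
  simp only [Polynomial.eval_mul, Polynomial.eval_ofNat]
  omega

end Tame
end

noncomputable section

open scoped ENNReal

namespace Tame

open PMF

variable {P : GroupInst} {N : ℕ} {a b c e s : Ty}

/-! ### Basic programs -/

/-- Equality test of numbers: `1` if they are equal and `0` if not. -/
def natEq : Tame (.prod .nat .nat) .nat :=
  .comp (.pair .sub .id) (.ite (.lit 0)
    (.comp (.pair (.comp (.pair .snd .fst) .sub) .id) (.ite (.lit 0) (.lit 1))))

/-- Two numbers are equal when both truncated differences vanish. -/
theorem eval_natEq (x : (Ty.prod .nat .nat).val P) :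
    eval P N natEq x = PMF.pure (if x.1 = x.2 then 1 else 0) := by
  have key : ∀ i j : ℕ, (if i - j = 0 then (if j - i = 0 then PMF.pure 1 else PMF.pure 0)
      else PMF.pure 0 : PMF ℕ) = PMF.pure (if i = j then 1 else 0) := by
    intro i j
    split_ifs <;> first | rfl | omega
  simp only [natEq, eval, PMF.pure_bind]
  exact key x.1 x.2

/-- One step of the square-and-multiply algorithm on `(accumulator, (base, exponent))`. -/
def powStep : Tame (.prod .grp (.prod .grp .nat)) (.prod .grp (.prod .grp .nat)) :=
  .pair
    (.comp (.pair (.comp (.pair (.comp .snd .snd) (.lit 2)) .mod) .id)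
      (.ite (.comp (.pair .fst (.comp .snd .fst)) .gmul) .fst))
    (.pair (.comp (.pair (.comp .snd .fst) (.comp .snd .fst)) .gmul)
      (.comp (.pair (.comp .snd .snd) (.lit 2)) .div))

/-- `a ^ x`, for exponents below `2 ^ N`. -/
def pow : Tame (.prod .grp .nat) .grp := .comp (.pair .gone .id) (.comp (.rep powStep) .fst)

theorem eval_powStep (x : (Ty.prod .grp (.prod .grp .nat)).val P) : eval P N powStep x =
    PMF.pure (x.1 * x.2.1 ^ (x.2.2 % 2), x.2.1 * x.2.1, x.2.2 / 2) := by
  simp only [powStep, eval, PMF.pure_bind]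
  rcases Nat.mod_two_eq_zero_or_one x.2.2 with h | h <;> simp [h]

/-- After n rounds the low n bits of the exponent have been consumed, the base has been squared n
times, and the high bits remain. -/
theorem iterate_square_multiply {G : Type*} [CommGroup G] (n : ℕ) (x : G × G × ℕ) :
    (fun x : G × G × ℕ => (x.1 * x.2.1 ^ (x.2.2 % 2), x.2.1 * x.2.1, x.2.2 / 2))^[n] x =
      (x.1 * x.2.1 ^ (x.2.2 % 2 ^ n), x.2.1 ^ 2 ^ n, x.2.2 / 2 ^ n) := by
  induction n generalizing x with
  | zero => simp [Nat.mod_one]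
  | succ n ih =>
    obtain ⟨a, b, x⟩ := x
    rw [Function.iterate_succ_apply, ih]
    simp only [← pow_two, ← pow_mul, mul_assoc, ← pow_add, Nat.div_div_eq_div_mul,
      ← pow_succ']
    rw [pow_succ' 2 n, Nat.mod_mul]

theorem eval_pow (x : (Ty.prod .grp .nat).val P) :
    eval P N pow x = PMF.pure (x.1 ^ (x.2 % 2 ^ N) : P.G) := by
  simp only [pow, eval, PMF.pure_bind]
  rw [iterP_pure _ _ fun x => eval_powStep x]
  rw [iterate_square_multiply (G := P.G)]
  simp

/-- One step of a left fold on `(e, (list, state))`. -/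
def foldStep (f : Tame (.prod e (.prod s b)) s) :
    Tame (.prod e (.prod (.list b) s)) (.prod e (.prod (.list b) s)) :=
  .comp (.pair (.comp .snd .fst) (.pair .fst (.comp .snd .snd)))
    (.lcase (.pair .fst (.pair .nil .snd))
      (.pair (.comp .snd .fst) (.pair (.comp .fst .snd)
        (.comp (.pair (.comp .snd .fst) (.pair (.comp .snd .snd) (.comp .fst .fst))) f))))

/-- Left fold over the first `N` elements of a list; the body gets `(e, (state, element))`. -/
def fold (f : Tame (.prod e (.prod s b)) s) : Tame (.prod e (.prod (.list b) s)) s :=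
  .comp (.rep (foldStep f)) (.comp .snd .snd)

/-- The number of passes is N whatever the length of the list: an exhausted list makes the remaining
passes idle, and a longer list is cut off after N elements. -/
theorem eval_fold (f : Tame (.prod e (.prod s b)) s) (x : (Ty.prod e (.prod (.list b) s)).val P) :
    eval P N (fold f) x =
      foldP (fun z y => eval P N f (x.1, (z, y))) (x.2.1.take N) x.2.2 := by
  obtain ⟨ε, l, z⟩ := x
  rw [fold, eval, eval]
  suffices ∀ n, (iterP (eval P N (foldStep f)) n (ε, (l, z))).bind
      (eval P N (.comp .snd .snd)) =
      foldP (fun z y => eval P N f (ε, (z, y))) (l.take n) z from this N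
  intro n
  induction n generalizing l z with
  | zero => simp [iterP, foldP, eval]
  | succ n ih =>
    rw [iterP, PMF.bind_bind]
    cases l with
    | nil =>
      have h : eval P N (foldStep f) (ε, ([], z)) = PMF.pure (ε, ([], z)) := by
        simp only [foldStep, eval, PMF.pure_bind]
      rw [h, PMF.pure_bind]
      simpa using ih [] z
    | cons y l =>
      have h : eval P N (foldStep f) (ε, (y :: l, z)) =
          (eval P N f (ε, (z, y))).bind fun w => PMF.pure (ε, (l, w)) := by
        simp only [foldStep, eval, PMF.pure_bind, PMF.bind_bind]
      rw [h, PMF.bind_bind, List.take_succ_cons, foldP]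
      congr 1
      funext w
      rw [PMF.pure_bind]
      exact ih l w

/-- Reversal of (the first `N` elements of) a list. -/
def rev : Tame (.list b) (.list b) :=
  .comp (.pair .id (.pair .id .nil))
    (fold (.comp .snd (.comp (.pair .snd .fst) .cons)))

theorem eval_rev (l : List (b.val P)) :
    eval P N rev l = PMF.pure (l.take N).reverse := by
  simp only [rev, eval, PMF.pure_bind]
  rw [eval_fold]
  simp only [eval, PMF.pure_bind]
  rw [foldP_pure (fun s y => y :: s) _ fun _ _ => rfl]
  congr 1
  suffices ∀ (l s : List (b.val P)), l.foldl (fun s y => y :: s) s = l.reverse ++ s by simp [this]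
  intro l
  induction l with
  | nil => simp
  | cons y l ih => simp [ih]

/-- Applies a program to (the first `N`) elements of a list. -/
def map (f : Tame (.prod e b) c) : Tame (.prod e (.list b)) (.list c) :=
  .comp (.pair .fst (.pair .snd .nil))
    (.comp (fold (.comp (.pair (.comp (.pair .fst (.comp .snd .snd)) f) (.comp .snd .fst)) .cons))
      rev)

theorem eval_map (f : Tame (.prod e b) c) (x : (Ty.prod e (.list b)).val P) :
    eval P N (map f) x = mapP (fun y => eval P N f (x.1, y)) (x.2.take N) := by
  simp only [map, eval, PMF.pure_bind]
  rw [eval_fold]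
  simp only [eval, PMF.pure_bind, PMF.bind_bind]
  rw [foldP_cons, PMF.bind_bind]
  -- The final reversal also cuts off after N elements. It loses nothing because every possible
  -- result has at most N elements.
  refine (PMF.bind_congr_of_support _ fun r hr => ?_).trans (PMF.bind_pure _)
  have := length_of_mem_support_mapP hr
  rw [PMF.pure_bind, eval_rev, List.append_nil, List.take_of_length_le, List.reverse_reverse]
  rw [List.length_reverse, this]
  exact List.length_take_le ..

/-- Prepends `i` to a list and replaces `i` by `i - 1`, unless `i = 0`. -/
def iotaStep : Tame (.prod .nat (.list .nat)) (.prod .nat (.list .nat)) :=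
  .comp (.pair .fst .id) (.ite (.pair (.comp (.pair .fst (.lit 1)) .sub) .cons) .id)

theorem eval_iotaStep (x : (Ty.prod .nat (.list .nat)).val P) : eval P N iotaStep x =
    PMF.pure (if x.1 = 0 then x else (x.1 - 1, x.1 :: x.2)) := by
  simp only [iotaStep, eval, PMF.pure_bind]
  split_ifs <;> rfl

/-- The list `[1, …, n]` for `n ≤ N`. -/
def iota : Tame .nat (.list .nat) := .comp (.pair .id .nil) (.comp (.rep iotaStep) .snd)

theorem eval_iota {n : ℕ} (hn : n ≤ N) :
    eval P N iota n = PMF.pure (List.ofFn fun i : Fin n => (i : ℕ) + 1) := by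
  simp only [iota, eval, PMF.pure_bind]
  rw [iterP_pure _ _ fun x => eval_iotaStep x]
  -- The counter goes down from n while the list grows at its front; after reaching 0 the remaining
  -- passes are idle.
  suffices ∀ (N n : ℕ) (l : List ℕ), n ≤ N →
      (fun x : ℕ × List ℕ => if x.1 = 0 then x else (x.1 - 1, x.1 :: x.2))^[N] (n, l) =
        (0, (List.ofFn fun i : Fin n => (i : ℕ) + 1) ++ l) by
    rw [this N n [] hn]
    simp
  intro N
  induction N with
  | zero =>
    intro n l hn
    obtain rfl := Nat.le_zero.1 hn
    simp
  | succ N ih =>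
    intro n l hn
    rw [Function.iterate_succ_apply]
    rcases n with _ | n
    · exact ih 0 l (Nat.zero_le _)
    · simp only [Nat.succ_ne_zero, if_false, Nat.add_sub_cancel]
      rw [ih n _ (by omega), List.ofFn_succ', List.concat_eq_append]
      simp

/-- Membership test for (the first `N` elements of) a list of numbers: `1` or `0`. -/
def mem : Tame (.prod .nat (.list .nat)) .nat :=
  .comp (.pair .fst (.pair .snd (.lit 0)))
    (fold (.comp (.pair (.comp (.pair .fst (.comp .snd .snd)) natEq) (.comp .snd .fst))
      (.ite (.lit 1) .id)))

theorem eval_mem (x : (Ty.prod .nat (.list .nat)).val P) : eval P N mem x =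
    PMF.pure (if x.1 ∈ x.2.take N then 1 else 0) := by
  obtain ⟨i, l⟩ := x
  simp only [mem, eval, PMF.pure_bind]
  rw [eval_fold]
  simp only [eval, PMF.pure_bind, eval_natEq]
  rw [foldP_pure (fun s y => if i = y then 1 else s) _ (by intro s y; split_ifs <;> simp_all)]
  congr 1
  suffices ∀ (l : List ℕ) (s : ℕ), l.foldl (fun s y => if i = y then 1 else s) s =
      if i ∈ l then 1 else s by simpa using this (l.take N) 0
  intro l
  induction l with
  | nil => simp
  | cons y l ih =>
    intro s
    rw [List.foldl_cons, ih]
    by_cases h : i = y <;> by_cases h' : i ∈ l <;> simp [h, h']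

/-- The value `∏ z_j ^ (x ^ j)` for a list `[z_0, z_1, …]`. -/
def _root_.horner {G : Type*} [Monoid G] (l : List G) (x : ℕ) : G :=
  l.foldr (fun z acc => acc ^ x * z) 1

/-- Evaluation in the exponent, by Horner's rule. -/
def horner : Tame (.prod (.list .grp) .nat) .grp :=
  .comp (.pair .snd (.pair (.comp .fst rev) .gone))
    (fold (.comp (.pair (.comp (.pair (.comp .snd .fst) .fst) pow) (.comp .snd .snd)) .gmul))

/-- The list is reversed first, so that the left fold of the program becomes the right fold of
Horner's rule. -/
theorem eval_horner {x : (Ty.prod (.list .grp) .nat).val P} (hl : x.1.length ≤ N) :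
    eval P N horner x = PMF.pure (_root_.horner (G := P.G) x.1 (x.2 % 2 ^ N)) := by
  simp only [horner, eval, PMF.pure_bind]
  rw [eval_rev, PMF.pure_bind, PMF.pure_bind, PMF.pure_bind, eval_fold]
  simp only [eval, PMF.pure_bind, eval_pow]
  rw [foldP_pure (fun (acc : P.G) z => acc ^ (x.2 % 2 ^ N) * z) _ fun _ _ => rfl]
  rw [List.take_of_length_le hl, List.take_of_length_le (by simpa using hl), List.foldl_reverse]
  rfl

end Tame
end

noncomputable section

open scoped ENNReal

/-! ### Simulation of the key owner -/

/-- Public information on one coefficient of the sharing polynomial. -/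
abbrev coeffTy : Ty := .prod .grp (.prod .grp .nat)

/-- A server: its index and its public point. -/
abbrev pointTy : Ty := .prod .nat .nat

/-- The information from which queries are answered: `(q, g, Y, coefficients, points)`. -/
abbrev ctxTy : Ty := .prod .nat (.prod .grp (.prod .grp (.prod (.list coeffTy) (.list pointTy))))

/-- Data type of answers of the key owner. -/
abbrev ansTy : Ty := .prod (.prod .grp .grp) (.list .grp)

/-- Data type of the input of a combiner. -/
abbrev inTy : Ty := .prod (.prod .nat (.prod .nat .nat)) ElGamal.pkTy

namespace Tame

open PMF

variable {P : GroupInst} {N : ℕ} {a b c e s : Ty}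

/-- On `(((s, s'), g), (X, (W, v)))`, the element `W ^ s * X ^ s' * g ^ u` for `u` random below
`v`. -/
def coord : Tame (.prod (.prod (.prod .nat .nat) .grp) coeffTy) .grp :=
  .comp (.pair
    (.comp (.pair (.comp (.pair (.comp .snd (.comp .snd .fst)) (.comp .fst (.comp .fst .fst))) pow)
      (.comp (.pair (.comp .snd .fst) (.comp .fst (.comp .fst .snd))) pow)) .gmul)
    (.comp (.pair (.comp .fst .snd) (.comp .snd (.comp .snd (.comp .snd .rand)))) pow)) .gmul

theorem eval_coord (x : (Ty.prod (.prod (.prod .nat .nat) .grp) coeffTy).val P) :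
    eval P N coord x = (uniformBelow x.2.2.2).bind fun u => PMF.pure
      (x.2.2.1 ^ (x.1.1.1 % 2 ^ N) * x.2.1 ^ (x.1.1.2 % 2 ^ N) * x.1.2 ^ (u % 2 ^ N) : P.G) := by
  simp only [coord, eval, PMF.pure_bind, PMF.bind_bind, eval_pow]

/-- On `(((q, a), (Z, L)), (i, x))`, the evaluation of `Z` at `x` if `i` is in `L`, and a random
power of `a` otherwise. -/
def shareOf : Tame (.prod (.prod (.prod .nat .grp) (.prod (.list .grp) (.list .nat))) pointTy)
    .grp :=
  .comp (.pair (.comp (.pair (.comp .snd .fst) (.comp .fst (.comp .snd .snd))) mem) .id)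
    (.ite (.comp (.pair (.comp .fst (.comp .snd .fst)) (.comp .snd .snd)) horner)
      (.comp (.pair (.comp .fst (.comp .fst .snd)) (.comp .fst (.comp .fst (.comp .fst .rand))))
        pow))

theorem eval_shareOf
    (x : (Ty.prod (.prod (.prod .nat .grp) (.prod (.list .grp) (.list .nat))) pointTy).val P)
    (hx : x.1.2.1.length ≤ N) :
    eval P N shareOf x = if x.2.1 ∈ x.1.2.2.take N then
      PMF.pure (_root_.horner (G := P.G) x.1.2.1 (x.2.2 % 2 ^ N)) else
      (uniformBelow x.1.1.1).bind fun r => PMF.pure (x.1.1.2 ^ (r % 2 ^ N) : P.G) := by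
  simp only [shareOf, eval, PMF.pure_bind, PMF.bind_bind, eval_pow, eval_mem]
  rw [eval_horner hx]
  split_ifs <;> first | rfl | simp_all

/-- An answer on `(context, (m, L))`. -/
def answer : Tame (.prod ctxTy (.prod .grp (.list .nat))) ansTy :=
  .comp (.pair (.pair (.comp .fst (.comp .fst .rand)) (.comp .fst (.comp .fst .rand))) .id) <|
  .comp (.pair
    (.comp (.pair
      (.comp (.pair (.comp .snd (.comp .fst (.comp .snd (.comp .snd .fst)))) (.comp .fst .fst)) pow)
      (.comp (.pair (.comp .snd (.comp .fst (.comp .snd .fst))) (.comp .fst .snd)) pow)) .gmul)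
    (.pair
      (.comp (.pair (.pair .fst (.comp .snd (.comp .fst (.comp .snd .fst))))
        (.comp .snd (.comp .fst (.comp .snd (.comp .snd (.comp .snd .fst)))))) (map coord))
      .snd)) <|
  .pair
    (.pair .fst (.comp (.pair (.comp .snd (.comp .snd (.comp .snd .fst)))
      (.comp (.pair (.comp .snd .fst) (.lit 0)) horner)) .gmul))
    (.comp (.pair
      (.pair (.pair (.comp .snd (.comp .snd (.comp .fst .fst))) .fst)
        (.pair (.comp .snd .fst) (.comp .snd (.comp .snd (.comp .snd .snd)))))
      (.comp .snd (.comp .snd (.comp .fst (.comp .snd (.comp .snd (.comp .snd .snd)))))))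
      (map shareOf))

theorem eval_answer (q : ℕ) (g Y m : P.G) (cs : List (coeffTy.val P)) (pts : List (ℕ × ℕ))
    (L : List ℕ) :
    eval P N answer ((q, (g, (Y, (cs, pts)))), (m, L)) =
      (uniformBelow q).bind fun s => (uniformBelow q).bind fun s' =>
        (mapP (fun y => eval P N coord (((s, s'), g), y)) (cs.take N)).bind fun Z =>
          (mapP (fun y => eval P N shareOf
            (((q, (Y ^ (s % 2 ^ N) * g ^ (s' % 2 ^ N) : P.G)), (Z, L)), y)) (pts.take N)).bind
              fun d => PMF.pure ((((Y ^ (s % 2 ^ N) * g ^ (s' % 2 ^ N) : P.G)),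
                m * _root_.horner (G := P.G) Z 0), d) := by
  simp only [answer, eval, PMF.pure_bind, PMF.bind_bind, eval_pow, eval_map]
  congr 1
  funext s
  congr 1
  funext s'
  -- Only lists Z of at most N elements occur, which is what makes the evaluation by `horner` exact.
  refine PMF.bind_congr_of_support _ fun Z hZ => ?_
  have hZ' : Z.length ≤ N := by
    rw [length_of_mem_support_mapP hZ]
    exact List.length_take_le ..
  rw [eval_horner hZ', PMF.pure_bind]
  simp only [Nat.zero_mod]

/-- An answer of the procedure `S` on `(context, m)`. -/
def oracleS : Tame (.prod ctxTy .grp) ansTy :=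
  .comp (.pair .fst (.pair .snd
    (.comp (.comp .fst (.comp .snd (.comp .snd (.comp .snd .snd))))
      (.comp (.pair .id .id) (map (.comp .snd .fst)))))) answer

theorem eval_oracleS (q : ℕ) (g Y m : P.G) (cs : List (coeffTy.val P)) (pts : List (ℕ × ℕ)) :
    eval P N oracleS ((q, (g, (Y, (cs, pts)))), m) =
      eval P N answer ((q, (g, (Y, (cs, pts)))), (m, (pts.take N).map Prod.fst)) := by
  simp only [oracleS, eval, PMF.pure_bind, eval_map]
  rw [mapP_pure Prod.fst _ fun _ => rfl]
  simp only [PMF.pure_bind]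

/-- Truncated subtraction of the length of (the first `N` elements of) a list. -/
def subLength : Tame (.prod (.list .nat) .nat) .nat :=
  .comp (.pair .fst .id) (fold (.comp (.pair (.comp .snd .fst) (.lit 1)) .sub))

theorem eval_subLength (x : (Ty.prod (.list .nat) .nat).val P) :
    eval P N subLength x = PMF.pure (x.2 - (x.1.take N).length : ℕ) := by
  simp only [subLength, eval, PMF.pure_bind, eval_fold]
  rw [foldP_pure (fun (s : ℕ) (_ : ℕ) => s - 1) _ fun _ _ => rfl]
  congr 1
  suffices ∀ (l : List ℕ) (s : ℕ), l.foldl (fun s _ => s - 1) s = s - l.length from this _ _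
  intro l
  induction l with
  | nil => simp
  | cons y l ih => intro s; rw [List.foldl_cons, ih, List.length_cons]; omega

/-- Truncated subtraction of the number of servers whose index is in a list. -/
def subCount : Tame (.prod (.list .nat) (.prod (.list pointTy) .nat)) .nat :=
  fold (.comp (.pair (.comp .snd .fst)
    (.comp (.pair (.comp .snd (.comp .snd .fst)) .fst) mem)) .sub)

theorem eval_subCount (x : (Ty.prod (.list .nat) (.prod (.list pointTy) .nat)).val P) :
    eval P N subCount x = PMF.pure
      (x.2.2 - (x.2.1.take N).countP (fun p : ℕ × ℕ => p.1 ∈ x.1.take N) : ℕ) := by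
  simp only [subCount, eval, PMF.pure_bind, eval_fold, eval_mem]
  rw [foldP_pure (fun (s : ℕ) (p : ℕ × ℕ) => s - if p.1 ∈ x.1.take N then 1 else 0) _
    fun _ _ => rfl]
  congr 1
  suffices ∀ (l : List (ℕ × ℕ)) (s : ℕ),
      l.foldl (fun s p => s - if p.1 ∈ x.1.take N then 1 else 0) s =
        s - l.countP (fun p : ℕ × ℕ => p.1 ∈ x.1.take N) from this _ _
  intro l
  induction l with
  | nil => simp
  | cons y l ih =>
    intro s
    rw [List.foldl_cons, ih, List.countP_cons]
    by_cases h : y.1 ∈ x.1.take N <;> simp [h]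
    omega

/-- The challenge oracle, on `((context, (t, (m, flag))), L)`. -/
def challenge : Tame (.prod (.prod ctxTy (.prod .nat (.prod .grp .nat))) (.list .nat))
    (.list ansTy) :=
  .comp (.pair (.comp (.pair (.comp (.pair .snd (.comp .fst (.comp .snd .fst))) subLength)
    (.lit 1)) natEq) .id) <|
  .ite (.comp (.pair (.comp (.pair
      (.comp (.pair .snd (.pair (.comp .fst (.comp .fst (.comp .snd (.comp .snd (.comp .snd .snd)))))
        (.comp .fst (.comp .snd .fst)))) subCount)
      (.lit 1)) natEq) .id) <|
    .ite (.comp (.pair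
        (.comp (.pair (.comp .fst .fst) (.pair (.comp .fst (.comp .snd (.comp .snd .fst)))
          (.comp (.pair (.comp .fst (.comp .snd (.comp .snd .snd))) .snd) (.ite .nil .id)))) answer)
        .nil) .cons) .nil)
    .nil

theorem eval_challenge (q t fl : ℕ) (g Y m : P.G) (cs : List (coeffTy.val P))
    (pts : List (ℕ × ℕ)) (L : List ℕ) :
    eval P N challenge (((q, (g, (Y, (cs, pts)))), (t, (m, fl))), L) =
      if t - (L.take N).length = 1 ∧
          t - (pts.take N).countP (fun p => p.1 ∈ L.take N) = 1 then
        (eval P N answer ((q, (g, (Y, (cs, pts)))), (m, if fl = 0 then L else []))).bind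
          fun y => PMF.pure [y]
      else PMF.pure [] := by
  simp only [challenge, eval, PMF.pure_bind, PMF.bind_bind, eval_natEq, eval_subLength,
    eval_subCount]
  by_cases h₁ : t - (L.take N).length = 1
  · by_cases h₂ : t - (pts.take N).countP (fun p => p.1 ∈ L.take N) = 1
    · by_cases h₃ : fl = 0 <;> simp [-List.length_take, h₁, h₂, h₃]
    · simp [-List.length_take, h₁, h₂]
  · simp [-List.length_take, h₁]

/-- A server with a random point, on `(q, index)`. -/
def point : Tame (.prod .nat .nat) pointTy := .pair .snd (.comp .fst .rand)

/-- The data of coefficient `l - 1`, on `(((i, (q, g)), (X, (Y, Z))), l)`. -/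
def coeff : Tame (.prod (.prod (.prod .nat (.prod .nat .grp)) (.prod .grp (.prod .grp .grp))) .nat)
    coeffTy :=
  .comp (.pair (.comp .fst (.comp .fst (.comp .snd (.comp .fst .rand)))) .id) <|
  .comp (.pair (.comp (.pair (.comp (.pair (.comp .snd .snd) (.lit 1)) .sub)
    (.comp .snd (.comp .fst (.comp .fst .fst)))) natEq) .id) <|
  .ite
    (.pair (.comp .snd (.comp .fst (.comp .snd .fst)))
      (.pair (.comp .snd (.comp .fst (.comp .snd (.comp .snd .snd)))) (.lit 0)))
    (.pair (.comp (.pair (.comp .snd (.comp .fst (.comp .fst (.comp .snd .snd)))) .fst) pow)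
      (.pair (.comp (.pair (.comp .snd (.comp .fst (.comp .snd (.comp .snd .fst)))) .fst) pow)
        (.comp (.pair
          (.comp (.pair (.comp .snd (.comp .fst (.comp .fst .fst)))
            (.comp (.pair (.comp .snd .snd) (.lit 1)) .sub)) .sub)
          (.comp .snd (.comp .fst (.comp .fst (.comp .snd .fst))))) (.ite .id (.lit 0)))))

/-- The label l stands for coefficient l - 1, because `iota` counts from 1. The last component is
the bound for the noise in `coord`: q gives uniform noise, while 0 gives none since sampling below 0
returns 0. The number a is drawn even for l - 1 = i, where it is discarded. -/
theorem eval_coeff (i q l : ℕ) (g X Y Z : P.G) :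
    eval P N coeff (((i, (q, g)), (X, (Y, Z))), l) = (uniformBelow q).bind fun a =>
      PMF.pure (if l - 1 = i then (X, (Z, 0)) else
        (g ^ (a % 2 ^ N), (Y ^ (a % 2 ^ N), if l - 1 < i then q else 0)) : P.G × P.G × ℕ) := by
  simp only [coeff, eval, PMF.pure_bind, PMF.bind_bind, eval_natEq, eval_pow]
  congr 1
  funext a
  by_cases h₁ : l - 1 = i
  · simp [h₁]
  · by_cases h₂ : l - 1 < i
    · have : i - (l - 1) ≠ 0 := by omega
      simp [h₁, h₂, this]
    · have : i - (l - 1) = 0 := by omega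
      simp [h₁, h₂, this]

/-- Data type of the result of `setup`: `(b, ((contexts), (t, input)))`. -/
abbrev _root_.setupTy : Ty := .prod .nat (.prod (.prod ctxTy ctxTy) (.prod .nat inTy))

/-- Generates keys from a Diffie–Hellman instance, on `(n, (t, instance))`. -/
def setup : Tame (.prod .nat (.prod .nat ddhTy)) setupTy :=
  .comp (.pair
    (.comp (.pair (.comp .snd (.comp .snd (.comp .snd (.comp .fst (.comp .snd .fst)))))
      (.comp .fst iota)) (map point))
    (.pair (.comp .snd (.comp .fst .rand)) .id)) <|
  .comp (.pair
    (.comp (.pair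
      (.pair (.pair (.comp .snd .fst)
          (.comp .snd (.comp .snd (.comp .snd (.comp .snd (.comp .snd (.comp .fst .snd)))))))
        (.comp .snd (.comp .snd (.comp .snd (.comp .snd (.comp .snd .snd))))))
      (.comp .snd (.comp .snd (.comp .snd (.comp .fst iota))))) (map coeff))
    (.pair .fst (.comp .snd .snd))) <|
  .pair (.comp (.lit 2) .rand)
    (.pair
      (.pair
        (.pair (.comp .snd (.comp .snd (.comp .snd (.comp .snd (.comp .snd (.comp .fst (.comp .snd .fst)))))))
          (.pair (.comp .snd (.comp .snd (.comp .snd (.comp .snd (.comp .snd (.comp .fst (.comp .snd .snd)))))))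
            (.pair .gone
              (.pair (.comp .fst (.comp (.pair .id .id)
                (map (.pair (.comp .snd .fst) (.pair .gone (.lit 0)))))) (.comp .snd .fst)))))
        (.pair (.comp .snd (.comp .snd (.comp .snd (.comp .snd (.comp .snd (.comp .fst (.comp .snd .fst)))))))
          (.pair (.comp .snd (.comp .snd (.comp .snd (.comp .snd (.comp .snd (.comp .fst (.comp .snd .snd)))))))
            (.pair (.comp .snd (.comp .snd (.comp .snd (.comp .snd (.comp .snd (.comp .snd (.comp .snd .fst)))))))
              (.pair .fst (.comp .snd .fst))))))
      (.pair (.comp .snd (.comp .snd (.comp .snd .fst)))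
        (.pair
          (.pair (.comp .snd (.comp .snd (.comp .snd (.comp .snd .fst))))
            (.pair (.comp .snd (.comp .snd .fst)) (.comp .snd (.comp .snd (.comp .snd .fst)))))
          (.pair (.comp .snd (.comp .snd (.comp .snd (.comp .snd (.comp .snd (.comp .fst .fst))))))
            (.pair (.comp .snd (.comp .snd (.comp .snd (.comp .snd (.comp .snd (.comp .fst (.comp .snd .fst)))))))
              (.pair (.comp .snd (.comp .snd (.comp .snd (.comp .snd (.comp .snd (.comp .fst (.comp .snd .snd)))))))
                (.pair
                  (.comp (.pair (.comp .fst (.comp (.pair .id .id) (map (.comp .snd .fst))))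
                    (.lit 0)) horner)
                  (.comp .snd (.comp .fst (.comp (.pair .id .id) (map (.comp .snd .snd))))))))))))

theorem eval_setup {n t : ℕ} (hn : n ≤ N) (ht : t ≤ N) (k desc q : ℕ) (g X Y Z : P.G) :
    eval P N setup (n, (t, (k, ((desc, (q, g)), (X, (Y, Z)))))) =
      (mapP (fun l => eval P N point (q, l)) (List.ofFn fun i : Fin n => (i : ℕ) + 1)).bind
        fun pts => (uniformBelow t).bind fun i =>
      (mapP (fun l => eval P N coeff (((i, (q, g)), (X, (Y, Z))), l))
        (List.ofFn fun j : Fin t => (j : ℕ) + 1)).bind fun cs => (uniformBelow 2).bind fun b =>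
      PMF.pure (b, (((q, (g, ((1 : P.G), (cs.map (fun y => (y.1, ((1 : P.G), 0))), pts)))),
        (q, (g, (Y, (cs, pts))))), (t, ((k, (n, t)), (desc, (q, (g,
          (_root_.horner (G := P.G) (cs.map Prod.fst) 0, pts.map Prod.snd)))))))) := by
  simp only [setup, eval, PMF.pure_bind, PMF.bind_bind]
  simp only [eval_map, eval_iota hn, eval_iota ht, PMF.pure_bind, eval]
  rw [List.take_of_length_le (by simpa using hn), List.take_of_length_le (by simpa using ht)]
  refine PMF.bind_congr_of_support _ fun pts hpts => ?_
  congr 1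
  funext i
  refine PMF.bind_congr_of_support _ fun cs hcs => ?_
  congr 1
  funext b
  have h₁ : pts.length ≤ N := by simpa [length_of_mem_support_mapP hpts] using hn
  have h₂ : cs.length ≤ N := by simpa [length_of_mem_support_mapP hcs] using ht
  rw [List.take_of_length_le h₁, List.take_of_length_le h₂,
    mapP_pure (fun y : coeffTy.val P => ((y.1, ((1 : P.G), 0)) : coeffTy.val P)) _ fun _ => rfl,
    mapP_pure (fun y : coeffTy.val P => y.1) _ fun _ => rfl,
    mapP_pure (fun y : pointTy.val P => y.2) _ fun _ => rfl]
  simp only [PMF.pure_bind]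
  rw [eval_horner (by simpa using h₂), PMF.pure_bind]
  simp

end Tame
end

noncomputable section

open scoped ENNReal

/-! ### Arithmetic in the exponent -/

namespace GroupInst

variable (P : GroupInst)

theorem g_pow_q : P.g ^ P.q = 1 := by
  rw [← P.card_eq]
  exact pow_card_eq_one'

theorem gpow_natCast (n : ℕ) : P.gpow (n : ZMod P.q) = P.g ^ n := by
  rw [gpow, ZMod.val_natCast, ← pow_eq_pow_mod n P.g_pow_q]

theorem gpow_zero : P.gpow 0 = 1 := by
  simpa using P.gpow_natCast 0

theorem gpow_add (a b : ZMod P.q) : P.gpow (a + b) = P.gpow a * P.gpow b := by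
  rw [← ZMod.natCast_zmod_val a, ← ZMod.natCast_zmod_val b, ← Nat.cast_add]
  simp only [gpow_natCast, pow_add]

theorem gpow_pow (a : ZMod P.q) (n : ℕ) : P.gpow a ^ n = P.gpow (a * n) := by
  rw [← ZMod.natCast_zmod_val a, ← Nat.cast_mul]
  simp only [gpow_natCast, pow_mul]

theorem gpow_pow_val (a b : ZMod P.q) : P.gpow a ^ b.val = P.gpow (a * b) := by
  rw [gpow_pow, ZMod.natCast_zmod_val]

theorem g_pow_val (a : ZMod P.q) : P.g ^ a.val = P.gpow a := rfl

theorem finite : Finite P.G :=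
  Nat.finite_of_card_ne_zero (by rw [P.card_eq]; exact P.prime.1.ne_zero)

/-- Together with injectivity this allows arbitrary group elements to be written as powers of g, so
that everything below is linear algebra over the field of exponents. -/
theorem gpow_surjective : Function.Surjective P.gpow := fun y => by
  have := P.finite
  obtain ⟨n, hn⟩ := mem_powers_iff_mem_zpowers.2 (P.g_gen y)
  exact ⟨n, (P.gpow_natCast n).trans hn⟩

theorem gpow_injective : Function.Injective P.gpow := by
  have := P.finite
  exact ((Nat.bijective_iff_surjective_and_card _).2 ⟨P.gpow_surjective, by
    rw [P.card_eq, Nat.card_zmod]⟩).1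

end GroupInst

namespace ElGamal

variable {q t : ℕ}

theorem share_add (a b : Fin t → ZMod q) (x : ZMod q) :
    share (fun j => a j + b j) x = share a x + share b x := by
  simp [share, add_mul, Finset.sum_add_distrib]

theorem share_mul (r : ZMod q) (a : Fin t → ZMod q) (x : ZMod q) :
    share (fun j => r * a j) x = r * share a x := by
  simp [share, mul_assoc, Finset.mul_sum]

/-- One step of Horner's rule. -/
theorem share_succ (z : Fin (t + 1) → ZMod q) (x : ZMod q) :
    share z x = share (fun j => z j.succ) x * x + z 0 := by
  simp only [share, Fin.sum_univ_succ, Fin.val_succ, Fin.val_zero, pow_zero, mul_one, pow_succ,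
    Finset.sum_mul, mul_assoc]
  ring

theorem horner_ofFn (P : GroupInst) {t : ℕ} (z : Fin t → ZMod P.q) (x : ℕ) :
    horner (List.ofFn fun j => P.gpow (z j)) x = P.gpow (share z x) := by
  induction t with
  | zero => simp [horner, share, P.gpow_zero]
  | succ t ih =>
    rw [share_succ, P.gpow_add, ← P.gpow_pow, ← ih, List.ofFn_succ]
    rfl

open PMF

/-! ### Answers of the key owner in terms of exponents -/

variable {P : GroupInst} {n t : ℕ}

/-- An answer with randomness `g ^ r` that is made from `z`, which stands for `r` times the
coefficients of the sharing polynomial. Servers that are not in `L` use random keys. -/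
def answerOf (x : Fin n → ZMod P.q) (m : P.G) (L : List ℕ)
    (w : ZMod P.q × (Fin t → ZMod P.q)) : PMF (ansTy.val P) :=
  (unif (Fin n → ZMod P.q)).bind fun ρ => PMF.pure
    ((P.gpow w.1, m * P.gpow (share w.2 0)), List.ofFn fun i : Fin n =>
      P.gpow (if (i : ℕ) + 1 ∈ L then share w.2 (x i) else w.1 * ρ i))

/-- The list of all servers. -/
def allServers (n : ℕ) : List ℕ := List.ofFn fun i : Fin n => (i : ℕ) + 1

theorem mem_allServers (i : Fin n) : (i : ℕ) + 1 ∈ allServers n :=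
  (List.mem_ofFn' _ _).2 ⟨i, rfl⟩

/-- Servers with their public points. -/
def points (x : Fin n → ZMod P.q) : List (pointTy.val P) :=
  List.ofFn fun i : Fin n => ((i : ℕ) + 1, (x i).val)

/-- Data of the coefficients; the first `i` of them are hidden by random noise. -/
def coeffs (a w : Fin t → ZMod P.q) (i : ℕ) : List (coeffTy.val P) :=
  List.ofFn fun j : Fin t => (P.gpow (a j), (P.gpow (w j), if (j : ℕ) < i then P.q else 0))

/-- Joint distribution of the exponents in simulated answers. -/
def simSampler (P : GroupInst) (β : ZMod P.q) (a w : Fin t → ZMod P.q) (i : ℕ) :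
    PMF (ZMod P.q × (Fin t → ZMod P.q)) :=
  (unif (ZMod P.q)).bind fun s => (unif (ZMod P.q)).bind fun s' =>
    (unif (Fin t → ZMod P.q)).bind fun u => PMF.pure
      (β * s + s', fun j => w j * s + a j * s' + if (j : ℕ) < i then u j else 0)

variable {N : ℕ}

/-- The power program reads only N bits of the exponent; this is harmless for reduced exponents as
soon as q ≤ 2^N. -/
theorem val_mod_two_pow (hq : P.q ≤ 2 ^ N) (a : ZMod P.q) : a.val % 2 ^ N = a.val :=
  Nat.mod_eq_of_lt (a.val_lt.trans_le hq)

theorem bind_uniformBelow_q {α : Type*} (f : ℕ → PMF α) :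
    (uniformBelow P.q).bind f = (unif (ZMod P.q)).bind fun s => f s.val := by
  rw [uniformBelow_eq_map_val, PMF.bind_map]
  rfl

theorem map_eq_bind_pure {α β : Type*} (f : α → β) (p : PMF α) :
    p.map f = p.bind fun x => PMF.pure (f x) := rfl

/-- In exponents, Y^s g^{s'} is βs + s', and the element computed for coefficient j is w_j s + a_j
s' plus possible noise. Multiplying or raising to powers in the group is adding or multiplying here,
so the program samples exactly from `simSampler`. -/
theorem eval_answer (hq : P.q ≤ 2 ^ N) (hn : n ≤ N) (ht : t ≤ N) (β : ZMod P.q)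
    (a w : Fin t → ZMod P.q) (i : ℕ) (x : Fin n → ZMod P.q) (m : P.G) (L : List ℕ) :
    Tame.eval P N Tame.answer
        ((P.q, (P.g, (P.gpow β, (coeffs a w i, points x)))), (m, L)) =
      (simSampler P β a w i).bind (answerOf x m (L.take N)) := by
  rw [Tame.eval_answer, bind_uniformBelow_q, simSampler, PMF.bind_bind]
  congr 1
  funext s
  rw [bind_uniformBelow_q, PMF.bind_bind]
  congr 1
  funext s'
  rw [List.take_of_length_le (by simpa [coeffs] using ht),
    List.take_of_length_le (by simpa [points] using hn), PMF.bind_bind, coeffs,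
    mapP_ofFn _ _ (fun (j : Fin t) (u : ZMod P.q) =>
      P.gpow (w j * s + a j * s' + if (j : ℕ) < i then u else 0)), PMF.bind_map]
  · congr 1
    funext u
    rw [Function.comp_apply, points, mapP_ofFn _ _ (fun (j : Fin n) (ρ : ZMod P.q) =>
      P.gpow (if (j : ℕ) + 1 ∈ L.take N then
        share (fun j => w j * s + a j * s' + if (j : ℕ) < i then u j else 0) (x j) else
        (β * s + s') * ρ)), PMF.bind_map, PMF.pure_bind, answerOf]
    · congr 1
      funext ρ
      rw [Function.comp_apply, val_mod_two_pow hq, val_mod_two_pow hq, P.gpow_pow_val,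
        P.g_pow_val, ← P.gpow_add, horner_ofFn, Nat.cast_zero]
    · intro j
      rw [Tame.eval_shareOf _ (by simpa using ht)]
      simp only [val_mod_two_pow hq, P.gpow_pow_val, P.g_pow_val, ← P.gpow_add, horner_ofFn,
        ZMod.natCast_zmod_val, bind_uniformBelow_q]
      split_ifs
      · exact (PMF.map_const _ _).symm
      · rfl
  · intro j
    simp only [Tame.eval_coord, val_mod_two_pow hq, P.gpow_pow_val, ← P.gpow_add]
    split_ifs
    · simp only [bind_uniformBelow_q, val_mod_two_pow hq, P.g_pow_val, ← P.gpow_add]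
      rfl
    -- The noise bound is 0, so the sampled noise is the constant 0.
    · simp [uniformBelow, map_eq_bind_pure]

/-! ### Hybrid distributions and the self-reduction of Diffie–Hellman triples -/

/-- Joint distribution of the exponents in answers: the first `i` coefficients are random. -/
def hybSampler (P : GroupInst) (a : Fin t → ZMod P.q) (i : ℕ) :
    PMF (ZMod P.q × (Fin t → ZMod P.q)) :=
  (unif (ZMod P.q)).bind fun r => (unif (Fin t → ZMod P.q)).bind fun u => PMF.pure
    (r, fun j => r * a j + if (j : ℕ) < i then u j else 0)

theorem hybSampler_zero (a : Fin t → ZMod P.q) :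
    hybSampler P a 0 = (unif (ZMod P.q)).bind fun r => PMF.pure (r, fun j => r * a j) := by
  simp [hybSampler]

theorem bind_unif_eq_of_map {A B γ : Type*} [Fintype A] [Nonempty A] [Fintype B] [Nonempty B]
    {F : A → B} (hF : (unif A).map F = unif B) (f : B → PMF γ) :
    (unif B).bind f = (unif A).bind fun a => f (F a) := by
  rw [← hF, PMF.bind_map]
  rfl

theorem unif_add_const {q : ℕ} [NeZero q] (c : ZMod q) :
    (unif (ZMod q)).map (fun s => c + s) = unif (ZMod q) :=
  unif_map_equiv (Equiv.addLeft c)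

/-- On a Diffie–Hellman triple the first `i` coefficients are random. -/
theorem simSampler_mul (β : ZMod P.q) (a : Fin t → ZMod P.q) (i : ℕ) :
    simSampler P β a (fun j => β * a j) i = hybSampler P a i := by
  rw [simSampler, hybSampler]
  -- The target has no s. An idle draw of s is inserted, and for each s the translation r = βs + s'
  -- keeps r uniform.
  refine Eq.trans ?_ (PMF.bind_const (unif (ZMod P.q)) _)
  congr 1
  funext s
  refine Eq.trans ?_ (bind_unif_eq_of_map (unif_add_const (β * s)) _).symm
  congr 1
  funext s'
  congr 1
  funext u
  congr 2
  funext j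
  ring

theorem unif_bind_bind {A B γ : Type*} [Fintype A] [Nonempty A] [Fintype B] [Nonempty B]
    (f : A → B → PMF γ) :
    ((unif A).bind fun a => (unif B).bind fun b => f a b) =
      (unif (A × B)).bind fun x => f x.1 x.2 := by
  rw [unif_prod, PMF.bind_bind]
  simp only [PMF.bind_map]
  rfl

/-- On a random triple one more coefficient is random. -/
theorem simSampler_update (α β γ : ZMod P.q) (h : γ ≠ β * α) (a : Fin t → ZMod P.q) (i : Fin t) :
    simSampler P β (Function.update a i α) (Function.update (fun j => β * a j) i γ) i =
      hybSampler P (Function.update a i α) (i + 1) := by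
  have hd : γ - β * α ≠ 0 := sub_ne_zero.2 h
  rw [simSampler, hybSampler]
  simp only [unif_bind_bind]
  -- F sends (s, s', u) to the randomness r = βs + s' and to the noise vector of the next hybrid.
  -- Its coordinate i is (γ - βα)s, because γs + αs' = rα + (γ - βα)s. The entry u_i is free to be
  -- overwritten, since only the noise of coordinates below i is used. The map is linear, so
  -- uniformity follows from surjectivity, for which γ ≠ βα lets s be solved from coordinate i.
  let F : ZMod P.q × ZMod P.q × (Fin t → ZMod P.q) → ZMod P.q × (Fin t → ZMod P.q) := fun y =>
    (β * y.1 + y.2.1, Function.update y.2.2 i ((γ - β * α) * y.1))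
  have hF : (unif (ZMod P.q × ZMod P.q × (Fin t → ZMod P.q))).map F = unif _ := by
    refine unif_map_eq_unif F ?_ ?_
    · intro y y'
      refine Prod.ext (by simp [F]; ring) (funext fun j => ?_)
      by_cases hj : j = i
      · subst hj; simp [F]; ring
      · simp [F, hj]
    · intro y
      refine ⟨((γ - β * α)⁻¹ * y.2 i, y.1 - β * ((γ - β * α)⁻¹ * y.2 i), y.2), ?_⟩
      refine Prod.ext (by simp [F]) (funext fun j => ?_)
      by_cases hj : j = i
      · subst hj; simp [F, hd]
      · simp [F, hj]
  rw [bind_unif_eq_of_map hF]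
  congr 1
  funext y
  congr 2
  funext j
  by_cases hj : j = i
  · subst hj
    simp [F]
    ring
  · have : (j : ℕ) < i + 1 ↔ (j : ℕ) < i := by
      have := Fin.val_ne_of_ne hj
      omega
    simp [F, hj, this]
    ring

end ElGamal
end

noncomputable section

open scoped ENNReal

/-! ### Replacing an oracle by a statistically close one -/

namespace Prog

open PMF

variable {Q R a b c : Ty} {P : GroupInst}

/-- If two oracles are at statistical distance at most `ε` on each query, the outputs of a program
are at distance at most `ε` times the expected running time. -/
theorem ex_run_le {O O' : Q.val P → PMF (R.val P)} {ε : ℝ≥0∞}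
    (hO : ∀ y f, (∀ z, f z ≤ 1) → (O y).ex f ≤ (O' y).ex f + ε) (p : Prog Q R a b) (x : a.val P)
    (f : b.val P → ℝ≥0∞) (hf : ∀ y, f y ≤ 1) :
    (p.run P O x).ex (fun y => f y.1) ≤
      (p.run P O' x).ex (fun y => f y.1) + ε * (p.run P O x).ex fun y => (y.2 : ℝ≥0∞) := by
  induction p with
  | id | unit | fst | snd | lit | arith | nil | cons | gone | gmul | enc | dec | rand =>
    exact le_add_right le_rfl
  | comp p q hp hq =>
    have hH : ∀ y, (q.run P O' y).ex (fun z => f z.1) ≤ 1 := fun y => ex_le_of_le _ fun z _ => hf _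
    simp only [Prog.run, ex_bind, ex_map]
    calc _ ≤ (p.run P O x).ex fun y => (q.run P O' y.1).ex (fun z => f z.1) +
          ε * (q.run P O y.1).ex fun z => (z.2 : ℝ≥0∞) := ex_mono _ fun y => hq y.1 f hf
      _ = ((p.run P O x).ex fun y => (q.run P O' y.1).ex (fun z => f z.1)) +
          ε * (p.run P O x).ex fun y => (q.run P O y.1).ex fun z => (z.2 : ℝ≥0∞) := by
        rw [ex_add, ex_const_mul]
      _ ≤ _ := by
        -- The second program has been switched to the other oracle already; its expected value is a
        -- test function bounded by 1, to which the induction hypothesis for the first program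
        -- applies. The errors add up like the expected running times.
        refine (add_le_add_left (hp x _ hH) _).trans ?_
        rw [add_assoc, ← mul_add, ← ex_add]
        gcongr
        refine ex_mono _ fun y => ?_
        rw [← ex_const (q.run P O y.1) (y.2 : ℝ≥0∞), ← ex_add]
        refine ex_mono _ fun z => ?_
        push_cast
        exact le_self_add
  | pair p q hp hq =>
    have hH : ∀ y, (q.run P O' x).ex (fun z => f (y, z.1)) ≤ 1 := fun y =>
      ex_le_of_le _ fun z _ => hf _
    simp only [Prog.run, ex_bind, ex_map]
    calc _ ≤ (p.run P O x).ex fun y => (q.run P O' x).ex (fun z => f (y.1, z.1)) +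
          ε * (q.run P O x).ex fun z => (z.2 : ℝ≥0∞) :=
          ex_mono _ fun y => hq x (fun z => f (y.1, z)) fun z => hf _
      _ = ((p.run P O x).ex fun y => (q.run P O' x).ex (fun z => f (y.1, z.1))) +
          ε * (p.run P O x).ex fun y => (q.run P O x).ex fun z => (z.2 : ℝ≥0∞) := by
        rw [ex_add, ex_const_mul]
      _ ≤ _ := by
        refine (add_le_add_left (hp x _ hH) _).trans ?_
        rw [add_assoc, ← mul_add, ← ex_add]
        gcongr
        refine ex_mono _ fun y => ?_
        rw [← ex_const (q.run P O x) (y.2 : ℝ≥0∞), ← ex_add]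
        refine ex_mono _ fun z => ?_
        push_cast
        exact le_self_add
  | ite p q hp hq =>
    obtain ⟨n, x⟩ := x
    cases n with
    | zero =>
      simp only [Prog.run, ex_map, Prod.map]
      refine (hq x f hf).trans ?_
      gcongr
      exact ex_mono _ fun y => by push_cast; exact le_self_add
    | succ n =>
      simp only [Prog.run, ex_map, Prod.map]
      refine (hp x f hf).trans ?_
      gcongr
      exact ex_mono _ fun y => by push_cast; exact le_self_add
  | lcase p q hp hq =>
    obtain ⟨l, x⟩ := x
    cases l with
    | nil =>
      simp only [Prog.run, ex_map, Prod.map]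
      refine (hp x f hf).trans ?_
      gcongr
      exact ex_mono _ fun y => by push_cast; exact le_self_add
    | cons z l =>
      simp only [Prog.run, ex_map, Prod.map]
      refine (hq _ f hf).trans ?_
      gcongr
      exact ex_mono _ fun y => by push_cast; exact le_self_add
  | loop p hp =>
    obtain ⟨n, x⟩ := x
    simp only [Prog.run]
    induction n generalizing x with
    | zero => exact le_add_right le_rfl
    | succ n ih =>
      have hH : ∀ y, (iterateCost (p.run P O') n y).ex (fun z => f z.1) ≤ 1 := fun y =>
        ex_le_of_le _ fun z _ => hf _
      simp only [iterateCost, ex_bind, ex_map]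
      calc _ ≤ (p.run P O x).ex fun y => (iterateCost (p.run P O') n y.1).ex (fun z => f z.1) +
            ε * (iterateCost (p.run P O) n y.1).ex fun z => (z.2 : ℝ≥0∞) :=
            ex_mono _ fun y => ih y.1
        _ = ((p.run P O x).ex fun y => (iterateCost (p.run P O') n y.1).ex (fun z => f z.1)) +
            ε * (p.run P O x).ex fun y =>
              (iterateCost (p.run P O) n y.1).ex fun z => (z.2 : ℝ≥0∞) := by
          rw [ex_add, ex_const_mul]
        _ ≤ _ := by
          refine (add_le_add_left (hp x _ hH) _).trans ?_
          rw [add_assoc, ← mul_add, ← ex_add]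
          gcongr
          refine ex_mono _ fun y => ?_
          rw [← ex_const (iterateCost (p.run P O) n y.1) (y.2 : ℝ≥0∞), ← ex_add]
          refine ex_mono _ fun z => ?_
          push_cast
          exact le_self_add
  | call =>
    -- This is the only place where ε is charged, and a call costs exactly one step.
    simp only [Prog.run, ex_map]
    refine (hO x f hf).trans ?_
    simp [ex_const]

end Prog

namespace ElGamal

open PMF

variable {P : GroupInst} {n t N : ℕ}

/-! ### The oracles of the games -/

/-- Public key. -/
def publicKey (P : GroupInst) (a : Fin t → ZMod P.q) (x : Fin n → ZMod P.q) : pkTy.val P :=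
  (P.desc, P.q, P.g, P.gpow (share a 0), List.ofFn fun i => (x i).val)

/-- The procedure `S`, in terms of exponents. -/
def keyOwner (a : Fin t → ZMod P.q) (x : Fin n → ZMod P.q) (m : P.G) : PMF (ansTy.val P) :=
  (hybSampler P a 0).bind (answerOf x m (allServers n))

/-- Raising g^r to the share f(x_i) amounts to evaluating the polynomial with coefficients r a_j. As
all servers are listed, the fresh keys in `answerOf` have no effect. -/
theorem oracleS_eq (gen : ℕ → PMF GroupInst) (a : Fin t → ZMod P.q) (x : Fin n → ZMod P.q)
    (m : P.G) :
    (elGamal gen).oracleS P (publicKey P a x) (fun i => share a (x i)) m = keyOwner a x m := by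
  simp only [TEScheme.oracleS, elGamal, Enc, SD, keyOwner, hybSampler_zero, answerOf, publicKey,
    PMF.map_comp, PMF.bind_bind, PMF.pure_bind, share_mul, mem_allServers, if_true,
    PMF.bind_const, P.gpow_pow_val, P.g_pow_val]
  rw [map_eq_bind_pure]
  simp only [Function.comp_apply, P.gpow_pow_val, mul_comm]

theorem oracleI_eq (gen : ℕ → PMF GroupInst) (a : Fin t → ZMod P.q) (x : Fin n → ZMod P.q)
    (m : P.G) (L : List ℕ) :
    (elGamal gen).oracleI P (publicKey P a x) (fun i => share a (x i)) m L =
      (hybSampler P a 0).bind (answerOf x m L) := by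
  simp only [TEScheme.oracleI, elGamal, Enc, SD, hybSampler_zero, answerOf, publicKey,
    PMF.bind_map, PMF.bind_bind, PMF.pure_bind, share_mul]
  congr 1
  funext r
  rw [Function.comp_apply, map_eq_bind_pure]
  simp only [P.g_pow_val, P.gpow_pow_val, mul_comm r]
  congr 1
  funext ρ
  congr 3
  funext i
  split_ifs
  · rw [mul_comm]
  · rw [mul_comm]

theorem oracleF_eq (gen : ℕ → PMF GroupInst) (a : Fin t → ZMod P.q) (x : Fin n → ZMod P.q)
    (m : P.G) :
    (elGamal gen).oracleF P n (publicKey P a x) m =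
      (hybSampler P a 0).bind (answerOf x m []) := by
  simp only [TEScheme.oracleF, elGamal, Enc, SD, hybSampler_zero, answerOf, publicKey,
    PMF.bind_map, PMF.bind_bind, PMF.pure_bind, share_mul]
  congr 1
  funext r
  rw [Function.comp_apply, map_eq_bind_pure]
  simp only [P.g_pow_val, P.gpow_pow_val, mul_comm, List.not_mem_nil, if_false]
  rfl

open Classical in
/-- The challenge oracle for message `m`, in terms of exponents that are sampled from `Ψ`. If
`fl ≠ 0`, all decryption shares are random. -/
def challenger (t : ℕ) (x : Fin n → ZMod P.q) (Ψ : PMF (ZMod P.q × (Fin t → ZMod P.q)))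
    (m : P.G × ℕ) (L : List ℕ) : PMF (List (ansTy.val P)) :=
  if TEScheme.ValidIndices n t L then
    (Ψ.bind (answerOf x m.1 (if m.2 = 0 then L else []))).bind fun y => PMF.pure [y]
  else PMF.pure []

/-- With Y = 1 and all W_j = 1, that is β = 0 and w = 0, the context is a degenerate Diffie–Hellman
instance. Then r = s', and the exponents are r a_j without any knowledge of the a_j. -/
theorem eval_oracleS (hq : P.q ≤ 2 ^ N) (hn : n ≤ N) (ht : t ≤ N) (a : Fin t → ZMod P.q)
    (x : Fin n → ZMod P.q) (m : P.G) :
    Tame.eval P N Tame.oracleS ((P.q, (P.g, (P.gpow 0, (coeffs a 0 0, points x)))), m) =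
      keyOwner a x m := by
  have h : ((points x).take N).map Prod.fst = allServers n := by
    rw [List.take_of_length_le (by simpa [points] using hn), points, List.map_ofFn]
    rfl
  have h0 : (0 : Fin t → ZMod P.q) = fun j => 0 * a j := by
    funext j
    simp
  rw [Tame.eval_oracleS, h, eval_answer hq hn ht, h0, simSampler_mul,
    List.take_of_length_le (by simpa [allServers] using hn)]
  rfl

theorem countP_points (x : Fin n → ZMod P.q) (L : List ℕ) :
    (points x).countP (fun p => p.1 ∈ L) = (Finset.Icc 1 n ∩ L.toFinset).card := by
  have h1 : (points x).countP (fun p => p.1 ∈ L) = (allServers n).countP (fun i => i ∈ L) := by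
    have : allServers n = (points x).map Prod.fst := by
      rw [points, List.map_ofFn]
      rfl
    rw [this, List.countP_map]
    rfl
  have hnd : (allServers n).Nodup := List.nodup_ofFn.2 fun i j h => Fin.ext (by simpa using h)
  rw [h1, List.countP_eq_length_filter, ← List.toFinset_card_of_nodup (hnd.filter _)]
  congr 1
  ext i
  simp only [allServers, List.mem_toFinset, List.mem_filter, List.mem_ofFn, Finset.mem_inter,
    Finset.mem_Icc, decide_eq_true_eq]
  refine and_congr_left fun _ => ⟨?_, fun h => ⟨⟨i - 1, by omega⟩, by simp; omega⟩⟩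
  rintro ⟨j, rfl⟩
  omega

/-- Two counts characterise a valid list: its length is t - 1, and t - 1 servers have their index in
it. The second count is at most the number of different entries, so equality forces the entries to
be different and in range. Requiring a truncated difference to be 1 excludes lists that are too
long; in particular one cut off at N ≥ t entries gives 0. -/
theorem validIndices_iff (ht : 1 ≤ t) (hnN : n ≤ N) (htN : t ≤ N) (x : Fin n → ZMod P.q)
    (L : List ℕ) : TEScheme.ValidIndices n t L ↔ t - (L.take N).length = 1 ∧
      t - ((points x).take N).countP (fun p => p.1 ∈ L.take N) = 1 := by
  rw [List.take_of_length_le (show (points x).length ≤ N by simpa [points] using hnN),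
    countP_points]
  have hlen : t - (L.take N).length = 1 ↔ L.length = t - 1 := by
    rw [List.length_take]
    omega
  rw [hlen, TEScheme.ValidIndices]
  refine and_congr_right fun hL => ?_
  rw [List.take_of_length_le (show L.length ≤ N by omega)]
  have h1 := Finset.card_le_card (Finset.inter_subset_right (s₁ := Finset.Icc 1 n)
    (s₂ := L.toFinset))
  have h2 := List.toFinset_card_le L
  constructor
  · rintro ⟨hnd, hmem⟩
    rw [Finset.inter_eq_right.2 fun i hi => Finset.mem_Icc.2 (hmem i (List.mem_toFinset.1 hi)),
      List.toFinset_card_of_nodup hnd]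
    omega
  · intro h
    refine ⟨Multiset.toFinset_card_eq_card_iff_nodup.1
      (show L.toFinset.card = L.length by omega), fun i hi => ?_⟩
    have := Finset.eq_of_subset_of_card_le (Finset.inter_subset_right (s₁ := Finset.Icc 1 n)
      (s₂ := L.toFinset)) (by omega)
    have hi' := List.mem_toFinset.2 hi
    rw [← this] at hi'
    exact Finset.mem_Icc.1 (Finset.mem_inter.1 hi').1

theorem eval_challenge (hq : P.q ≤ 2 ^ N) (ht1 : 1 ≤ t) (hn : n ≤ N) (ht : t ≤ N) (β : ZMod P.q)
    (a w : Fin t → ZMod P.q) (i : ℕ) (x : Fin n → ZMod P.q) (m : P.G × ℕ) (L : List ℕ) :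
    Tame.eval P N Tame.challenge
        (((P.q, (P.g, (P.gpow β, (coeffs a w i, points x)))), (t, m)), L) =
      challenger t x (simSampler P β a w i) m L := by
  obtain ⟨m, fl⟩ := m
  rw [Tame.eval_challenge, challenger]
  by_cases h : TEScheme.ValidIndices n t L
  · rw [if_pos h, if_pos ((validIndices_iff ht1 hn ht x L).1 h), eval_answer hq hn ht]
    congr 3
    by_cases hf : fl = 0
    · simp only [hf, if_true]
      exact List.take_of_length_le (by rw [h.1]; omega)
    · simp [hf]
  · rw [if_neg h, if_neg fun h' => h ((validIndices_iff ht1 hn ht x L).2 h')]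

end ElGamal
end

noncomputable section

open scoped ENNReal

namespace ElGamal

open PMF

variable {P : GroupInst} {n t N : ℕ}

/-! ### Random coefficients hide everything -/

/-- A completely random answer. -/
def randomAnswer (P : GroupInst) (n : ℕ) (r : ZMod P.q) : PMF (ansTy.val P) :=
  (unif (ZMod P.q × (Fin n → ZMod P.q))).bind fun v =>
    PMF.pure ((P.gpow r, P.gpow v.1), List.ofFn fun i : Fin n => P.gpow (v.2 i))

theorem exists_share_eq {q : ℕ} [Fact q.Prime] {ι : Type*} (S : Finset ι) (hS : S.card ≤ t)
    (v : ι → ZMod q) (hv : Set.InjOn v S) (y : ι → ZMod q) :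
    ∃ z : Fin t → ZMod q, ∀ i ∈ S, share z (v i) = y i := by
  classical
  let p := Lagrange.interpolate S v y
  refine ⟨fun j => p.coeff j, fun i hi => ?_⟩
  have hd : p.degree < t := (Lagrange.degree_interpolate_lt y hv).trans_le (by exact_mod_cast hS)
  have h1 : Polynomial.eval (v i) p = y i := Lagrange.eval_interpolate_at_node y hv hi
  rw [← h1, share, Polynomial.eval_eq_sum_degreeLTEquiv (Polynomial.mem_degreeLT.2 hd)]
  rfl

/-- The points of the servers are different and nonzero. -/
def GoodPoints (x : Fin n → ZMod P.q) : Prop := Function.Injective x ∧ ∀ i, x i ≠ 0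

/-- This is the secrecy of Shamir sharing. The values of a uniform polynomial of degree less than t
at 0 and at the at most t - 1 listed points are independent and uniform, so the message is masked
and the correct shares are uniform. The other shares are r times fresh keys, which are uniform
because r ≠ 0. The result does not depend on m or L. -/
theorem answerOf_unif {x : Fin n → ZMod P.q} (hx : GoodPoints x) (ht : 1 ≤ t) {L : List ℕ}
    (hL : L.length ≤ t - 1) (m : P.G) {r : ZMod P.q} (hr : r ≠ 0) :
    ((unif (Fin t → ZMod P.q)).bind fun u => answerOf x m L (r, u)) = randomAnswer P n r := by
  classical
  obtain ⟨μ, rfl⟩ := P.gpow_surjective m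
  simp only [answerOf, randomAnswer]
  rw [unif_bind_bind]
  let F : (Fin t → ZMod P.q) × (Fin n → ZMod P.q) → ZMod P.q × (Fin n → ZMod P.q) := fun y =>
    (share y.1 0, fun i => if (i : ℕ) + 1 ∈ L then share y.1 (x i) else r * y.2 i)
  have hF : (unif ((Fin t → ZMod P.q) × (Fin n → ZMod P.q))).map F = unif _ := by
    refine unif_map_eq_unif F ?_ ?_
    · intro y y'
      refine Prod.ext (share_add _ _ _) (funext fun i => ?_)
      by_cases hi : (i : ℕ) + 1 ∈ L
      · simp only [F, hi, if_true, Prod.snd_add, Pi.add_apply]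
        exact share_add _ _ _
      · simp [F, hi, mul_add]
    · intro y
      let S : Finset (Fin n) := Finset.univ.filter fun i => (i : ℕ) + 1 ∈ L
      have hS : S.card ≤ t - 1 := by
        refine le_trans ?_ ((List.toFinset_card_le L).trans hL)
        refine Finset.card_le_card_of_injOn (fun i : Fin n => (i : ℕ) + 1) ?_ ?_
        · intro i hi
          simpa [S] using hi
        · intro i _ j _ h
          exact Fin.ext (by simpa using h)
      -- The interpolation nodes are indexed by options: `none` is the node 0, which carries the
      -- mask of the message, and `some i` is the point of a listed server. Good points make these
      -- nodes different.
      obtain ⟨z, hz⟩ := exists_share_eq (t := t) (Finset.insertNone S)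
        (by rw [Finset.card_insertNone]; omega)
        (fun o => o.elim 0 x) (by
          rintro (_ | i) - (_ | j) - h
          · rfl
          · exact absurd h.symm (hx.2 j)
          · exact absurd h (hx.2 i)
          · exact congrArg some (hx.1 h))
        (fun o => o.elim y.1 y.2)
      refine ⟨(z, fun i => r⁻¹ * y.2 i), Prod.ext ?_ (funext fun i => ?_)⟩
      · exact hz none (by simp)
      · by_cases hi : (i : ℕ) + 1 ∈ L
        · simp only [F, hi, if_true]
          exact hz (some i) (by simp [S, hi])
        · simp [F, hi, hr]
  -- Translation by the exponent μ of the message absorbs m into the uniform mask.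
  have hF' : (unif (ZMod P.q × (Fin n → ZMod P.q))).map (fun v => (μ + v.1, v.2)) = unif _ :=
    unif_map_equiv ((Equiv.addLeft μ).prodCongr (Equiv.refl _))
  rw [bind_unif_eq_of_map hF', bind_unif_eq_of_map hF]
  simp only [F, P.gpow_add]

/-- Once every coefficient carries noise, translating by r a_j shows that the vector is uniform and
independent of r. -/
theorem hybSampler_of_le (a : Fin t → ZMod P.q) {i : ℕ} (hi : t ≤ i) :
    hybSampler P a i = (unif (ZMod P.q)).bind fun r => (unif (Fin t → ZMod P.q)).bind fun u =>
      PMF.pure (r, u) := by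
  rw [hybSampler]
  congr 1
  funext r
  have h : (unif (Fin t → ZMod P.q)).map (fun u j => r * a j + u j) = unif _ :=
    unif_map_equiv (Equiv.addLeft fun j => r * a j)
  refine Eq.trans ?_ (bind_unif_eq_of_map h _).symm
  congr 1
  funext u
  congr 2
  funext j
  rw [if_pos (j.2.trans_le hi)]

open Classical in
/-- The challenge oracle that returns completely random answers. -/
def randomChallenger (P : GroupInst) (n t : ℕ) (L : List ℕ) : PMF (List (ansTy.val P)) :=
  if TEScheme.ValidIndices n t L then
    ((unif (ZMod P.q)).bind (randomAnswer P n)).bind fun y => PMF.pure [y]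
  else PMF.pure []

theorem ex_unif_eq {A : Type*} [Fintype A] [Nonempty A] (p : A → Prop) [DecidablePred p] {a : A}
    (hp : ∀ y, p y ↔ y = a) :
    ((unif A).ex fun y => if p y then 1 else 0) = (Fintype.card A : ℝ≥0∞)⁻¹ := by
  classical
  simp [ex_unif, hp]

/-- The two oracles agree for r ≠ 0. The event r = 0 has probability 1/q, and there the test
function is bounded by 1. -/
theorem ex_challenger_le {x : Fin n → ZMod P.q} (hx : GoodPoints x) (ht : 1 ≤ t)
    (a : Fin t → ZMod P.q) {i : ℕ} (hi : t ≤ i) (m : P.G × ℕ) (L : List ℕ)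
    (f : List (ansTy.val P) → ℝ≥0∞) (hf : ∀ y, f y ≤ 1) :
    (challenger t x (hybSampler P a i) m L).ex f ≤
      (randomChallenger P n t L).ex f + (P.q : ℝ≥0∞)⁻¹ := by
  classical
  rw [challenger, randomChallenger]
  by_cases hL : TEScheme.ValidIndices n t L
  · rw [if_pos hL, if_pos hL]
    have hL' : (if m.2 = 0 then L else []).length ≤ t - 1 := by
      split_ifs
      · exact hL.1.le
      · exact Nat.zero_le _
    have hc := ex_unif_eq (fun y : ZMod P.q => y = 0) (fun _ => Iff.rfl)
    rw [ZMod.card] at hc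
    rw [hybSampler_of_le a hi, PMF.bind_bind, PMF.bind_bind, PMF.bind_bind, ex_bind, ex_bind,
      ← hc, ← ex_add]
    refine ex_mono _ fun r => ?_
    by_cases hr : r = 0
    · simp only [hr, if_true]
      exact (ex_le_of_le _ fun y _ => hf y).trans le_add_self
    · simp only [hr, if_false, add_zero, PMF.bind_bind, PMF.pure_bind]
      rw [← answerOf_unif hx ht hL' m.1 hr, PMF.bind_bind]
  · rw [if_neg hL, if_neg hL]
    exact le_add_right le_rfl

/-- Union bound over n events x_i = 0 and at most n² events x_i = x_j with i ≠ j, each of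
probability 1/q. -/
theorem ex_not_goodPoints_le (P : GroupInst) (n : ℕ) [DecidablePred (GoodPoints (P := P) (n := n))] :
    ((unif (Fin n → ZMod P.q)).ex fun x => if GoodPoints x then 0 else 1) ≤
      ((n + n * n : ℕ) : ℝ≥0∞) * (P.q : ℝ≥0∞)⁻¹ := by
  classical
  have h1 : ∀ i : Fin n, ((unif (Fin n → ZMod P.q)).ex fun x => if x i = 0 then 1 else 0) =
      (P.q : ℝ≥0∞)⁻¹ := by
    intro i
    have : (unif (Fin n → ZMod P.q)).map (fun x => x i) = unif _ :=
      unif_map_eq_unif _ (fun _ _ => rfl) fun y => ⟨fun _ => y, rfl⟩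
    rw [← ex_map (f := fun y => if y = 0 then 1 else 0), this,
      ex_unif_eq (fun y : ZMod P.q => y = 0) (fun _ => Iff.rfl), ZMod.card]
  have h2 : ∀ i j : Fin n, i ≠ j →
      ((unif (Fin n → ZMod P.q)).ex fun x => if x i = x j then 1 else 0) =
      (P.q : ℝ≥0∞)⁻¹ := by
    intro i j hij
    have : (unif (Fin n → ZMod P.q)).map (fun x => x i - x j) = unif _ :=
      unif_map_eq_unif _ (fun x y => by simp; ring) fun y => ⟨Pi.single i y, by simp [hij.symm]⟩
    have h : (fun x : Fin n → ZMod P.q => (if x i = x j then 1 else 0 : ℝ≥0∞)) =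
        fun x => if x i - x j = 0 then 1 else 0 := by
      funext x
      simp only [sub_eq_zero]
    rw [h, ← ex_map (f := fun y => if y = 0 then 1 else 0), this,
      ex_unif_eq (fun y : ZMod P.q => y = 0) (fun _ => Iff.rfl), ZMod.card]
  calc _ ≤ (unif (Fin n → ZMod P.q)).ex fun x => (∑ i : Fin n, if x i = 0 then 1 else 0) +
        ∑ y ∈ (Finset.univ : Finset (Fin n × Fin n)).filter (fun y => y.1 ≠ y.2),
          if x y.1 = x y.2 then 1 else 0 := by
        refine ex_mono _ fun x => ?_
        by_cases hx : GoodPoints x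
        · simp [hx]
        · rw [if_neg hx]
          rw [GoodPoints, not_and_or] at hx
          rcases hx with hx | hx
          · simp only [Function.Injective, not_forall] at hx
            obtain ⟨i, j, hij, hne⟩ := hx
            refine le_trans ?_ le_add_self
            refine le_trans ?_ (Finset.single_le_sum (a := (i, j)) (fun _ _ => bot_le)
              (by simp [hne]))
            simp [hij]
          · push Not at hx
            obtain ⟨i, hi⟩ := hx
            refine le_trans ?_ le_self_add
            refine le_trans ?_ (Finset.single_le_sum (a := i) (fun _ _ => bot_le)
              (Finset.mem_univ _))
            simp [hi]
    _ ≤ (n : ℝ≥0∞) * (P.q : ℝ≥0∞)⁻¹ + ((n * n : ℕ) : ℝ≥0∞) * (P.q : ℝ≥0∞)⁻¹ := by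
        rw [ex_add, ex_finset_sum, ex_finset_sum, Finset.sum_congr rfl fun i _ => h1 i,
          Finset.sum_congr rfl fun y hy => h2 y.1 y.2 (Finset.mem_filter.1 hy).2]
        simp only [Finset.sum_const, nsmul_eq_mul, Finset.card_univ, Fintype.card_fin]
        gcongr
        exact (Finset.card_filter_le _ _).trans (by simp)
    _ = _ := by push_cast; ring

/-! ### Key generation from a Diffie–Hellman instance -/

theorem coeffs_zero (a w : Fin t → ZMod P.q) (i : ℕ) :
    (coeffs a w i).map (fun y => (y.1, ((1 : P.G), 0))) = coeffs a 0 0 := by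
  simp [coeffs, List.map_ofFn, Function.comp_def, P.gpow_zero]

/-- Input of the combiner. -/
def combinerInput (k : ℕ) (a : Fin t → ZMod P.q) (x : Fin n → ZMod P.q) : inTy.val P :=
  ((k, (n, t)), publicKey P a x)

theorem uniformBelow_eq_map_fin (t : ℕ) [NeZero t] :
    uniformBelow t = (unif (Fin t)).map Fin.val := by
  cases t with
  | zero => exact absurd rfl (NeZero.ne 0)
  | succ n => rfl

/-- The instance is planted at a random position i. The element g^α becomes the commitment to a_i,
and g^γ takes the place of g^{βα}. Both contexts and the public key share the same coefficients and
points. -/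
theorem eval_setup (hq : P.q ≤ 2 ^ N) (hn : n ≤ N) (htN : t ≤ N) [NeZero t] (k : ℕ)
    (α β γ : ZMod P.q) :
    Tame.eval P N Tame.setup (n, (t, ddhInput P k (P.gpow α) (P.gpow β) (P.gpow γ))) =
      (unif (Fin n → ZMod P.q)).bind fun x => (unif (Fin t)).bind fun i =>
      (unif (Fin t → ZMod P.q)).bind fun a => (uniformBelow 2).bind fun b =>
      PMF.pure (b, (((P.q, (P.g, (P.gpow 0, (coeffs (Function.update a i α) 0 0, points x)))),
        (P.q, (P.g, (P.gpow β, (coeffs (Function.update a i α)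
          (Function.update (fun j => β * a j) i γ) i, points x))))),
        (t, combinerInput k (Function.update a i α) x))) := by
  rw [ddhInput, Tame.eval_setup hn htN, mapP_ofFn _ _
    (fun (i : Fin n) (x : ZMod P.q) => ((((i : ℕ) + 1, x.val) : ℕ × ℕ) : pointTy.val P)),
    PMF.bind_map]
  · congr 1
    funext x
    rw [Function.comp_apply, uniformBelow_eq_map_fin t, PMF.bind_map]
    congr 1
    funext i
    rw [Function.comp_apply, mapP_ofFn _ _ (fun (j : Fin t) (a : ZMod P.q) =>
      ((P.gpow (if j = i then α else a),
        (P.gpow (if j = i then γ else β * a), if (j : ℕ) < i then P.q else 0)) : coeffTy.val P)),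
      PMF.bind_map]
    · congr 1
      funext a
      have hc : (List.ofFn fun j : Fin t => ((P.gpow (if j = i then α else a j),
          (P.gpow (if j = i then γ else β * a j), if (j : ℕ) < i then P.q else 0)) :
            coeffTy.val P)) = coeffs (Function.update a i α)
              (Function.update (fun j => β * a j) i γ) i := by
        simp only [coeffs, Function.update_apply]
      have hh : horner (G := P.G) ((coeffs (Function.update a i α)
          (Function.update (fun j => β * a j) i γ) i).map Prod.fst) 0 =
          P.gpow (share (Function.update a i α) 0) := by
        rw [coeffs, List.map_ofFn]
        refine (horner_ofFn P _ 0).trans ?_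
        rw [Nat.cast_zero]
      have hp : ((List.ofFn fun i : Fin n => ((((i : ℕ) + 1, (x i).val) : ℕ × ℕ))).map Prod.snd) =
          List.ofFn fun i : Fin n => (x i).val := by
        rw [List.map_ofFn]
        rfl
      rw [Function.comp_apply, hc, hh, coeffs_zero, hp, P.gpow_zero]
      rfl
    · intro j
      rw [Tame.eval_coeff, bind_uniformBelow_q, map_eq_bind_pure]
      congr 1
      funext a
      rw [Nat.add_sub_cancel, val_mod_two_pow hq, P.gpow_pow_val, P.g_pow_val]
      congr 1
      by_cases hj : j = i
      · simp [hj]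
      · simp [hj, Fin.val_inj]
  · intro i
    simp only [Tame.point, Tame.eval, PMF.pure_bind, bind_uniformBelow_q]
    rfl

end ElGamal
end

noncomputable section

open scoped ENNReal

/-! ### The distinguisher -/

/-- Output distribution of a program without oracle. -/
abbrev PlainProg.out (P : GroupInst) {a b : Ty} (p : PlainProg a b) (x : a.val P) :
    PMF (b.val P) :=
  Prog.out (Q := .unit) (R := .unit) P (fun _ => PMF.pure ()) p x

/-- Runs of a program without oracle. -/
abbrev PlainProg.Steps (P : GroupInst) {a b : Ty} (p : PlainProg a b) (x : a.val P) (y : b.val P)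
    (c : ℕ) : Prop :=
  Prog.Steps (Q := .unit) (R := .unit) P (fun _ => PMF.pure ()) p x y c

namespace Tame

variable {Q R a b c e s : Ty}

/-- Runs `p` on the input that `i` computes, and answers its oracle calls by the program `o` with
the parameter that `f` computes. -/
def simulate (f : Tame s e) (i : Tame s a) (o : Tame (.prod e Q) R) (p : Prog Q R a b) :
    PlainProg (.prod .nat s) b :=
  .comp (.pair (.pair .fst f.compile) i.compile)
    (Prog.sim (.comp (.pair (.comp .fst .fst) (.pair (.comp .fst .snd) .snd)) o.compile) p)

variable {P : GroupInst} {N : ℕ}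

theorem out_simulate {f : Tame s e} {i : Tame s a} {o : Tame (.prod e Q) R} {p : Prog Q R a b}
    {x : s.val P} {ε : e.val P} {w : a.val P} (hf : f.eval P N x = PMF.pure ε)
    (hi : i.eval P N x = PMF.pure w) :
    Prog.out (Q := .unit) (R := .unit) P (fun _ => PMF.pure ()) (simulate f i o p) (N, x) =
      p.out P (fun y => o.eval P N (ε, y)) w := by
  rw [simulate, Prog.out_comp, Prog.out_pair, Prog.out_pair, Prog.out_fst,
    out_compile, out_compile, hf, hi]
  simp only [PMF.pure_bind]
  rw [Prog.out_sim]
  congr 1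
  funext y
  simp only [Prog.out_comp, Prog.out_pair, Prog.out_fst, Prog.out_snd, PMF.pure_bind]
  exact o.out_compile P N _

/-- The setting of `steps_compile`. -/
structure SizeBound (P : GroupInst) (N M : ℕ) : Prop where
  le : N ≤ M
  two_le : 2 ≤ M
  encLe : P.EncLe M

theorem steps_compile' (p : Tame a b) : ∃ T : Polynomial ℕ, ∀ (P : GroupInst)
    (N M : ℕ), SizeBound P N M → ∀ x y s, Ty.Bits P M a x →
      PlainProg.Steps P p.compile (N, x) y s →
        y ∈ (p.eval P N x).support ∧ s ≤ T.eval M ∧ Ty.Bits P M b y := by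
  obtain ⟨T, hT⟩ := p.steps_compile
  refine ⟨T, fun P N M h x y s hx hs => ⟨?_, hT P N M h.1 h.2 h.3 x y s hx hs⟩⟩
  rw [← out_compile]
  exact Prog.mem_support_out_iff.2 ⟨s, hs⟩

theorem steps_simulate (f : Tame s e) (i : Tame s a) (o : Tame (.prod e Q) R) (p : Prog Q R a b) :
    ∃ T : Polynomial ℕ, ∀ (P : GroupInst) (N M : ℕ), SizeBound P N M → ∀ x ε w y c',
      Ty.Bits P M s x → f.eval P N x = PMF.pure ε → i.eval P N x = PMF.pure w →
      PlainProg.Steps P (simulate f i o p) (N, x) y c' →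
        ∃ c, p.Steps P (fun y => o.eval P N (ε, y)) w y c ∧
          (c ≤ M → c' ≤ T.eval M ∧ Ty.Bits P M b y) := by
  obtain ⟨Tf, hTf⟩ := f.steps_compile'
  obtain ⟨Ti, hTi⟩ := i.steps_compile'
  obtain ⟨To, hTo⟩ := o.steps_compile'
  refine ⟨Tf + Ti + (To + 40) * Polynomial.X + 10, fun P N M hM x ε w y c' hx hf hi h => ?_⟩
  rw [simulate, PlainProg.Steps] at h
  simp only [Prog.steps_comp_iff, Prog.steps_pair_iff, Prog.steps_fst_iff] at h
  obtain ⟨⟨⟨N', _⟩, _⟩, _, c₂, ⟨_, ci, ⟨_, cf, ⟨hN', rfl⟩, hsf, rfl⟩, hsi, rfl⟩, h, rfl⟩ := h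
  change N' = N at hN'
  subst N'
  obtain ⟨hf', lf, bf⟩ := hTf P N M hM _ _ _ hx hsf
  obtain ⟨hi', li, bi⟩ := hTi P N M hM _ _ _ hx hsi
  rw [hf, PMF.mem_support_pure_iff] at hf'
  rw [hi, PMF.mem_support_pure_iff] at hi'
  subst hf'
  subst hi'
  have hN : Nat.size N ≤ M := (Nat.size_le.2 Nat.lt_two_pow_self).trans hM.le
  -- The factor K covers one run of `o` plus the rearrangement of its arguments, and is at least the
  -- 30 that `sim_steps` requires.
  obtain ⟨c, hc, hk⟩ := Prog.sim_steps (M := M) (K := To.eval M + 40) (by omega) (by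
    intro y hy r c ho
    simp only [Prog.steps_comp_iff, Prog.steps_pair_iff, Prog.steps_fst_iff,
      Prog.steps_snd_iff] at ho
    obtain ⟨⟨N', ε', y'⟩, _, co, ⟨_, _, ⟨_, _, _, ⟨h₁, rfl⟩, ⟨h₂, rfl⟩, rfl⟩, ⟨_, _, ⟨_, _, _,
      ⟨h₃, rfl⟩, ⟨h₄, rfl⟩, rfl⟩, ⟨h₅, rfl⟩, rfl⟩, rfl⟩, ho', rfl⟩ := ho
    subst h₁ h₃
    change N' = N at h₂
    change ε' = _ at h₄
    change y' = _ at h₅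
    subst h₂ h₄ h₅
    obtain ⟨-, l, b⟩ := hTo P _ M hM (_, y') _ _ ⟨bf, hy⟩ ho'
    exact ⟨by omega, b⟩) h
  refine ⟨c, ?_, fun hcM => ?_⟩
  · simp only [Prog.out_comp, Prog.out_pair, Prog.out_fst, Prog.out_snd, PMF.pure_bind] at hc
    rwa [funext fun y => o.out_compile P N (_, y)] at hc
  · obtain ⟨l, b⟩ := hk hcM bi
    refine ⟨?_, b⟩
    have := Nat.mul_le_mul_left (To.eval M + 40) hcM
    simp only [Polynomial.eval_add, Polynomial.eval_mul, Polynomial.eval_X,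
      Polynomial.eval_ofNat]
    omega

end Tame

namespace ElGamal

open PMF

/-- A combiner together with the rule that determines from the bit and from the challenge data
the message to be encrypted and whether all decryption shares are random. -/
structure Attack where
  σ : Ty
  τ : Ty
  X : Ty
  phase1 : Prog .grp ansTy inTy (.prod σ X)
  phase2 : Prog (.list .nat) (.list ansTy) σ τ
  phase3 : Prog .grp ansTy τ .nat
  choose : Tame (.prod .nat X) (.prod .grp .nat)
  choice : (P : GroupInst) → ℕ → X.val P → P.G × ℕ
  eval_choose : ∀ P N x, choose.eval P N x = PMF.pure (choice P x.1 x.2)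

variable {P : GroupInst} {n t N : ℕ}

/-- Success of an attack, in terms of exponents that are sampled from `Ψ` for challenges. -/
def Attack.play (A : Attack) (k : ℕ) (a : Fin t → ZMod P.q) (x : Fin n → ZMod P.q) (b : ℕ)
    (Ψ : PMF (ZMod P.q × (Fin t → ZMod P.q))) : PMF Bool :=
  (A.phase1.out P (Q := .grp) (R := ansTy) (keyOwner a x) (combinerInput k a x)).bind fun y =>
    (A.phase2.out P (Q := .list .nat) (R := .list ansTy) (challenger t x Ψ (A.choice P b y.2))
        y.1).bind fun z =>
      (A.phase3.out P (Q := .grp) (R := ansTy) (keyOwner a x) z).bind fun o =>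
        PMF.pure ((o != 0) == (b != 0))

/-- The first context that `setup` provides. -/
def ownerCtx : Tame setupTy ctxTy := .comp .snd (.comp .fst .fst)

/-- The second context that `setup` provides, with the data of the challenge. -/
def challengeCtx (A : Attack) :
    Tame (.prod setupTy (.prod A.σ A.X)) (.prod ctxTy (.prod .nat (.prod .grp .nat))) :=
  .pair (.comp .fst (.comp .snd (.comp .fst .snd)))
    (.pair (.comp .fst (.comp .snd (.comp .snd .fst)))
      (.comp (.pair (.comp .fst .fst) (.comp .snd .snd)) A.choose))

/-- Compares two numbers, as bits. -/
def sameBit : PlainProg (.prod .nat .nat) .nat :=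
  .comp (.pair .fst (.pair .snd .id))
    (.ite (.ite (.lit 1) (.lit 0)) (.ite (.lit 0) (.lit 1)))

theorem out_sameBit (x : (Ty.prod .nat .nat).val P) : PlainProg.out P sameBit x =
    PMF.pure (if ((x.1 : ℕ) != 0) == ((x.2 : ℕ) != 0) then 1 else 0) := by
  have key : ∀ o b : ℕ, (if o = 0 then (if b = 0 then PMF.pure 1 else PMF.pure 0) else
      (if b = 0 then PMF.pure 0 else PMF.pure 1) : PMF ℕ) =
        PMF.pure (if (o != 0) == (b != 0) then 1 else 0) := by
    intro o b
    cases o <;> cases b <;> simp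
  simp only [sameBit, PlainProg.out, Prog.out_comp, Prog.out_pair, Prog.out_fst, Prog.out_snd,
    Prog.out_id, PMF.pure_bind, Prog.out_ite, Prog.out_lit]
  exact key x.1 x.2

theorem steps_sameBit {x : (Ty.prod .nat .nat).val P} {y c : ℕ}
    (h : PlainProg.Steps P sameBit x y c) : c ≤ 20 := by
  simp only [sameBit, PlainProg.Steps, Prog.steps_comp_iff, Prog.steps_pair_iff,
    Prog.steps_fst_iff, Prog.steps_snd_iff, Prog.steps_id_iff, Prog.steps_ite_iff,
    Prog.steps_lit_iff] at h
  obtain ⟨_, _, c₂, ⟨_, _, ⟨-, rfl⟩, ⟨_, _, ⟨-, rfl⟩, ⟨-, rfl⟩, rfl⟩, rfl⟩, ⟨c₃, h, rfl⟩, rfl⟩ := h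
  split_ifs at h <;> obtain ⟨c₄, ⟨-, rfl⟩, rfl⟩ := h <;> simp

/-- The distinguisher, on `(N, (n, (t, instance)))`. -/
def distinguish (A : Attack) : PlainProg (.prod .nat (.prod .nat (.prod .nat ddhTy))) .nat :=
  .comp (.pair .fst Tame.setup.compile) <|
  .comp (.pair .fst (.pair .snd (Tame.simulate ownerCtx (.comp .snd (.comp .snd .snd))
    Tame.oracleS A.phase1))) <|
  .comp (.pair .fst (.pair (.comp .snd .fst) (Tame.simulate (challengeCtx A) (.comp .snd .fst)
    Tame.challenge A.phase2))) <|
  .comp (.pair (Tame.simulate (.comp .fst ownerCtx) .snd Tame.oracleS A.phase3)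
    (.comp .snd (.comp .fst .fst))) sameBit

/-- Phases 1 and 3 are answered from the context with Y = 1, phase 2 from the one with Y = g^β. The
output 1 means that the guess agrees with the bit drawn in `setup`. -/
theorem out_distinguish (A : Attack) (hq : P.q ≤ 2 ^ N) (hn : n ≤ N) (ht : t ≤ N) [NeZero t]
    (k : ℕ) (α β γ : ZMod P.q) :
    PlainProg.out P (distinguish A)
        (N, (n, (t, ddhInput P k (P.gpow α) (P.gpow β) (P.gpow γ)))) =
      (unif (Fin n → ZMod P.q)).bind fun x => (unif (Fin t)).bind fun i =>
      (unif (Fin t → ZMod P.q)).bind fun a => (uniformBelow 2).bind fun b =>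
        (A.play k (Function.update a i α) x b (simSampler P β (Function.update a i α)
          (Function.update (fun j => β * a j) i γ) i)).bind fun o =>
            PMF.pure (if o then 1 else 0) := by
  have ht1 : 1 ≤ t := Nat.one_le_iff_ne_zero.2 (NeZero.ne t)
  rw [distinguish, PlainProg.out, Prog.out_comp, Prog.out_pair, Prog.out_fst, PMF.pure_bind,
    Tame.out_compile, eval_setup hq hn ht]
  simp only [PMF.bind_bind, PMF.pure_bind]
  congr 1; funext x; congr 1; funext i; congr 1; funext a; congr 1; funext b
  simp only [Prog.out_comp, Prog.out_pair, Prog.out_fst, Prog.out_snd, PMF.pure_bind,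
    PMF.bind_bind]
  have hS : ∀ m, _ = _ := fun m => eval_oracleS hq hn ht (Function.update a i α) x m
  rw [Tame.out_simulate (by simp only [ownerCtx, Tame.eval, PMF.pure_bind]; rfl)
    (by simp only [Tame.eval, PMF.pure_bind]; rfl), Attack.play, PMF.bind_bind]
  refine congrArg₂ PMF.bind (congrArg (fun O => Prog.out (Q := .grp) (R := ansTy) P O
    A.phase1 _) (funext hS)) (funext fun y => ?_)
  rw [Tame.out_simulate (by
      simp only [challengeCtx, Tame.eval, PMF.pure_bind, A.eval_choose]; rfl)
    (by simp only [Tame.eval, PMF.pure_bind]; rfl), PMF.bind_bind]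
  have hc : ∀ L : List ℕ, _ = _ := fun L => eval_challenge hq ht1 hn ht β (Function.update a i α)
    (Function.update (fun j => β * a j) i γ) i x (A.choice P b y.2) L
  have hc' := funext hc
  refine congrArg₂ PMF.bind (congrArg (fun O => Prog.out (Q := .list .nat) (R := .list ansTy) P O
    A.phase2 y.1) hc') (funext fun z => ?_)
  rw [Tame.out_simulate (by simp only [ownerCtx, Tame.eval, PMF.pure_bind]; rfl)
    (by simp only [Tame.eval]; rfl), PMF.bind_bind]
  refine congrArg₂ PMF.bind (congrArg (fun O => Prog.out (Q := .grp) (R := ansTy) P O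
    A.phase3 _) (funext hS)) (funext fun o => ?_)
  rw [PMF.pure_bind]
  exact out_sameBit _

/-- The total running time of an attack is at most `T`, whatever answers of the right length it
gets. -/
def Attack.TimeLe (A : Attack) (P : GroupInst) (k n t T : ℕ) : Prop :=
  ∀ (a : Fin t → ZMod P.q) (x : Fin n → ZMod P.q) (O₁ O₃ : P.G → PMF (ansTy.val P))
    (O₂ : A.X.val P → List ℕ → PMF (List (ansTy.val P))),
    (∀ m, ∀ r ∈ (O₁ m).support, r.2.length = n) →
    (∀ m L, ∀ l ∈ (O₂ m L).support, l.length ≤ 1 ∧ ∀ r ∈ l, r.2.length = n) →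
    (∀ m, ∀ r ∈ (O₃ m).support, r.2.length = n) →
    ∀ y z o c₁ c₂ c₃, A.phase1.Steps P (Q := .grp) (R := ansTy) O₁ (combinerInput k a x) y c₁ →
      A.phase2.Steps P (Q := .list .nat) (R := .list ansTy) (O₂ y.2) y.1 z c₂ →
      A.phase3.Steps P (Q := .grp) (R := ansTy) O₃ z o c₃ → c₁ + c₂ + c₃ ≤ T

theorem length_answerOf {x : Fin n → ZMod P.q} {m : P.G} {L : List ℕ}
    {w : ZMod P.q × (Fin t → ZMod P.q)} {r : ansTy.val P} (h : r ∈ (answerOf x m L w).support) :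
    r.2.length = n := by
  simp only [answerOf, PMF.mem_support_bind_iff, PMF.mem_support_pure_iff] at h
  obtain ⟨_, _, rfl⟩ := h
  simp

theorem length_keyOwner {a : Fin t → ZMod P.q} {x : Fin n → ZMod P.q} {m : P.G}
    {r : ansTy.val P} (h : r ∈ (keyOwner a x m).support) : r.2.length = n := by
  rw [keyOwner, PMF.mem_support_bind_iff] at h
  obtain ⟨_, _, h⟩ := h
  exact length_answerOf h

theorem length_challenger {x : Fin n → ZMod P.q} {Ψ : PMF (ZMod P.q × (Fin t → ZMod P.q))}
    {m : P.G × ℕ} {L : List ℕ} {l : List (ansTy.val P)}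
    (h : l ∈ (challenger t x Ψ m L).support) : l.length ≤ 1 ∧ ∀ r ∈ l, r.2.length = n := by
  classical
  rw [challenger] at h
  by_cases hL : TEScheme.ValidIndices n t L
  · rw [if_pos hL] at h
    simp only [PMF.mem_support_bind_iff, PMF.mem_support_pure_iff] at h
    obtain ⟨r, ⟨_, _, h⟩, rfl⟩ := h
    refine ⟨le_rfl, fun r' hr' => ?_⟩
    rw [List.mem_singleton.1 hr']
    exact length_answerOf h
  · rw [if_neg hL, PMF.mem_support_pure_iff] at h
    simp [h]

/-- Lets a partial run be completed: `TimeLe` bounds only the total over all three phases. -/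
theorem exists_steps {Q R a b : Ty} (O : Q.val P → PMF (R.val P)) (p : Prog Q R a b)
    (x : a.val P) : ∃ y c, p.Steps P O x y c := by
  obtain ⟨⟨y, c⟩, h⟩ := (Prog.run P O p x).support_nonempty
  exact ⟨y, c, h⟩

theorem steps_pair_fst_comp {a b c : Ty} {p : PlainProg (.prod .nat a) b}
    {r : PlainProg (.prod .nat b) c} {x : (Ty.prod .nat a).val P} {o : c.val P} {s : ℕ}
    (h : PlainProg.Steps P (.comp (.pair .fst p) r) x o s) : ∃ y s₁ s₂,
      PlainProg.Steps P p x y s₁ ∧ PlainProg.Steps P r (x.1, y) o s₂ ∧ s = s₁ + s₂ + 3 := by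
  rw [PlainProg.Steps, Prog.steps_comp_iff] at h
  obtain ⟨⟨_, y⟩, _, s₂, h, h', rfl⟩ := h
  obtain ⟨_, s₁, hf, h₁, rfl⟩ := Prog.steps_pair_iff.1 h
  obtain ⟨rfl, rfl⟩ := Prog.steps_fst_iff.1 hf
  exact ⟨y, s₁, s₂, h₁, h', by omega⟩

/-- The simulated oracles give answers with n shares, so `TimeLe` applies to the simulated attack.
Its number of steps is at most M, and each phase is simulated in time polynomial in M. -/
theorem steps_distinguish (A : Attack) : ∃ T : Polynomial ℕ, ∀ (P : GroupInst) (N M k n t : ℕ),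
    Tame.SizeBound P N M → P.q ≤ 2 ^ N → n ≤ N → t ≤ N → 1 ≤ t → Nat.size k ≤ M →
    Nat.size P.desc ≤ M → Nat.size P.q ≤ M → A.TimeLe P k n t M →
    ∀ α β γ o c, PlainProg.Steps P (distinguish A)
      (N, (n, (t, ddhInput P k (P.gpow α) (P.gpow β) (P.gpow γ)))) o c → c ≤ T.eval M := by
  obtain ⟨T₀, h₀⟩ := Tame.setup.steps_compile'
  obtain ⟨T₁, h₁⟩ := Tame.steps_simulate ownerCtx (.comp .snd (.comp .snd .snd)) Tame.oracleS
    A.phase1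
  obtain ⟨T₂, h₂⟩ := Tame.steps_simulate (challengeCtx A) (.comp .snd .fst) Tame.challenge A.phase2
  obtain ⟨T₃, h₃⟩ := Tame.steps_simulate (s := .prod setupTy A.τ) (.comp .fst ownerCtx) .snd
    Tame.oracleS A.phase3
  refine ⟨T₀ + T₁ + T₂ + T₃ + 100, fun P N M k n t hM hq hn ht ht1 hk hd hqM hA α β γ o c h => ?_⟩
  have : NeZero t := ⟨by omega⟩
  have hle : ∀ {m : ℕ}, m ≤ N → Nat.size m ≤ M := fun h =>
    (Nat.size_le.2 Nat.lt_two_pow_self).trans (h.trans hM.le)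
  obtain ⟨v, s₀, d₁, hs₀, h', rfl⟩ := steps_pair_fst_comp h
  obtain ⟨hv, l₀, b₀⟩ := h₀ P N M hM
    (n, (t, ddhInput P k (P.gpow α) (P.gpow β) (P.gpow γ))) _ _
    ⟨hle hn, hle ht, hk, ⟨hd, hqM, trivial⟩, trivial, trivial, trivial⟩ hs₀
  rw [eval_setup hq hn ht] at hv
  simp only [PMF.mem_support_bind_iff, PMF.mem_support_pure_iff] at hv
  obtain ⟨x, -, i, -, a, -, b, -, hv⟩ := hv
  have hS : ∀ m, _ = _ := fun m => eval_oracleS hq hn ht (Function.update a i α) x m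
  obtain ⟨vy, s₁, d₂, hs₁, h'', rfl⟩ := steps_pair_fst_comp h'
  obtain ⟨v', y⟩ := vy
  obtain ⟨_, s₁, hs, hs₁', rfl⟩ := Prog.steps_pair_iff.1 hs₁
  obtain ⟨hv', rfl⟩ := Prog.steps_snd_iff.1 hs
  change v' = v at hv'
  subst hv'
  obtain ⟨vz, s₂, d₃, hs₂, h₃', rfl⟩ := steps_pair_fst_comp h''
  obtain ⟨v'', z⟩ := vz
  obtain ⟨_, s₂, hs', hs₂', rfl⟩ := Prog.steps_pair_iff.1 hs₂
  obtain ⟨_, _, _, hsa, hsb, rfl⟩ := Prog.steps_comp_iff.1 hs'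
  obtain ⟨rfl, rfl⟩ := Prog.steps_snd_iff.1 hsa
  obtain ⟨hv'', rfl⟩ := Prog.steps_fst_iff.1 hsb
  change v'' = v' at hv''
  subst hv''
  obtain ⟨ob, _, s₄, hs₃, h₄, rfl⟩ := Prog.steps_comp_iff.1 h₃'
  obtain ⟨o', b'⟩ := ob
  obtain ⟨s₃, _, hs₃', hs'', rfl⟩ := Prog.steps_pair_iff.1 hs₃
  obtain ⟨_, _, _, hsc, hsd, rfl⟩ := Prog.steps_comp_iff.1 hs''
  obtain ⟨-, rfl⟩ := Prog.steps_snd_iff.1 hsc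
  obtain ⟨_, _, _, hse, hsf, rfl⟩ := Prog.steps_comp_iff.1 hsd
  obtain ⟨-, rfl⟩ := Prog.steps_fst_iff.1 hse
  obtain ⟨-, rfl⟩ := Prog.steps_fst_iff.1 hsf
  subst hv
  obtain ⟨c₁, r₁, k₁⟩ := h₁ P N M hM _ _ _ _ _ b₀
    (by simp only [ownerCtx, Tame.eval, PMF.pure_bind]; rfl)
    (by simp only [Tame.eval, PMF.pure_bind]; rfl) hs₁'
  rw [show _ = keyOwner (Function.update a i α) x from funext hS] at r₁
  have hC : ∀ L : List ℕ, _ = _ := fun L => eval_challenge hq ht1 hn ht β (Function.update a i α)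
    (Function.update (fun j => β * a j) i γ) i x (A.choice P b y.2) L
  have hT := fun {z o c₂ c₃} r₂ r₃ => hA (Function.update a i α) x
    (keyOwner (Function.update a i α) x) (keyOwner (Function.update a i α) x)
    (fun y => challenger t x (simSampler P β (Function.update a i α)
        (Function.update (fun j => β * a j) i γ) i) (A.choice P b y))
    (fun _ _ => length_keyOwner) (fun _ _ _ => length_challenger) (fun _ _ => length_keyOwner)
    y z o c₁ c₂ c₃ r₁ r₂ r₃
  -- The bound on the first phase alone comes from completing it by arbitrary later phases.
  obtain ⟨l₁, y₀⟩ := k₁ (by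
    obtain ⟨z, c₂, r₂⟩ := exists_steps (P := P) (Q := .list .nat) (R := .list ansTy) _ A.phase2 y.1
    obtain ⟨o, c₃, r₃⟩ := exists_steps (P := P) (Q := .grp) (R := ansTy) _ A.phase3 z
    have := hT r₂ r₃
    omega)
  obtain ⟨c₂, r₂, k₂⟩ := h₂ P N M hM _ _ _ _ _ ⟨b₀, y₀⟩
    (by simp only [challengeCtx, Tame.eval, PMF.pure_bind, A.eval_choose]; rfl)
    (by simp only [Tame.eval, PMF.pure_bind]; rfl) hs₂'
  rw [show _ = challenger t x (simSampler P β (Function.update a i α)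
        (Function.update (fun j => β * a j) i γ) i) (A.choice P b y.2) from funext hC] at r₂
  obtain ⟨l₂, z₀⟩ := k₂ (by
    obtain ⟨o, c₃, r₃⟩ := exists_steps (P := P) (Q := .grp) (R := ansTy) _ A.phase3 z
    have := hT r₂ r₃
    omega)
  obtain ⟨c₃, r₃, k₃⟩ := h₃ P N M hM _ _ _ _ _ ⟨b₀, z₀⟩
    (by simp only [ownerCtx, Tame.eval, PMF.pure_bind]; rfl)
    (by simp only [Tame.eval]; rfl) hs₃'
  rw [show _ = keyOwner (Function.update a i α) x from funext hS] at r₃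
  obtain ⟨l₃, -⟩ := k₃ (by
    have := hT r₂ r₃
    omega)
  have := steps_sameBit h₄
  simp only [Polynomial.eval_add, Polynomial.eval_ofNat]
  omega

end ElGamal
end

noncomputable section

open scoped ENNReal

/-! ### The hybrid argument -/

namespace ElGamal

open PMF

variable {P : GroupInst} {n t : ℕ}

/-- The game in which the first `i` coefficients in the challenges are random. -/
def Attack.game (A : Attack) (k n t i : ℕ) (P : GroupInst) : PMF Bool :=
  (unif (Fin t → ZMod P.q)).bind fun a => (unif (Fin n → ZMod P.q)).bind fun x =>
    (uniformBelow 2).bind fun b => A.play k a x b (hybSampler P a i)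

/-- The game that the distinguisher plays. -/
def Attack.ddhGame (A : Attack) (k n t : ℕ) [NeZero t] (α β γ : ZMod P.q) : PMF Bool :=
  (unif (Fin n → ZMod P.q)).bind fun x => (unif (Fin t)).bind fun i =>
    (unif (Fin t → ZMod P.q)).bind fun a => (uniformBelow 2).bind fun b =>
      A.play k (Function.update a i α) x b (simSampler P β (Function.update a i α)
        (Function.update (fun j => β * a j) i γ) i)

/-- Replacing one coordinate of a uniform vector by an independent uniform value leaves it uniform.
This is why planting the unknown α as a_i goes unnoticed. -/
theorem ex_update (i : Fin t) (f : (Fin t → ZMod P.q) → ℝ≥0∞) :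
    ((unif (ZMod P.q)).ex fun α => (unif (Fin t → ZMod P.q)).ex fun a =>
      f (Function.update a i α)) = (unif (Fin t → ZMod P.q)).ex f := by
  have h : (unif (ZMod P.q × (Fin t → ZMod P.q))).map (fun y => Function.update y.2 i y.1) =
      unif _ := by
    refine unif_map_eq_unif _ (fun y z => ?_) fun y => ⟨(y i, y), Function.update_eq_self i y⟩
    exact Function.update_add y.2 z.2 i y.1 z.1
  have h' := congrArg (fun p => ex p f) h
  simp only [ex_map] at h'
  rw [← h', unif_prod, ex_bind]
  simp only [ex_map]

theorem ex_game (A : Attack) (k i : ℕ) (F : Bool → ℝ≥0∞) :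
    (A.game k n t i P).ex F = (unif (Fin n → ZMod P.q)).ex fun x =>
      (unif (Fin t → ZMod P.q)).ex fun a => (uniformBelow 2).ex fun b =>
        (A.play k a x b (hybSampler P a i)).ex F := by
  simp only [Attack.game, ex_bind]
  rw [ex_comm]

/-- On real triples, position i gives hybrid i, so the distinguisher plays a uniformly chosen hybrid
among 0, …, t - 1. -/
theorem ex_ddhGame_mul (A : Attack) (k : ℕ) [NeZero t] (β : ZMod P.q) (F : Bool → ℝ≥0∞) :
    ((unif (ZMod P.q)).ex fun α => (A.ddhGame k n t α β (β * α)).ex F) =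
      (unif (Fin t)).ex fun i => (A.game k n t i P).ex F := by
  simp only [ex_game]
  rw [ex_comm (unif (Fin t))]
  simp only [Attack.ddhGame, ex_bind]
  rw [ex_comm]
  congr 1; funext x
  rw [ex_comm]
  congr 1; funext i
  rw [← ex_update i]
  congr 1; funext α
  congr 1; funext a
  have h : Function.update (fun j => β * a j) i (β * α) =
      fun j => β * Function.update a i α j := by
    funext j
    by_cases hj : j = i
    · subst hj; simp
    · simp [hj]
  rw [h, simSampler_mul]

/-- On random triples, position i gives hybrid i + 1 except when γ = βα, an event of probability 1/q
that is charged in full. -/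
theorem ex_ddhGame_le (A : Attack) (k : ℕ) [NeZero t] (F : Bool → ℝ≥0∞) (hF : ∀ o, F o ≤ 1) :
    ((unif (ZMod P.q)).ex fun α => (unif (ZMod P.q)).ex fun β => (unif (ZMod P.q)).ex fun γ =>
      (A.ddhGame k n t α β γ).ex F) ≤
      ((unif (Fin t)).ex fun i => (A.game k n t (i + 1) P).ex F) + (P.q : ℝ≥0∞)⁻¹ := by
  classical
  have key : ((unif (ZMod P.q)).ex fun α => (unif (Fin n → ZMod P.q)).ex fun x =>
      (unif (Fin t)).ex fun i => (unif (Fin t → ZMod P.q)).ex fun a => (uniformBelow 2).ex fun b =>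
        (A.play k (Function.update a i α) x b
          (hybSampler P (Function.update a i α) (i + 1))).ex F) =
      (unif (Fin t)).ex fun i => (A.game k n t (i + 1) P).ex F := by
    simp only [ex_game]
    rw [ex_comm (unif (Fin t)), ex_comm]
    congr 1; funext x
    rw [ex_comm]
    congr 1; funext i
    rw [← ex_update i]
  rw [← key, ← ex_const (unif (ZMod P.q)) (P.q : ℝ≥0∞)⁻¹, ← ex_add]
  refine ex_mono _ fun α => ex_le_of_le _ fun β _ => ?_
  have hc := ex_unif_eq (fun γ : ZMod P.q => γ = β * α) (fun _ => Iff.rfl)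
  rw [ZMod.card] at hc
  rw [← hc]
  refine le_of_le_of_eq (ex_mono _ (g := fun γ => _ + if γ = β * α then 1 else 0) fun γ => ?_)
    ((ex_add _ _ _).trans (congrArg (· + _) (ex_const _ _)))
  by_cases h : γ = β * α
  · rw [if_pos h]
    exact (ex_le_of_le _ fun o _ => hF o).trans le_add_self
  · simp only [Attack.ddhGame, ex_bind, simSampler_update α β γ h]
    exact le_self_add

theorem ex_play (A : Attack) (k : ℕ) (a : Fin t → ZMod P.q) (x : Fin n → ZMod P.q) (b : ℕ)
    (Ψ : PMF (ZMod P.q × (Fin t → ZMod P.q))) (F : Bool → ℝ≥0∞) :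
    (A.play k a x b Ψ).ex F =
      (Prog.run (Q := .grp) (R := ansTy) P (keyOwner a x) A.phase1 (combinerInput k a x)).ex
        fun y => (Prog.run (Q := .list .nat) (R := .list ansTy) P
          (challenger t x Ψ (A.choice P b y.1.2)) A.phase2 y.1.1).ex fun z =>
            (Prog.run (Q := .grp) (R := ansTy) P (keyOwner a x) A.phase3 z.1).ex fun o =>
              F ((o.1 != 0) == (b != 0)) := by
  simp only [Attack.play, Prog.out, ex_bind, ex_map, ex_pure]

/-- In the last hybrid every challenge is within 1/q of a completely random answer, and there are at
most T challenges because each one costs a step. The right-hand side involves b only in the final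
comparison. -/
theorem ex_play_le (A : Attack) {k T : ℕ} (hA : A.TimeLe P k n t T) {x : Fin n → ZMod P.q}
    (hx : GoodPoints x) (ht : 1 ≤ t) (a : Fin t → ZMod P.q) (F : Bool → ℝ≥0∞)
    (hF : ∀ o, F o ≤ 1) (b : ℕ) :
    (A.play k a x b (hybSampler P a t)).ex F ≤
      ((Prog.run (Q := .grp) (R := ansTy) P (keyOwner a x) A.phase1 (combinerInput k a x)).ex
        fun y => (Prog.run (Q := .list .nat) (R := .list ansTy) P (randomChallenger P n t)
          A.phase2 y.1.1).ex fun z =>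
            (Prog.run (Q := .grp) (R := ansTy) P (keyOwner a x) A.phase3 z.1).ex fun o =>
              F ((o.1 != 0) == (b != 0))) + T * (P.q : ℝ≥0∞)⁻¹ := by
  rw [ex_play, ← ex_const (Prog.run (Q := .grp) (R := ansTy) P (keyOwner a x) A.phase1
    (combinerInput k a x)) (T * (P.q : ℝ≥0∞)⁻¹), ← ex_add]
  refine ex_mono_of_support _ fun y hy => ?_
  refine (Prog.ex_run_le (P := P) (Q := .list .nat) (R := .list ansTy)
    (O' := randomChallenger P n t)
    (ex_challenger_le hx ht a le_rfl (A.choice P b y.1.2)) A.phase2 y.1.1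
    (fun z => (Prog.run (Q := .grp) (R := ansTy) P (keyOwner a x) A.phase3 z).ex fun o =>
              F ((o.1 != 0) == (b != 0))) fun z => ex_le_of_le _ fun o _ => hF _).trans ?_
  rw [mul_comm (T : ℝ≥0∞)]
  gcongr
  refine ex_le_of_le _ fun z hz => ?_
  obtain ⟨o, c₃, r₃⟩ := exists_steps (P := P) (Q := .grp) (R := ansTy) (keyOwner a x) A.phase3 z.1
  have := hA a x (keyOwner a x) (keyOwner a x)
    (fun y => challenger t x (hybSampler P a t) (A.choice P b y))
    (fun _ _ => length_keyOwner) (fun _ _ _ => length_challenger) (fun _ _ => length_keyOwner)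
    y.1 z.1 o y.2 z.2 c₃ hy hz r₃
  exact_mod_cast (show z.2 ≤ T by omega)

theorem ex_uniformBelow_two (f : ℕ → ℝ≥0∞) : (uniformBelow 2).ex f = 2⁻¹ * (f 0 + f 1) := by
  rw [uniformBelow_eq_map_fin, ex_map, ex_unif]
  simp

theorem game_le (A : Attack) {k T : ℕ} (hA : A.TimeLe P k n t T) (ht : 1 ≤ t) (b' : Bool) :
    A.game k n t t P b' ≤ 2⁻¹ + ((T + (n + n * n) : ℕ) : ℝ≥0∞) * (P.q : ℝ≥0∞)⁻¹ := by
  classical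
  rw [apply_eq_ex, ex_game]
  have hF : ∀ o : Bool, (if o = b' then 1 else 0 : ℝ≥0∞) ≤ 1 := fun o => by split_ifs <;> simp
  -- For a fixed guess exactly one of the two bits is matched.
  have h2 : ∀ o : ℕ, (2⁻¹ : ℝ≥0∞) * ((if ((o != 0) == ((0 : ℕ) != 0)) = b' then 1 else 0) +
      (if ((o != 0) == ((1 : ℕ) != 0)) = b' then 1 else 0)) = 2⁻¹ := by
    intro o
    cases b' <;> cases o <;> simp
  have hgood : ∀ x : Fin n → ZMod P.q, ((unif (Fin t → ZMod P.q)).ex fun a =>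
      (uniformBelow 2).ex fun b => (A.play k a x b (hybSampler P a t)).ex
        fun o => if o = b' then 1 else 0) ≤ (if GoodPoints x then 0 else 1) +
          (2⁻¹ + T * (P.q : ℝ≥0∞)⁻¹) := by
    intro x
    by_cases hx : GoodPoints x
    · refine ex_le_of_le _ fun a _ => ?_
      refine (ex_mono _ fun b => ex_play_le A hA hx ht a _ hF b).trans ?_
      rw [ex_add, ex_const, if_pos hx, zero_add]
      gcongr
      -- No phase depends on the bit any more, so its draw can be moved behind all three of them.
      rw [ex_comm]
      refine ex_le_of_le _ fun y _ => ?_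
      rw [ex_comm]
      refine ex_le_of_le _ fun z _ => ?_
      rw [ex_comm]
      refine ex_le_of_le _ fun o _ => ?_
      rw [ex_uniformBelow_two]
      exact (h2 o.1).le
    · rw [if_neg hx]
      refine le_add_right (ex_le_of_le _ fun a _ => ex_le_of_le _ fun b _ => ex_le_of_le _
        fun o _ => hF o)
  refine (ex_mono _ hgood).trans ?_
  rw [ex_add, ex_const]
  refine (add_le_add_left (ex_not_goodPoints_le P n) _).trans_eq ?_
  push_cast
  ring

end ElGamal
end

noncomputable section

open scoped ENNReal

/-! ### Advantages -/

namespace PMF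

theorem add_bool_toReal (p : PMF Bool) : (p true).toReal + (p false).toReal = 1 := by
  rw [← ENNReal.toReal_add (p.apply_ne_top _) (p.apply_ne_top _)]
  have := p.tsum_coe
  rw [tsum_fintype, Fintype.sum_bool] at this
  rw [this, ENNReal.toReal_one]

/-- The one-sided bounds at the two outcomes are complementary because probabilities add up to 1, so
together they are two-sided. -/
theorem abs_sub_le_of_le {p p' : PMF Bool} {ε : ℝ≥0∞} (hε : ε ≠ ⊤)
    (h : ∀ b, p b ≤ p' b + ε) : |(p true).toReal - (p' true).toReal| ≤ ε.toReal := by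
  have h' : ∀ b, (p b).toReal ≤ (p' b).toReal + ε.toReal := fun b => by
    rw [← ENNReal.toReal_add (p'.apply_ne_top _) hε]
    exact ENNReal.toReal_mono (ENNReal.add_ne_top.2 ⟨p'.apply_ne_top _, hε⟩) (h b)
  have h1 := h' true
  have h2 := h' false
  have h3 := p.add_bool_toReal
  have h4 := p'.add_bool_toReal
  rw [abs_le]
  constructor <;> linarith

theorem bind_unif_apply {α : Type*} {ι : Type} [Fintype ι] [Nonempty ι] (p : PMF α) (g : α → ι → PMF Bool)
    (b : Bool) : ((p.bind fun x => (unif ι).bind (g x)) b).toReal =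
      (Fintype.card ι : ℝ)⁻¹ * ∑ i, ((p.bind fun x => g x i) b).toReal := by
  have h : (p.bind fun x => (unif ι).bind (g x)) b =
      (Fintype.card ι : ℝ≥0∞)⁻¹ * ∑ i, (p.bind fun x => g x i) b := by
    simp only [apply_eq_ex, ex_bind, ex_unif, ex_const_mul, ex_finset_sum]
  rw [h, ENNReal.toReal_mul, ENNReal.toReal_inv, ENNReal.toReal_natCast,
    ENNReal.toReal_sum fun i _ => apply_ne_top _ _]

end PMF

namespace ElGamal

open PMF

/-- Expectation of `1 / q`. -/
def meanInv (gen : ℕ → PMF GroupInst) (k : ℕ) : ℝ≥0∞ := (gen k).ex fun P => (P.q : ℝ≥0∞)⁻¹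

theorem meanInv_ne_top (gen : ℕ → PMF GroupInst) (k : ℕ) : meanInv gen k ≠ ⊤ := by
  refine ne_top_of_le_ne_top ENNReal.one_ne_top (ex_le_of_le _ fun P _ => ?_)
  rw [ENNReal.inv_le_one]
  exact_mod_cast P.prime.out.one_le

variable {gen : ℕ → PMF GroupInst} {k n t : ℕ}

theorem abs_bind_sub_le {p p' : GroupInst → PMF Bool} (c : ℕ)
    (h : ∀ P ∈ (gen k).support, ∀ b, p P b ≤ p' P b + c * (P.q : ℝ≥0∞)⁻¹) :
    |(((gen k).bind p) true).toReal - (((gen k).bind p') true).toReal| ≤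
      c * (meanInv gen k).toReal := by
  have h' := abs_sub_le_of_le (p := (gen k).bind p) (p' := (gen k).bind p')
    (ε := c * meanInv gen k)
    (ENNReal.mul_ne_top (ENNReal.natCast_ne_top c) (meanInv_ne_top gen k)) fun b => by
      rw [meanInv, ← ex_const_mul, apply_eq_ex, apply_eq_ex, ex_bind, ex_bind, ← ex_add]
      refine ex_mono_of_support _ fun P hP => ?_
      rw [← apply_eq_ex, ← apply_eq_ex]
      exact h P hP b
  rwa [ENNReal.toReal_mul, ENNReal.toReal_natCast] at h'

theorem ddhExp_eq {D : PlainProg ddhTy .nat} {k : ℕ} (f : (P : GroupInst) → ZMod P.q → ZMod P.q →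
      ZMod P.q → PMF Bool)
    (hD : ∀ P ∈ (gen k).support, ∀ α β γ,
      PlainProg.out P D (ddhInput P k (P.gpow α) (P.gpow β) (P.gpow γ)) =
        (f P α β γ).bind fun o => PMF.pure (if o then 1 else 0)) (real : Bool) :
    ddhExp gen D k real 1 = ((gen k).bind fun P => (unif (ZMod P.q)).bind fun α =>
      (unif (ZMod P.q)).bind fun β => (unif (ZMod P.q)).bind fun γ =>
        f P α β (if real then α * β else γ)) true := by
  rw [apply_eq_ex, apply_eq_ex, ddhExp, ex_bind, ex_bind]
  refine ex_congr_of_support _ fun P hP => ?_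
  simp only [ex_bind]
  congr 1; funext α; congr 1; funext β; congr 1; funext γ
  have h := hD P hP α β (if real then α * β else γ)
  rw [PlainProg.out, Prog.out] at h
  rw [PlainProg.run, h, ex_bind]
  congr 1; funext o
  cases o <;> simp [ex_pure]

/-- The real experiment averages p_0, …, p_{t-1} and the ideal one averages p_1, …, p_t up to the
mean of 1/q. Their difference telescopes to (p_0 - p_t)/t, and p_t is close to 1/2 by `game_le`. -/
theorem abs_game_sub_le (A : Attack) (hn : 1 ≤ t) {T : ℕ} {D : PlainProg ddhTy .nat} [NeZero t]
    (hD : ∀ P ∈ (gen k).support, ∀ α β γ,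
      PlainProg.out P D (ddhInput P k (P.gpow α) (P.gpow β) (P.gpow γ)) =
        (A.ddhGame k n t α β γ).bind fun o => PMF.pure (if o then 1 else 0))
    (hA : ∀ P ∈ (gen k).support, A.TimeLe P k n t T) :
    |(((gen k).bind (A.game k n t 0)) true).toReal - 1 / 2| ≤
      t * (ddhAdvantage gen D k + (meanInv gen k).toReal) +
        ((T + (n + n * n) : ℕ) : ℝ) * (meanInv gen k).toReal := by
  set ε := (meanInv gen k).toReal
  let p : ℕ → ℝ := fun i => (((gen k).bind (A.game k n t i)) true).toReal
  have ht : (0 : ℝ) < t := by exact_mod_cast hn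
  have hreal : (ddhExp gen D k true 1).toReal = (t : ℝ)⁻¹ * ∑ i : Fin t, p i := by
    have h := bind_unif_apply (gen k) (fun P (i : Fin t) => A.game k n t i P) true
    rw [Fintype.card_fin] at h
    rw [← h, ddhExp_eq (fun P α β γ => A.ddhGame k n t α β γ) hD true]
    congr 2
    congr 1
    funext P
    refine ext_of_ex fun F => ?_
    simp only [ex_bind, if_true, ex_const]
    rw [ex_comm]
    refine Eq.trans ?_ (ex_const (unif (ZMod P.q)) _)
    congr 1
    funext β
    rw [← ex_ddhGame_mul A k β F]
    simp only [mul_comm]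
  have hideal : |(ddhExp gen D k false 1).toReal - (t : ℝ)⁻¹ * ∑ i : Fin t, p (i + 1)| ≤ ε := by
    have h := bind_unif_apply (gen k) (fun P (i : Fin t) => A.game k n t (i + 1) P) true
    rw [Fintype.card_fin] at h
    rw [← h, ddhExp_eq (fun P α β γ => A.ddhGame k n t α β γ) hD false]
    refine (abs_bind_sub_le 1 fun P hP b => ?_).trans_eq (by rw [Nat.cast_one, one_mul])
    rw [apply_eq_ex, apply_eq_ex, Nat.cast_one, one_mul]
    simp only [ex_bind, Bool.false_eq_true, if_false]
    exact ex_ddhGame_le A k _ fun o => by split_ifs <;> simp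
  have hlast : |p t - 1 / 2| ≤ ((T + (n + n * n) : ℕ) : ℝ) * ε := by
    have h : (((gen k).bind fun _ => unif Bool) true).toReal = 1 / 2 := by
      rw [PMF.bind_const, PMF.uniformOfFintype_apply, ENNReal.toReal_inv]
      simp
    rw [← h]
    refine abs_bind_sub_le _ fun P hP b => ?_
    refine (game_le A (hA P hP) hn b).trans_eq ?_
    rw [PMF.uniformOfFintype_apply, Fintype.card_bool]
    rfl
  have hsum : (∑ i : Fin t, p i) - ∑ i : Fin t, p (i + 1) = p 0 - p t := by
    rw [Fin.sum_univ_eq_sum_range p, Fin.sum_univ_eq_sum_range (fun i => p (i + 1)),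
      ← Finset.sum_sub_distrib, Finset.sum_range_sub']
  have hadv : ddhAdvantage gen D k = |(t : ℝ)⁻¹ * (∑ i : Fin t, p i) -
      (ddhExp gen D k false 1).toReal| := by rw [ddhAdvantage, hreal]
  have h0t : |p 0 - p t| ≤ t * (ddhAdvantage gen D k + ε) := by
    have h : p 0 - p t = t * (((t : ℝ)⁻¹ * (∑ i : Fin t, p i) -
        (ddhExp gen D k false 1).toReal) + ((ddhExp gen D k false 1).toReal -
          (t : ℝ)⁻¹ * ∑ i : Fin t, p (i + 1))) := by
      rw [← hsum]
      field_simp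
      ring
    rw [h, abs_mul, abs_of_pos ht, hadv]
    gcongr
    exact (abs_add_le _ _).trans (by gcongr)
  calc |p 0 - 1 / 2| = |(p 0 - p t) + (p t - 1 / 2)| := by ring_nf
    _ ≤ _ := (abs_add_le _ _).trans (add_le_add h0t hlast)

end ElGamal
end

noncomputable section

open scoped ENNReal

/-! ### The two games as attacks -/

namespace ElGamal

open PMF

variable {gen : ℕ → PMF GroupInst} {P : GroupInst} {n t : ℕ}

theorem publicKey_mem_support (a : Fin t → ZMod P.q) (x : Fin n → ZMod P.q) :
    ((publicKey P a x, fun i => share a (x i)) : pkTy.val P × (Fin n → ZMod P.q)) ∈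
      (KG P n t).support := by
  simp only [KG, PMF.mem_support_bind_iff, PMF.mem_support_map_iff]
  exact ⟨a, by simp, x, by simp, rfl⟩

/-- The first component determines r, and then m can be solved from the second. -/
theorem mem_support_enc (pk : pkTy.val P) (hpk : pk.2.2.1 = P.g) (c : P.G × P.G) :
    ∃ m, c ∈ (Enc P pk m).support := by
  obtain ⟨r, hr⟩ := P.gpow_surjective c.1
  refine ⟨c.2 * (pk.2.2.2.1 ^ r.val)⁻¹, ?_⟩
  rw [Enc, PMF.mem_support_map_iff]
  refine ⟨r, by simp, Prod.ext ?_ (inv_mul_cancel_right _ _)⟩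
  rw [← hr, hpk]
  rfl

/-- Every pair of group elements is a possible ciphertext, and every group element is a possible
share, namely a power of g itself. Hence well-formedness only restricts the number of shares. The
condition n ≥ 1 supplies a server. -/
theorem wellFormed (hn : 1 ≤ n) {r : ansTy.val P} (hr : r.2.length = n) :
    (elGamal gen).WellFormed P n t r := by
  have hK := publicKey_mem_support (P := P) (0 : Fin t → ZMod P.q) (0 : Fin n → ZMod P.q)
  refine ⟨⟨_, hK, mem_support_enc _ rfl r.1⟩, hr, fun d _ => ?_⟩
  obtain ⟨s, hs⟩ := P.gpow_surjective d
  obtain ⟨m, hm⟩ := mem_support_enc (publicKey P (0 : Fin t → ZMod P.q) (0 : Fin n → ZMod P.q)) rfl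
    (P.gpow 1, 1)
  refine ⟨_, hK, m, _, hm, ⟨0, hn⟩, s, ?_⟩
  change d = P.gpow 1 ^ s.val
  rw [P.gpow_pow_val, one_mul, hs]

/-- The attack of a combiner. -/
def attackOf {X : Ty} (A : (elGamal gen).Combiner X) (choose : Tame (.prod .nat X) (.prod .grp .nat))
    (choice : (P : GroupInst) → ℕ → X.val P → P.G × ℕ)
    (h : ∀ P N x, choose.eval P N x = PMF.pure (choice P x.1 x.2)) : Attack where
  σ := A.σ
  τ := A.τ
  X := X
  phase1 := A.phase1
  phase2 := A.phase2
  phase3 := A.phase3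
  choose := choose
  choice := choice
  eval_choose := h

theorem timeLe_attackOf {X : Ty} {A : (elGamal gen).Combiner X} {n t : ℕ → ℕ}
    (hA : A.PolyTime n t) (hn : ∀ k, 1 ≤ n k) : ∃ T : Polynomial ℕ,
      ∀ k, ∀ P ∈ (gen k).support, ∀ choose choice h,
        (attackOf A choose choice h).TimeLe P k (n k) (t k) (T.eval k) := by
  obtain ⟨T, hT⟩ := hA
  refine ⟨T, fun k P hP choose choice h a x O₁ O₃ O₂ h₁ h₂ h₃ y z o c₁ c₂ c₃ r₁ r₂ r₃ => ?_⟩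
  refine hT k P hP _ (publicKey_mem_support a x) O₁ O₂ O₃
    (fun m r hr => wellFormed (hn k) (h₁ m r hr))
    (fun m L l hl => ⟨(h₂ m L l hl).1, fun r hr => wellFormed (hn k) ((h₂ m L l hl).2 r hr)⟩)
    (fun m r hr => wellFormed (hn k) (h₃ m r hr)) (o != 0, c₁ + c₂ + c₃) ?_
  unfold TEScheme.Combiner.run
  rw [PMF.mem_support_bind_iff]
  refine ⟨(y, c₁), r₁, ?_⟩
  rw [PMF.mem_support_bind_iff]
  refine ⟨(z, c₂), r₂, ?_⟩
  rw [PMF.mem_support_map_iff]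
  exact ⟨(o, c₃), r₃, rfl⟩

theorem unif_bool_bind {α : Type*} (f : Bool → PMF α) :
    (unif Bool).bind f = (uniformBelow 2).bind fun b => f (b != 0) := by
  refine ext_of_ex fun F => ?_
  rw [ex_bind, ex_bind, ex_uniformBelow_two, ex_unif, Fintype.sum_bool]
  simp [add_comm]

/-- The real game is hybrid 0: no coefficient is masked, so the exponents in challenges are the true
r a_j. -/
theorem game_eq {X : Ty} {A : (elGamal gen).Combiner X} {choose} {choice} {h}
    (chal : (P : GroupInst) → pkTy.val P → (Fin n → ZMod P.q) → Bool → X.val P → List ℕ →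
      PMF (ansTy.val P))
    (hchal : ∀ P (a : Fin t → ZMod P.q) (x : Fin n → ZMod P.q) (b : ℕ) y L,
      chal P (publicKey P a x) (fun i => share a (x i)) (b != 0) y L = (hybSampler P a 0).bind
        (answerOf x (choice P b y).1 (if (choice P b y).2 = 0 then L else []))) (k : ℕ) :
    (elGamal gen).game A k n t chal = (gen k).bind ((attackOf A choose choice h).game k n t 0) := by
  unfold TEScheme.game
  refine congrArg₂ PMF.bind rfl (funext fun P => ?_)
  refine (PMF.bind_bind _ _ _).trans (congrArg₂ PMF.bind rfl (funext fun a => ?_))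
  refine (PMF.bind_map _ _ _).trans (congrArg₂ PMF.bind rfl (funext fun x => ?_))
  refine (unif_bool_bind _).trans (congrArg₂ PMF.bind rfl (funext fun b => ?_))
  have hS : (elGamal gen).oracleS P (publicKey P a x) (fun i => share a (x i)) = keyOwner a x :=
    funext fun m => oracleS_eq gen a x m
  have hC : ∀ y, (elGamal gen).challenge P n t
      (chal P (publicKey P a x) (fun i => share a (x i)) (b != 0) y) =
        challenger t x (hybSampler P a 0) (choice P b y) := by
    intro y
    funext L
    unfold TEScheme.challenge
    rw [challenger, hchal]
    rfl
  refine Eq.trans (b := ((A.run P (keyOwner a x)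
    (fun y => challenger t x (hybSampler P a 0) (choice P b y)) (keyOwner a x)
      (combinerInput k a x)).map fun o => o.1 == (b != 0))) ?_ ?_
  · rw [← hS, ← funext hC]
    rfl
  · refine ext_of_ex fun F => ?_
    rw [ex_play, ex_map]
    unfold TEScheme.Combiner.run
    rw [ex_bind]
    simp only [ex_bind, ex_map]
    rfl

/-- The instructions that choose the message in the first game. -/
def chooseMessage : Tame (.prod .nat (.prod .grp .grp)) (.prod .grp .nat) :=
  .pair (.ite .snd .fst) (.lit 0)

theorem eval_chooseMessage (P : GroupInst) (N : ℕ) (x : (Ty.prod .nat (.prod .grp .grp)).val P) :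
    chooseMessage.eval P N x = PMF.pure (if (x.1 : ℕ) = 0 then x.2.1 else x.2.2, (0 : ℕ)) := by
  obtain ⟨b, y⟩ := x
  cases b <;> simp [chooseMessage, Tame.eval, PMF.pure_bind]

/-- The instructions that choose the challenge in the second game. -/
def chooseFlag : Tame (.prod .nat .grp) (.prod .grp .nat) := .pair .snd .fst

theorem eval_chooseFlag (P : GroupInst) (N : ℕ) (x : (Ty.prod .nat .grp).val P) :
    chooseFlag.eval P N x = PMF.pure (x.2, x.1) := by
  simp [chooseFlag, Tame.eval, PMF.pure_bind]

theorem game1_eq (A : (elGamal gen).Combiner (.prod .grp .grp)) (k : ℕ) :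
    (elGamal gen).game1 A k n t = (gen k).bind ((attackOf A chooseMessage
      (fun _ b y => (if b = 0 then y.1 else y.2, 0)) eval_chooseMessage).game k n t 0) := by
  refine game_eq _ (fun P a x b y L => ?_) k
  refine (oracleI_eq gen a x _ L).trans ?_
  cases b <;> rfl

theorem game2_eq (A : (elGamal gen).Combiner .grp) (k : ℕ) :
    (elGamal gen).game2 A k n t = (gen k).bind ((attackOf A chooseFlag
      (fun _ b y => (y, b)) eval_chooseFlag).game k n t 0) := by
  refine game_eq _ (fun P a x b y L => ?_) k
  cases b
  · exact oracleI_eq gen a x y L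
  · exact oracleF_eq gen a x y

end ElGamal
end

noncomputable section

open scoped ENNReal

/-! ### Polynomial time computations -/

theorem Nat.size_le_self (n : ℕ) : Nat.size n ≤ n := Nat.size_le.2 Nat.lt_two_pow_self

/-- The distinguisher has to compute its own loop bound N, a polynomial in k. Monomials are built by
repeated multiplication; bit lengths are crudely bounded by the values. -/
theorem polyTimeComputable_eval (T : Polynomial ℕ) : PolyTimeComputable fun k => T.eval k := by
  have lit : ∀ c : ℕ, ∃ (p : PlainProg .nat .nat) (S : Polynomial ℕ), ∀ (k : ℕ) (P : GroupInst),
      ∀ y s, PlainProg.Steps P p k y s → y = c ∧ s ≤ S.eval k := by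
    intro c
    refine ⟨.lit c, Polynomial.C (1 + Nat.size c), fun k P y s h => ?_⟩
    rw [PlainProg.Steps, Prog.steps_lit_iff] at h
    simp [h.1, h.2]
  have op : ∀ (o : Arith) (T₁ T₂ : Polynomial ℕ) (p₁ p₂ : PlainProg .nat .nat)
      (S₁ S₂ : Polynomial ℕ),
      (∀ (k : ℕ) (P : GroupInst), ∀ y s, PlainProg.Steps P p₁ k y s →
        y = T₁.eval k ∧ s ≤ S₁.eval k) →
      (∀ (k : ℕ) (P : GroupInst), ∀ y s, PlainProg.Steps P p₂ k y s →
        y = T₂.eval k ∧ s ≤ S₂.eval k) →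
      ∃ (p : PlainProg .nat .nat) (S : Polynomial ℕ), ∀ (k : ℕ) (P : GroupInst),
        ∀ y s, PlainProg.Steps P p k y s → y = o.eval (T₁.eval k) (T₂.eval k) ∧ s ≤ S.eval k := by
    intro o T₁ T₂ p₁ p₂ S₁ S₂ h₁ h₂
    refine ⟨.comp (.pair p₁ p₂) (.arith o), S₁ + S₂ + T₁ + T₂ + 3, fun k P y s h => ?_⟩
    rw [PlainProg.Steps, Prog.steps_comp_iff] at h
    obtain ⟨⟨y₁, y₂⟩, _, _, hp, ho, rfl⟩ := h
    obtain ⟨s₁, s₂, hs₁, hs₂, rfl⟩ := Prog.steps_pair_iff.1 hp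
    obtain ⟨rfl, rfl⟩ := Prog.steps_arith_iff.1 ho
    obtain ⟨e₁, l₁⟩ := h₁ k P _ _ hs₁
    obtain ⟨e₂, l₂⟩ := h₂ k P _ _ hs₂
    change y₁ = _ at e₁
    change y₂ = _ at e₂
    subst e₁ e₂
    refine ⟨rfl, ?_⟩
    have := Nat.size_le_self (T₁.eval k)
    have := Nat.size_le_self (T₂.eval k)
    simp only [Polynomial.eval_add, Polynomial.eval_ofNat]
    omega
  suffices ∃ (p : PlainProg .nat .nat) (S : Polynomial ℕ), ∀ (k : ℕ) (P : GroupInst),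
      ∀ y s, PlainProg.Steps P p k y s → y = T.eval k ∧ s ≤ S.eval k by
    obtain ⟨p, S, h⟩ := this
    exact ⟨p, S, fun k P o ho => h k P o.1 o.2 ho⟩
  induction T using Polynomial.induction_on with
  | C a => simpa using lit a
  | add f g hf hg =>
    obtain ⟨p₁, S₁, h₁⟩ := hf
    obtain ⟨p₂, S₂, h₂⟩ := hg
    simpa [Arith.eval] using op .add f g p₁ p₂ S₁ S₂ h₁ h₂
  | monomial n a hf =>
    obtain ⟨p₁, S₁, h₁⟩ := hf
    have := op .mul (Polynomial.C a * Polynomial.X ^ n) Polynomial.X p₁ .id S₁ 1 h₁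
      fun k P y s h => by
        obtain ⟨rfl, rfl⟩ := Prog.steps_id_iff.1 h
        simp
    simpa [Arith.eval, pow_succ, mul_assoc] using this

theorem PlainProg.out_eq_pure {P : GroupInst} {a b : Ty} {p : PlainProg a b} {x : a.val P}
    {y : b.val P} (h : ∀ o ∈ (p.run P x).support, o.1 = y) : p.out P x = PMF.pure y := by
  change (p.run P x).map Prod.fst = _
  rw [ElGamal.map_eq_bind_pure, PMF.bind_congr_of_support _ fun o ho => by rw [h o ho],
    PMF.bind_const]

/-- The q elements have different representations of at most N bits. -/
theorem GroupInst.q_le (P : GroupInst) {N : ℕ} (h : P.EncLe N) : P.q ≤ 2 ^ N := by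
  have := P.finite
  rw [← P.card_eq]
  have hf : Function.Injective fun x : P.G => (⟨P.enc x, Nat.size_le.1 (h x)⟩ : Fin (2 ^ N)) :=
    fun x y hxy => P.enc_injective (Fin.mk.inj_iff.1 hxy)
  simpa using Nat.card_le_card_of_injective _ hf

namespace ElGamal

open PMF

variable {gen : ℕ → PMF GroupInst}

theorem exists_distinguisher (hgen : PolySize gen) {n t : ℕ → ℕ} (hn : PolyTimeComputable n)
    (ht : PolyTimeComputable t) (hbound : ∃ B : Polynomial ℕ, ∀ k, n k ≤ B.eval k)
    (htn : ∀ k, 1 ≤ t k ∧ t k ≤ n k) (A : Attack) (T : Polynomial ℕ)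
    (hA : ∀ k, ∀ P ∈ (gen k).support, A.TimeLe P k (n k) (t k) (T.eval k)) :
    ∃ D : PlainProg ddhTy .nat,
      (∃ S : Polynomial ℕ, ∀ k, ∀ P ∈ (gen k).support, ∀ x y z : P.G,
        ∀ o ∈ (D.run P (ddhInput P k x y z)).support, o.2 ≤ S.eval k) ∧
      ∀ k [NeZero (t k)], ∀ P ∈ (gen k).support, ∀ α β γ,
        PlainProg.out P D (ddhInput P k (P.gpow α) (P.gpow β) (P.gpow γ)) =
          (A.ddhGame k (n k) (t k) α β γ).bind fun o => PMF.pure (if o then 1 else 0) := by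
  obtain ⟨E, hE⟩ := hgen
  obtain ⟨B, hB⟩ := hbound
  obtain ⟨pn, Sn, hpn⟩ := hn
  obtain ⟨pt, St, hpt⟩ := ht
  -- N dominates the length of representations, which gives q ≤ 2^N, and the bound on n, which gives
  -- n, t ≤ N.
  obtain ⟨pN, SN, hpN⟩ := polyTimeComputable_eval (E + B + 2)
  obtain ⟨S, hS⟩ := steps_distinguish A
  have hq : ∀ k, ∀ P ∈ (gen k).support, P.q ≤ 2 ^ (E + B + 2).eval k := fun k P hP =>
    P.q_le fun x => ((hE k P hP).2 x).trans (by
      simp only [Polynomial.eval_add, Polynomial.eval_ofNat]; omega)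
  have hnN : ∀ k, n k ≤ (E + B + 2).eval k := fun k => (hB k).trans (by
    simp only [Polynomial.eval_add, Polynomial.eval_ofNat]; omega)
  refine ⟨.comp (.pair (.comp .fst pN) (.pair (.comp .fst pn) (.pair (.comp .fst pt) .id)))
    (distinguish A), ⟨SN + Sn + St + S.comp (E + B + 3 + Polynomial.X + T) + 20, ?_⟩, ?_⟩
  · rintro k P hP X Y Z ⟨o, c⟩ hc
    obtain ⟨α, rfl⟩ := P.gpow_surjective X
    obtain ⟨β, rfl⟩ := P.gpow_surjective Y
    obtain ⟨γ, rfl⟩ := P.gpow_surjective Z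
    obtain ⟨⟨N, n', t', x⟩, _, s, hp, hd, rfl⟩ := Prog.steps_comp_iff.1 hc
    obtain ⟨_, _, hsN, hp₁, rfl⟩ := Prog.steps_pair_iff.1 hp
    obtain ⟨_, _, hsn, hp₂, rfl⟩ := Prog.steps_pair_iff.1 hp₁
    obtain ⟨_, _, hst, hp₃, rfl⟩ := Prog.steps_pair_iff.1 hp₂
    obtain ⟨hx, rfl⟩ := Prog.steps_id_iff.1 hp₃
    obtain ⟨kN, _, _, hfN, hsN', rfl⟩ := Prog.steps_comp_iff.1 hsN
    obtain ⟨hkN, rfl⟩ := Prog.steps_fst_iff.1 hfN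
    rw [show kN = k from hkN] at hsN'
    obtain ⟨kn, _, _, hfn, hsn', rfl⟩ := Prog.steps_comp_iff.1 hsn
    obtain ⟨hkn, rfl⟩ := Prog.steps_fst_iff.1 hfn
    rw [show kn = k from hkn] at hsn'
    obtain ⟨kt, _, _, hft, hst', rfl⟩ := Prog.steps_comp_iff.1 hst
    obtain ⟨hkt, rfl⟩ := Prog.steps_fst_iff.1 hft
    rw [show kt = k from hkt] at hst'
    obtain ⟨eN, lN⟩ := hpN k P (_, _) hsN'
    obtain ⟨en, ln⟩ := hpn k P (_, _) hsn'
    obtain ⟨et, lt⟩ := hpt k P (_, _) hst'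
    change N = _ at eN
    change n' = _ at en
    change t' = _ at et
    change x = ddhInput P k (P.gpow α) (P.gpow β) (P.gpow γ) at hx
    subst eN en et hx
    have hM : (E + B + 3 + Polynomial.X + T).eval k = E.eval k + B.eval k + 3 + k + T.eval k := by
      simp
    have hN : (E + B + 2).eval k = E.eval k + B.eval k + 2 := by simp
    have := Nat.size_le_self k
    -- The size bound M adds to N the contributions of k and of the running time T of the attack;
    -- its constant 3 instead of 2 accounts for q, which may have N + 1 bits.
    have hd' := hS P _ ((E + B + 3 + Polynomial.X + T).eval k) k (n k) (t k)
      ⟨by omega, by omega, fun x => ((hE k P hP).2 x).trans (by omega)⟩ (hq k P hP) (hnN k)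
      ((htn k).2.trans (hnN k)) (htn k).1 (by omega) ((hE k P hP).1.trans (by omega))
      ((Nat.size_le_size (hq k P hP)).trans (by rw [Nat.size_pow]; omega))
      (fun a x O₁ O₃ O₂ h₁ h₂ h₃ y z o c₁ c₂ c₃ r₁ r₂ r₃ =>
        (hA k P hP a x O₁ O₃ O₂ h₁ h₂ h₃ y z o c₁ c₂ c₃ r₁ r₂ r₃).trans (by omega))
      α β γ o s hd
    simp only at lN ln lt
    simp only [Polynomial.eval_add, Polynomial.eval_ofNat, Polynomial.eval_comp] at hd' ⊢
    omega
  · intro k _ P hP α β γ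
    have hN := PlainProg.out_eq_pure fun o ho => (hpN k P o ho).1
    have hn := PlainProg.out_eq_pure fun o ho => (hpn k P o ho).1
    have ht := PlainProg.out_eq_pure fun o ho => (hpt k P o ho).1
    refine Eq.trans ?_ ((out_distinguish A (hq k P hP) (hnN k) ((htn k).2.trans (hnN k)) k α β
      γ).trans ?_)
    · rw [PlainProg.out, Prog.out_comp]
      refine Eq.trans (congrArg₂ PMF.bind (x' := PMF.pure ((E + B + 2).eval k, (n k, (t k,
        ddhInput P k (P.gpow α) (P.gpow β) (P.gpow γ))))) ?_ rfl) (PMF.pure_bind _ _)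
      simp only [Prog.out_pair, Prog.out_comp, Prog.out_fst, Prog.out_id, PMF.pure_bind]
      refine (congrArg₂ PMF.bind hN rfl).trans ?_
      rw [PMF.pure_bind]
      refine (congrArg₂ PMF.bind (congrArg₂ PMF.bind hn rfl) rfl).trans ?_
      rw [PMF.pure_bind]
      refine (congrArg₂ PMF.bind (congrArg₂ PMF.bind (congrArg₂ PMF.bind ht rfl) rfl) rfl).trans ?_
      simp only [PMF.pure_bind]
    · simp only [Attack.ddhGame, PMF.bind_bind]

/-! ### The mean of 1/q is negligible -/

/-- The test whether the third component of an instance is trivial. -/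
def isOne : PlainProg ddhTy .nat :=
  .comp (.pair (.lit 0) (.pair (.comp (.comp .snd (.comp .snd (.comp .snd .snd))) .enc)
    (.comp .gone .enc))) Tame.natEq.compile

theorem out_isOne {P : GroupInst} (k : ℕ) (α β γ : ZMod P.q) :
    PlainProg.out P isOne (ddhInput P k (P.gpow α) (P.gpow β) (P.gpow γ)) =
      (PMF.pure (decide (γ = 0))).bind fun o => PMF.pure (if o then 1 else 0) := by
  have h : P.enc (P.gpow γ) = P.enc 1 ↔ γ = 0 := by
    rw [P.enc_injective.eq_iff, ← P.gpow_zero, P.gpow_injective.eq_iff]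
  simp only [isOne, PlainProg.out, Prog.out_comp, Prog.out_pair, Prog.out_lit, Prog.out_snd,
    Prog.out_gone, Prog.out_enc, PMF.pure_bind]
  -- The loop bound may be 0, since the equality test contains no loop.
  refine (Tame.out_compile P 0 _ _).trans ((Tame.eval_natEq _).trans ?_)
  simp only [decide_eq_true_eq, ← h]
  rfl

theorem steps_isOne (hgen : PolySize gen) : ∃ S : Polynomial ℕ, ∀ k, ∀ P ∈ (gen k).support,
    ∀ x y z : P.G, ∀ o ∈ (isOne.run P (ddhInput P k x y z)).support, o.2 ≤ S.eval k := by
  obtain ⟨E, hE⟩ := hgen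
  obtain ⟨S, hS⟩ := Tame.natEq.steps_compile'
  refine ⟨S.comp (E + 2) + 2 * E + 30, ?_⟩
  rintro k P hP X Y Z ⟨o, c⟩ hc
  obtain ⟨⟨N, u, v⟩, _, s, hp, hd, rfl⟩ := Prog.steps_comp_iff.1 hc
  obtain ⟨_, _, hs₀, hp₁, rfl⟩ := Prog.steps_pair_iff.1 hp
  obtain ⟨hN, rfl⟩ := Prog.steps_lit_iff.1 hs₀
  change N = 0 at hN
  subst hN
  obtain ⟨_, _, hs₁, hs₂, rfl⟩ := Prog.steps_pair_iff.1 hp₁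
  obtain ⟨Z', _, _, hs₁', he₁, rfl⟩ := Prog.steps_comp_iff.1 hs₁
  obtain ⟨hu, rfl⟩ := Prog.steps_enc_iff.1 he₁
  simp only [Prog.steps_comp_iff, Prog.steps_snd_iff] at hs₁'
  obtain ⟨_, _, _, ⟨-, rfl⟩, ⟨_, _, _, ⟨-, rfl⟩, ⟨_, _, _, ⟨-, rfl⟩, ⟨-, rfl⟩, rfl⟩, rfl⟩, rfl⟩ :=
    hs₁'
  obtain ⟨W', _, _, hs₂', he₂, rfl⟩ := Prog.steps_comp_iff.1 hs₂
  obtain ⟨hv, rfl⟩ := Prog.steps_enc_iff.1 he₂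
  obtain ⟨-, rfl⟩ := Prog.steps_gone_iff.1 hs₂'
  change u = _ at hu
  change v = _ at hv
  subst hu hv
  have h₁ := (hE k P hP).2 Z'
  have h₂ := (hE k P hP).2 W'
  have hM : (E + 2).eval k = E.eval k + 2 := by simp
  obtain ⟨-, l, -⟩ := hS P 0 ((E + 2).eval k) ⟨by omega, by omega,
    fun x => ((hE k P hP).2 x).trans (by omega)⟩ (P.enc Z', P.enc W') _ _
    ⟨h₁.trans (by omega), h₂.trans (by omega)⟩ hd
  simp only [Polynomial.eval_add, Polynomial.eval_ofNat, Polynomial.eval_comp,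
    Polynomial.eval_mul, Nat.size_zero] at l ⊢
  omega

/-- For fixed q, a uniform γ vanishes with probability 1/q, while αβ vanishes with probability 2/q -
1/q². As q ≥ 2, the latter is at least 2/q - 1/(2q), so the test has advantage at least half the
mean of 1/q. -/
theorem meanInv_le (k : ℕ) : (meanInv gen k).toReal ≤ 2 * ddhAdvantage gen isOne k := by
  have hr := ddhExp_eq (gen := gen) (k := k) _ (fun P _ => out_isOne k) true
  have hi := ddhExp_eq (gen := gen) (k := k) _ (fun P _ => out_isOne k) false
  have hc : ∀ P : GroupInst, ((unif (ZMod P.q)).ex fun γ => if γ = 0 then 1 else 0) =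
      (P.q : ℝ≥0∞)⁻¹ := fun P => by
    rw [ex_unif_eq (fun γ : ZMod P.q => γ = 0) (fun _ => Iff.rfl), ZMod.card]
  simp only [apply_eq_ex, ex_bind, ex_pure, decide_eq_true_eq, Bool.false_eq_true, if_false,
    if_true, ex_const, hc] at hi hr
  have h2 : meanInv gen k + meanInv gen k ≤ ddhExp gen isOne k true 1 + 2⁻¹ * meanInv gen k := by
    rw [apply_eq_ex, hr, meanInv, ← ex_const_mul, ← ex_add, ← ex_add]
    refine ex_mono _ fun P => ?_
    have hsq : ((unif (ZMod P.q)).ex fun α => (unif (ZMod P.q)).ex fun β =>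
        if α = 0 then (if β = 0 then 1 else 0) else 0) ≤ 2⁻¹ * (P.q : ℝ≥0∞)⁻¹ := by
      rw [← hc P, ← ex_const_mul]
      refine ex_mono _ fun α => ?_
      by_cases h : α = 0
      · simp only [h, if_true, hc, mul_one]
        exact ENNReal.inv_le_inv.2 (by exact_mod_cast P.prime.out.two_le)
      · simp [h, ex_const]
    refine le_trans ?_ (add_le_add_right hsq _)
    have h₁ : ((unif (ZMod P.q)).ex fun α => (unif (ZMod P.q)).ex fun _ =>
        if α = 0 then 1 else 0) = (P.q : ℝ≥0∞)⁻¹ := by simp only [ex_const, hc]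
    have h₂ : ((unif (ZMod P.q)).ex fun _ => (unif (ZMod P.q)).ex fun β =>
        if β = 0 then 1 else 0) = (P.q : ℝ≥0∞)⁻¹ := by simp only [ex_const, hc]
    rw [← ex_add]
    -- Inclusion and exclusion for the events α = 0 and β = 0, whose union is αβ = 0.
    refine le_of_eq_of_le (congrArg₂ (· + ·) h₁.symm h₂.symm) ?_
    rw [← ex_add]
    refine ex_mono _ fun α => ?_
    rw [← ex_add, ← ex_add]
    refine ex_mono _ fun β => ?_
    by_cases hα : α = 0 <;> by_cases hβ : β = 0 <;> simp [hα, hβ]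
  have h2' := ENNReal.toReal_mono (ENNReal.add_ne_top.2 ⟨apply_ne_top _ _,
    ENNReal.mul_ne_top (by simp) (meanInv_ne_top gen k)⟩) h2
  rw [ENNReal.toReal_add (meanInv_ne_top gen k) (meanInv_ne_top gen k),
    ENNReal.toReal_add (apply_ne_top _ _) (ENNReal.mul_ne_top (by simp) (meanInv_ne_top gen k)),
    ENNReal.toReal_mul, ENNReal.toReal_inv, ENNReal.toReal_ofNat] at h2'
  have hi' : ddhExp gen isOne k false 1 = meanInv gen k := by
    rw [apply_eq_ex, hi, meanInv]
  have h3 := le_abs_self ((ddhExp gen isOne k true 1).toReal -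
    (ddhExp gen isOne k false 1).toReal)
  rw [ddhAdvantage]
  rw [hi'] at h3 ⊢
  linarith

/-! ### Conclusion -/

theorem Negligible.polynomial_mul {f : ℕ → ℝ} (hf : Negligible f) (p : Polynomial ℕ) :
    Negligible fun k => ((p.eval k : ℕ) : ℝ) * f k := by
  refine (Asymptotics.SuperpolynomialDecay.polynomial_mul hf
    (p.map (Nat.castRingHom ℝ))).congr fun k => ?_
  simp [Polynomial.eval_natCast_map]

theorem negligible_attack (hgen : PolySize gen) (hDDH : DDH gen) {n t : ℕ → ℕ}
    (hn : PolyTimeComputable n)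
    (ht : PolyTimeComputable t) (hbound : ∃ B : Polynomial ℕ, ∀ k, n k ≤ B.eval k)
    (htn : ∀ k, 1 ≤ t k ∧ t k ≤ n k) (A : Attack) (T : Polynomial ℕ)
    (hA : ∀ k, ∀ P ∈ (gen k).support, A.TimeLe P k (n k) (t k) (T.eval k)) :
    Negligible fun k => |(((gen k).bind (A.game k (n k) (t k) 0)) true).toReal - 1 / 2| := by
  obtain ⟨D, hD, hout⟩ := exists_distinguisher hgen hn ht hbound htn A T hA
  obtain ⟨B, hB⟩ := hbound
  have hadv := hDDH D hD
  have hmean := hDDH isOne (steps_isOne hgen)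
  -- B bounds both n and t. The factor 2 comes from `meanInv_le`, the first B in the second
  -- polynomial from the t hybrid steps, and T + B + B² from the last hybrid.
  have hg := (Negligible.polynomial_mul hadv B).add
    (Negligible.polynomial_mul hmean (2 * (B + (T + (B + B * B)))))
  refine hg.trans_abs_le fun k => ?_
  have : NeZero (t k) := ⟨by have := htn k; omega⟩
  have h := abs_game_sub_le A (htn k).1 (hout k) (hA k)
  have hm := meanInv_le (gen := gen) k
  have hm0 : 0 ≤ (meanInv gen k).toReal := ENNReal.toReal_nonneg
  have ha0 : 0 ≤ ddhAdvantage gen D k := abs_nonneg _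
  have hnB : (n k : ℝ) ≤ ((B.eval k : ℕ) : ℝ) := by exact_mod_cast hB k
  have htB : (t k : ℝ) ≤ ((B.eval k : ℕ) : ℝ) := by exact_mod_cast (htn k).2.trans (hB k)
  rw [abs_abs]
  refine (h.trans ?_).trans (le_abs_self _)
  calc _ ≤ ((B.eval k : ℕ) : ℝ) * (ddhAdvantage gen D k + 2 * ddhAdvantage gen isOne k) +
        ((T.eval k + (B.eval k + B.eval k * B.eval k) : ℕ) : ℝ) *
          (2 * ddhAdvantage gen isOne k) := by
        gcongr <;> exact hB k
    _ = _ := by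
        simp only [Pi.add_apply, Polynomial.eval_add, Polynomial.eval_mul, Polynomial.eval_ofNat]
        push_cast
        ring

end ElGamal

theorem mainTheorem1 (gen : ℕ → PMF GroupInst) (hgen : PolySize gen) (hDDH : DDH gen)
    (n t : ℕ → ℕ) (hn : PolyTimeComputable n) (ht : PolyTimeComputable t)
    (hbound : ∃ B : Polynomial ℕ, ∀ k, n k ≤ B.eval k)
    (htn : ∀ k, 1 ≤ t k ∧ t k ≤ n k) :
    (elGamal gen).Equivocable n t := by
  have hn1 : ∀ k, 1 ≤ n k := fun k => (htn k).1.trans (htn k).2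
  refine ⟨fun A hA => ?_, fun A hA => ?_⟩
  · obtain ⟨T, hT⟩ := ElGamal.timeLe_attackOf hA hn1
    exact (ElGamal.negligible_attack hgen hDDH hn ht hbound htn _ T fun k P hP =>
      hT k P hP _ _ _).congr fun k => congrArg (fun p : PMF Bool => |(p true).toReal - 1 / 2|)
        (ElGamal.game1_eq A k).symm
  · obtain ⟨T, hT⟩ := ElGamal.timeLe_attackOf hA hn1
    exact (ElGamal.negligible_attack hgen hDDH hn ht hbound htn _ T fun k P hP =>
      hT k P hP _ _ _).congr fun k => congrArg (fun p : PMF Bool => |(p true).toReal - 1 / 2|)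
        (ElGamal.game2_eq A k).symm
end
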